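/- **Setting.** An interval is a pair $i=(s(i),f(i))\in\mathbb R^2$ with $s(i)<f(i)$. Intervals $i,j$ are compatible if $f(i)<s(j)$ or $f(j)<s(i)$, and overlap otherwise. A finite set $I$ of intervals is monotonic if no interval of $I$ contains a different one; its finishing times are then pairwise distinct, and "least", "next", etc. refer to the order by finishing time. The right compatible interval $\mathrm{rc}(i)$ is the least $j\in I$ with $f(j)>f(i)$ that is compatible with $i$. The greedy optimal set of $I$ consists of the least interval $m$ of $I$ and of $\mathrm{rc}(m),\mathrm{rc}(\mathrm{rc}(m)),\dots$ as long as these exist (it is empty if $I=\emptyset$). The input is a sequence $o_1,\dots,o_k$ of operations acting on a set $I$, initially empty: $\mathrm{insert}(i)$ with $i\notin I$ and $I\cup\{i\}$ monotonic, $\mathrm{remove}(i)$ with $i\in I$, and $\mathrm{query}(i)$ for any interval $i$, which has to return whether $i$ belongs to the greedy optimal set of the current $I$. **Data structure.** A height-balanced (AVL) search tree $T(I)$ of the intervals ordered by starting time, and a family of splay trees, with links to parents and children, that partition $I$; $ST_i$ is the splay tree containing $i$. Each splay tree stores the intervals of a path in the compatibility forest (the graph on $I$ with the edges $(i,\mathrm{rc}(i))$);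 the edges of these paths are called solid and the other edges of the forest dashed. Splay trees have the usual operations maximum, predecessor, find, split (splitting $ST_u$ before $u$) and join, each of which splays the node reached. $\mathrm{rc}(j)$ is found by one descent in $T(I)$. * $\mathsf{expose}(i)$: let $j=\max ST_i$; while $i'=\mathrm{rc}(j)$ exists, split $ST_{i'}$ before $i'$, join $ST_i$ with the part starting at $i'$, and let $j$ be the maximum of the resulting tree. * $\mathsf{queryMonCF}(i)$: let $m=\min T(I)$; return whether the search for $i$ in $ST_m$ finds $i$ (false if $I=\emptyset$). * $\mathsf{insertMonCF}(i)$: insert $i$ into $T(I)$, with a one-node splay tree; if the next interval $r$ of $i$ exists, has a predecessor $j$ in $ST_r$, and $j$ is compatible with $i$, then split $ST_r$ before $r$ (and, in one of two variants, join the tree of $j$ with that of $i$, making $(j,i)$ solid); finally expose $\min T(I)$. * $\mathsf{removeMonCF}(i)$: take $i$ out of $ST_i$, the intervals before and after $i$ becoming two separate trees; remove $i$ from $T(I)$; expose $\min T(I)$ if it exists. Running time is the number of steps, where each reading or writing of a splay tree record and each visit to a node (or empty subtree) of $T(I)$ is one step. **Theorem 1.** There is a constant $C$ such that, for either variant of $\mathsf{insertMonCF}$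 and every sequence of operations as above, executed with $\mathsf{queryMonCF}$, $\mathsf{insertMonCF}$, $\mathsf{removeMonCF}$ from the empty data structure: 1. all operations terminate, and every query is answered correctly; 2. at the end of the sequence (hence after each operation) $T(I)$ stores exactly the intervals of $I$ and, if $I\ne\emptyset$ and $m$ is its least interval, $ST_m$ consists exactly of the greedy optimal set of $I$; 3. insertions and removals take $O(\log^2 n)$ and queries $O(\log n)$ amortised time, where $n$ is the size of the current set: the total number of steps is at most $$C\Bigl(\sum_{t:\ o_t\text{ an insertion or removal}}\log_2^2(n_t+2)+\sum_{t:\ o_t\text{ a query}}\log_2(n_t+2)\Bigr),$$ where $n_t$ is the number of intervals just before $o_t$. -/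

import Mathlib

/-! ### Intervals and the dynamic monotonic interval scheduling problem -/

/-- An interval with starting time `s` and finishing time `f`. -/
@[ext] structure Ivl (α : Type) [LinearOrder α] where
  s : α
  f : α
  lt : s < f

instance {α : Type} [LinearOrder α] : DecidableEq (Ivl α) := fun i j =>
  decidable_of_iff (i.s = j.s ∧ i.f = j.f)
    ⟨fun h => Ivl.ext h.1 h.2, fun h => h ▸ ⟨rfl, rfl⟩⟩

namespace Ivl

variable {α : Type} [LinearOrder α]

/-- Two intervals are compatible if one ends strictly before the other starts; otherwise they
overlap. -/
def Compatible (i j : Ivl α) : Prop := i.f < j.s ∨ j.f < i.s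

instance (i j : Ivl α) : Decidable (Compatible i j) :=
  inferInstanceAs (Decidable (i.f < j.s ∨ j.f < i.s))

/-- `i` is contained in `j`. -/
def ContainedIn (i j : Ivl α) : Prop := j.s ≤ i.s ∧ i.f ≤ j.f

/-- No interval of `I` contains another interval of `I`. Such a set has pairwise distinct
starting times and pairwise distinct finishing times. -/
def Monotonic (I : Finset (Ivl α)) : Prop :=
  ∀ i ∈ I, ∀ j ∈ I, i ≠ j → ¬ ContainedIn i j

/-- `m` is the least interval of `I` with respect to the finishing times. -/
def IsLeastIn (I : Finset (Ivl α)) (m : Ivl α) : Prop :=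
  m ∈ I ∧ ∀ j ∈ I, m.f ≤ j.f

/-- `j` is the right compatible interval of `i` in `I`: the least interval of `I` that is
compatible with `i` and finishes after `i`. -/
def IsRightCompatible (I : Finset (Ivl α)) (i j : Ivl α) : Prop :=
  (j ∈ I ∧ Compatible i j ∧ i.f < j.f) ∧
    ∀ k ∈ I, Compatible i k → i.f < k.f → j.f ≤ k.f

/-- Membership in the greedy optimal set of `I`. -/
inductive Greedy (I : Finset (Ivl α)) : Ivl α → Prop
  | first (m : Ivl α) : IsLeastIn I m → Greedy I m
  | next (i j : Ivl α) : Greedy I i → IsRightCompatible I i j → Greedy I j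

end Ivl

/-- The operations of the dynamic problem. -/
inductive Op (α : Type) [LinearOrder α] where
  | insert (i : Ivl α)
  | remove (i : Ivl α)
  | query (i : Ivl α)

namespace Op

variable {α : Type} [LinearOrder α]

/-- The interval set after an operation. -/
def apply (I : Finset (Ivl α)) : Op α → Finset (Ivl α)
  | insert i => Insert.insert i I
  | remove i => I.erase i
  | query _ => I

/-- Only new intervals are inserted, monotonicity is kept, only present intervals are removed;
any interval may be queried. -/
def Admissible (I : Finset (Ivl α)) : Op α → Prop
  | insert i => i ∉ I ∧ Ivl.Monotonic (Insert.insert i I)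
  | remove i => i ∈ I
  | query _ => True

/-- Every operation of the sequence is admissible for the set on which it acts. -/
def AdmissibleSeq : Finset (Ivl α) → List (Op α) → Prop
  | _, [] => True
  | I, o :: os => Admissible I o ∧ AdmissibleSeq (apply I o) os

/-- The interval set after a sequence of operations. -/
def applySeq (I : Finset (Ivl α)) (os : List (Op α)) : Finset (Ivl α) :=
  os.foldl apply I

open Classical in
/-- The required output of an operation: updates return nothing, a query for `i` tells whether
`i` belongs to the greedy optimal set. -/
noncomputable def answer (I : Finset (Ivl α)) : Op α → Option Bool
  | insert _ => none
  | remove _ => none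
  | query i => some (decide (Ivl.Greedy I i))

/-- The required outputs of a sequence of operations. -/
noncomputable def answers : Finset (Ivl α) → List (Op α) → List (Option Bool)
  | _, [] => []
  | I, o :: os => answer I o :: answers (apply I o) os

/-- The growth rate claimed for one operation on a set of `n` intervals: `log² n` for updates
and `log n` for queries (with `n + 2` in place of `n`, so that it is at least `1`). -/
noncomputable def rate (n : ℕ) : Op α → ℝ
  | insert _ => Real.logb 2 (n + 2) ^ 2
  | remove _ => Real.logb 2 (n + 2) ^ 2
  | query _ => Real.logb 2 (n + 2)

/-- The sum of the rates along a sequence, each taken at the current number of intervals. -/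
noncomputable def totalRate : Finset (Ivl α) → List (Op α) → ℝ
  | _, [] => 0
  | I, o :: os => rate I.card o + totalRate (apply I o) os

end Op

/-! ### The machine: a search tree, a memory of linked cells, and a clock -/

/-- Binary search trees whose nodes store their height. -/
inductive AVL (α : Type) [LinearOrder α] where
  | nil
  | node (ht : ℕ) (l : AVL α) (x : Ivl α) (r : AVL α)

/-- The record of an interval in the splay trees: links to parent, left and right child. -/
structure Cell (α : Type) [LinearOrder α] where
  parent : Option (Ivl α)
  left : Option (Ivl α)
  right : Option (Ivl α)

/-- The record of a node that has no links. -/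
def Cell.blank {α : Type} [LinearOrder α] : Cell α := ⟨none, none, none⟩

/-- The data structure: the search tree `T(I)`, the memory holding the splay trees (the record
of an interval is addressed by the interval), and the number of steps executed so far. -/
structure CF (α : Type) [LinearOrder α] where
  tree : AVL α
  cell : Ivl α → Cell α
  clock : ℕ

/-- The empty data structure at time zero. -/
def CF.empty (α : Type) [LinearOrder α] : CF α := ⟨AVL.nil, fun _ => Cell.blank, 0⟩

/-- Programs acting on the data structure. A computation that does not terminate has the
outcome `none`. Every memory access and every node of the search
tree that is visited takes one step. -/
abbrev Prog (α : Type) [LinearOrder α] (β : Type) : Type := StateT (CF α) Option β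

section Machine

variable {α : Type} [LinearOrder α]

/-- One step. -/
def tick : Prog α Unit := modify fun c => { c with clock := c.clock + 1 }

/-- Read a record. -/
def readCell (x : Ivl α) : Prog α (Cell α) := do
  tick
  return (← get).cell x

/-- Overwrite a record. -/
def writeCell (x : Ivl α) (c : Cell α) : Prog α Unit := do
  tick
  modify fun st => { st with cell := Function.update st.cell x c }

def setParent (x : Ivl α) (p : Option (Ivl α)) : Prog α Unit := do
  let c ← readCell x
  writeCell x { c with parent := p }

def setLeft (x : Ivl α) (l : Option (Ivl α)) : Prog α Unit := do
  let c ← readCell x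
  writeCell x { c with left := l }

def setRight (x : Ivl α) (r : Option (Ivl α)) : Prog α Unit := do
  let c ← readCell x
  writeCell x { c with right := r }

end Machine

/-! ### The balanced search tree `T(I)`, ordered by starting times -/

namespace AVL

variable {α : Type} [LinearOrder α]

/-- The interval `i` is stored in the tree. -/
def Mem (i : Ivl α) : AVL α → Prop
  | nil => False
  | node _ l x r => Mem i l ∨ i = x ∨ Mem i r

def height : AVL α → ℕ
  | nil => 0
  | node h _ _ _ => h

def mk (l : AVL α) (x : Ivl α) (r : AVL α) : AVL α :=
  node (max l.height r.height + 1) l x r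

/-- Rebalancing of a node by at most two rotations (a constant number of steps). -/
def balance (l : AVL α) (x : Ivl α) (r : AVL α) : AVL α :=
  if r.height + 1 < l.height then
    match l with
    | nil => mk l x r
    | node _ ll lx lr =>
      if lr.height ≤ ll.height then mk ll lx (mk lr x r)
      else
        match lr with
        | nil => mk l x r
        | node _ lrl lrx lrr => mk (mk ll lx lrl) lrx (mk lrr x r)
  else if l.height + 1 < r.height then
    match r with
    | nil => mk l x r
    | node _ rl rx rr =>
      if rl.height ≤ rr.height then mk (mk l x rl) rx rr
      else
        match rl with
        | nil => mk l x r
        | node _ rll rlx rlr => mk (mk l x rll) rlx (mk rlr rx rr)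
  else mk l x r

def insert (i : Ivl α) : AVL α → Prog α (AVL α)
  | nil => do
    tick
    return mk nil i nil
  | node h l x r => do
    tick
    if i.s < x.s then
      let l' ← insert i l
      return balance l' x r
    else if x.s < i.s then
      let r' ← insert i r
      return balance l x r'
    else return node h l x r

/-- Extraction of the leftmost node. -/
def extractMin : AVL α → Prog α (Option (Ivl α × AVL α))
  | nil => do
    tick
    return none
  | node _ l x r => do
    tick
    match ← extractMin l with
    | none => return some (x, r)
    | some (m, l') => return some (m, balance l' x r)

def remove (i : Ivl α) : AVL α → Prog α (AVL α)
  | nil => do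
    tick
    return nil
  | node _ l x r => do
    tick
    if i.s < x.s then
      let l' ← remove i l
      return balance l' x r
    else if x.s < i.s then
      let r' ← remove i r
      return balance l x r'
    else
      match ← extractMin r with
      | none => return l
      | some (m, r') => return balance l m r'

/-- Search for the node of `i`. -/
def find (i : Ivl α) : AVL α → Prog α (Option (Ivl α))
  | nil => do
    tick
    return none
  | node _ l x r => do
    tick
    if i.s < x.s then find i l
    else if x.s < i.s then find i r
    else return some x

/-- The leftmost interval; `a` is the last interval seen. -/
def minimum (a : Option (Ivl α)) : AVL α → Prog α (Option (Ivl α))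
  | nil => do
    tick
    return a
  | node _ l x _ => do
    tick
    minimum (some x) l

/-- The next interval after `i`; `a` is the last candidate seen. -/
def next (i : Ivl α) (a : Option (Ivl α)) : AVL α → Prog α (Option (Ivl α))
  | nil => do
    tick
    return a
  | node _ l x r => do
    tick
    if i.s < x.s then next i (some x) l else next i a r

/-- Search for the right compatible interval of `i`; `a` is the last candidate seen. -/
def rightCompatible (i : Ivl α) (a : Option (Ivl α)) :
    AVL α → Prog α (Option (Ivl α))
  | nil => do
    tick
    return a
  | node _ l j r => do
    tick
    if j.f ≤ i.f ∨ ¬ Ivl.Compatible j i then rightCompatible i a r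
    else rightCompatible i (some j) l

end AVL

/-! ### Splay trees, ordered by finishing times -/

namespace Splay

variable {α : Type} [LinearOrder α]

/-- Rotate the edge between `x` and its parent `p`. -/
def rotate (x p : Ivl α) : Prog α Unit := do
  let cx ← readCell x
  let cp ← readCell p
  if cp.left = some x then
    writeCell p { cp with left := cx.right, parent := some x }
    writeCell x { cx with right := some p, parent := cp.parent }
    match cx.right with
    | some b => setParent b (some p)
    | none => pure ()
  else
    writeCell p { cp with right := cx.left, parent := some x }
    writeCell x { cx with left := some p, parent := cp.parent }
    match cx.left with
    | some b => setParent b (some p)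
    | none => pure ()
  match cp.parent with
  | some g =>
    let cg ← readCell g
    if cg.left = some p then writeCell g { cg with left := some x }
    else writeCell g { cg with right := some x }
  | none => pure ()

/-- Bring `x` to the root of its splay tree, by zig, zig-zig and zig-zag steps. -/
def splay (x : Ivl α) : Prog α Unit := do
  let cx ← readCell x
  match cx.parent with
  | none => pure ()
  | some p =>
    let cp ← readCell p
    match cp.parent with
    | none => rotate x p
    | some g =>
      let cg ← readCell g
      if (cg.left = some p) ↔ (cp.left = some x) then
        rotate p g
        rotate x p
      else
        rotate x p
        rotate x g
      splay x
  partial_fixpoint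

/-- Follow right links from `x` as long as possible. -/
def rightmost (x : Ivl α) : Prog α (Ivl α) := do
  let cx ← readCell x
  match cx.right with
  | none => return x
  | some y => rightmost y
  partial_fixpoint

/-- The last node on the search path for `i` that starts at `x`. -/
def descend (i x : Ivl α) : Prog α (Ivl α) := do
  let cx ← readCell x
  if i = x then return x
  else if i.f < x.f then
    match cx.left with
    | none => return x
    | some y => descend i y
  else
    match cx.right with
    | none => return x
    | some y => descend i y
  partial_fixpoint

/-- The greatest interval in the splay tree of `x`. It becomes the root. -/
def maximum (x : Ivl α) : Prog α (Ivl α) := do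
  splay x
  let m ← rightmost x
  splay m
  return m

/-- Search for `i` in the splay tree of `x`. The last node visited becomes the root and is
returned. -/
def find (x i : Ivl α) : Prog α (Ivl α) := do
  splay x
  let y ← descend i x
  splay y
  return y

/-- The predecessor of `r` in its splay tree, if any. It becomes the root. -/
def predecessor (r : Ivl α) : Prog α (Option (Ivl α)) := do
  splay r
  let c ← readCell r
  match c.left with
  | none => return none
  | some y =>
    let j ← rightmost y
    splay j
    return some j

/-- Split the splay tree of `u` into the tree of the intervals before `u` and the tree of the
others, of which `u` becomes the root. -/
def split (u : Ivl α) : Prog α Unit := do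
  splay u
  let c ← readCell u
  match c.left with
  | none => pure ()
  | some l =>
    setParent l none
    setLeft u none

/-- Join the splay tree of `a` with the splay tree of `b`, whose intervals all come later. -/
def join (a b : Ivl α) : Prog α Unit := do
  let m ← maximum a
  splay b
  setRight m (some b)
  setParent b (some m)

/-- Take `i` out of its splay tree: the intervals before `i`, the interval `i` and the intervals
after `i` become three separate trees. -/
def remove (i : Ivl α) : Prog α Unit := do
  split i
  let c ← readCell i
  match c.right with
  | none => pure ()
  | some r =>
    setParent r none
    setRight i none

end Splay

/-! ### The algorithms on the compatibility forest -/

namespace MonCF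

variable {α : Type} [LinearOrder α]

def minimum : Prog α (Option (Ivl α)) := do
  (← get).tree.minimum none

def rightCompatible (i : Ivl α) : Prog α (Option (Ivl α)) := do
  (← get).tree.rightCompatible i none

def treeInsert (i : Ivl α) : Prog α Unit := do
  let t ← (← get).tree.insert i
  modify fun st => { st with tree := t }

def treeRemove (i : Ivl α) : Prog α Unit := do
  let t ← (← get).tree.remove i
  modify fun st => { st with tree := t }

/-- The loop of `expose`: `j` is the greatest interval in the splay tree of `i`. -/
def exposeLoop (i j : Ivl α) : Prog α Unit := do
  match ← rightCompatible j with
  | none => pure ()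
  | some i' =>
    Splay.split i'
    Splay.join i i'
    let j' ← Splay.maximum i'
    exposeLoop i j'
  partial_fixpoint

/-- Make all edges on the path from `i` to the root of its tree in the compatibility forest
solid. -/
def expose (i : Ivl α) : Prog α Unit := do
  let j ← Splay.maximum i
  exposeLoop i j

def exposeMinimum : Prog α Unit := do
  match ← minimum with
  | none => pure ()
  | some m => expose m

def queryMonCF (i : Ivl α) : Prog α Bool := do
  match ← minimum with
  | none => return false
  | some m =>
    let y ← Splay.find m i
    return decide (y = i)

/-- Insertion of `i`. When the solid edge from `j` to the next interval of `i` is destroyed, the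
new edge from `j` to `i` is made solid immediately if `link` is `true`, and is left dashed if
`link` is `false`. -/
def insertMonCF (link : Bool) (i : Ivl α) : Prog α Unit := do
  treeInsert i
  writeCell i Cell.blank
  match ← (← get).tree.next i none with
  | none => pure ()
  | some r =>
    match ← Splay.predecessor r with
    | none => pure ()
    | some j =>
      if Ivl.Compatible j i then
        Splay.split r
        if link then Splay.join j i
  exposeMinimum

/-- Removal of `i`; the node of `i` is first located in the search tree. -/
def removeMonCF (i : Ivl α) : Prog α Unit := do
  match ← (← get).tree.find i with
  | none => pure ()
  | some x =>
    Splay.remove x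
    treeRemove x
    exposeMinimum

/-- Execution of one operation. -/
def exec (link : Bool) : Op α → Prog α (Option Bool)
  | .insert i => do
    insertMonCF link i
    return none
  | .remove i => do
    removeMonCF i
    return none
  | .query i => do
    let b ← queryMonCF i
    return some b

/-- Execution of a sequence of operations, with the list of their outputs. -/
def execSeq (link : Bool) : List (Op α) → Prog α (List (Option Bool))
  | [] => return []
  | o :: os => do
    let a ← exec link o
    let as ← execSeq link os
    return a :: as

/-- The records of `x` and `y` belong to the same splay tree: their parent links lead to a common
node. -/
def SameSplayTree (c : CF α) (x y : Ivl α) : Prop :=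
  ∃ z, Relation.ReflTransGen (fun a b => (c.cell a).parent = some b) x z ∧
    Relation.ReflTransGen (fun a b => (c.cell a).parent = some b) y z

/-- The data structure represents `I`: its search tree stores exactly the intervals of `I`, and
the splay tree of the least interval of `I` consists exactly of the greedy optimal set. -/
def Represents (c : CF α) (I : Finset (Ivl α)) : Prop :=
  (∀ i, AVL.Mem i c.tree ↔ i ∈ I) ∧
    ∀ m, Ivl.IsLeastIn I m → ∀ i, SameSplayTree c m i ↔ Ivl.Greedy I i

end MonCF

/-! By monotonicity the orders by start and by finish agree, and an interval that finishes after $i$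
is compatible with it exactly if it starts after $f(i)$. So $\mathrm{rc}(i)$ is the first interval
in the search tree with a monotone property, found by one descent. The greedy optimal set is the
path of the compatibility forest from the least interval $m$. The splay trees always partition $I$
into forest paths; if every update ends by exposing $m$, then $m$'s splay tree starts at $m$ and
ends at a root of the forest, hence is this path (`mem_iff_greedy`).

The time bound is a potential argument with three terms (`total`): the clock, 12 times the usual
splay potential (the sum of $\log_2$ of all subtree sizes), and $320\,\mathrm{lg}\,n$ for each loose
edge, i.e. heavy edge of the forest that is not solid. The level of a node is $\lfloor\log_2\rfloor$
of its number of descendants, and an edge is heavy if its ends have equal level. A node has at most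
one heavy child edge (`Ivl.heavy_unique`), and at most $\log_2 n$ edges of a path are light.

Splaying has amortised cost $O(\log n)$ (`Splay.runs_splay_plug`). A round of `expose` makes an edge
$(j,u)$ solid and destroys at most one other solid edge, which also leads to $u$. If $(j,u)$ is
heavy, the number of loose edges drops and pays for the round; if it is light, that number grows by
at most one while the level rises. Hence (loose edges) minus twice the level of the path's end drops
by at least one per round (`runs_extend`), and `expose` costs $O(\log^2 n)$ amortised.

Inserting or removing $i$ can redirect many forest edges, but all redirected edges connect to $i$ on
one side and to a single node $r$ on the other. Descendant sets therefore change only along the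
forest paths from $i$ and $r$, and the loose status of a node there changes only at light edges and
at $O(1)$ further nodes. So the number of loose edges changes by $O(\log n)$ (`Ivl.loose_insert`),
at a price of $O(\log^2 n)$. The factor $\mathrm{lg}\,n$ itself also changes with $n$, but
$n(\mathrm{lg}(n+1)-\mathrm{lg}\,n)$ is bounded (`lg_succ_mul_le`). -/

/-! ### Total correctness of programs. -/

section Runs

variable {α : Type} [LinearOrder α] {β γ : Type}

/-- The program `m`, started in `s`, terminates with a result and a state that satisfy `Q`. -/
def Runs (m : Prog α β) (s : CF α) (Q : β → CF α → Prop) : Prop :=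
  ∃ b s', m s = some (b, s') ∧ Q b s'

theorem Runs.mono {m : Prog α β} {s : CF α} {Q Q' : β → CF α → Prop} (h : Runs m s Q)
    (hQ : ∀ b s', Q b s' → Q' b s') : Runs m s Q' := by
  obtain ⟨b, s', h1, h2⟩ := h
  exact ⟨b, s', h1, hQ _ _ h2⟩

-- Together with the rules for the primitive operations, this lets the simplifier execute a program
-- symbolically. Termination is included in `Runs`, because divergence is the outcome `none`.
@[simp] theorem runs_bind {m : Prog α β} {f : β → Prog α γ} {s : CF α} {Q : γ → CF α → Prop} :
    Runs (m >>= f) s Q ↔ Runs m s fun b s' => Runs (f b) s' Q := by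
  constructor
  · rintro ⟨c, s'', h1, h2⟩
    change (m s).bind (fun p => f p.1 p.2) = _ at h1
    rw [Option.bind_eq_some_iff] at h1
    obtain ⟨⟨b, s'⟩, h3, h4⟩ := h1
    exact ⟨b, s', h3, c, s'', h4, h2⟩
  · rintro ⟨b, s', h1, c, s'', h2, h3⟩
    refine ⟨c, s'', ?_, h3⟩
    change (m s).bind (fun p => f p.1 p.2) = _
    rw [h1]
    exact h2

theorem Runs.bind {m : Prog α β} {f : β → Prog α γ} {s : CF α} {P : β → CF α → Prop}
    {Q : γ → CF α → Prop} (h : Runs m s P) (hf : ∀ b s', P b s' → Runs (f b) s' Q) :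
    Runs (m >>= f) s Q :=
  runs_bind.2 (h.mono hf)

@[simp] theorem runs_pure {b : β} {s : CF α} {Q : β → CF α → Prop} :
    Runs (pure b) s Q ↔ Q b s := by
  constructor
  · rintro ⟨c, s', h1, h2⟩
    cases h1
    exact h2
  · exact fun h => ⟨b, s, rfl, h⟩

@[simp] theorem runs_get {s : CF α} {Q : CF α → CF α → Prop} :
    Runs (get : Prog α (CF α)) s Q ↔ Q s s := by
  constructor
  · rintro ⟨c, s', h1, h2⟩
    cases h1
    exact h2
  · exact fun h => ⟨s, s, rfl, h⟩

@[simp] theorem runs_modify {g : CF α → CF α} {s : CF α} {Q : Unit → CF α → Prop} :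
    Runs (modify g : Prog α Unit) s Q ↔ Q () (g s) := by
  constructor
  · rintro ⟨c, s', h1, h2⟩
    cases h1
    exact h2
  · exact fun h => ⟨(), g s, rfl, h⟩

@[simp] theorem runs_map {m : Prog α β} {g : β → γ} {s : CF α} {Q : γ → CF α → Prop} :
    Runs (g <$> m) s Q ↔ Runs m s fun b s' => Q (g b) s' := by
  rw [map_eq_pure_bind, runs_bind]
  simp only [runs_pure]

@[simp] theorem runs_tick {s : CF α} {Q : Unit → CF α → Prop} :
    Runs tick s Q ↔ Q () { s with clock := s.clock + 1 } := runs_modify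

@[simp] theorem runs_readCell {x : Ivl α} {s : CF α} {Q : Cell α → CF α → Prop} :
    Runs (readCell x) s Q ↔ Q (s.cell x) { s with clock := s.clock + 1 } := by
  simp [readCell]

@[simp] theorem runs_writeCell {x : Ivl α} {c : Cell α} {s : CF α} {Q : Unit → CF α → Prop} :
    Runs (writeCell x c) s Q ↔
      Q () { s with cell := Function.update s.cell x c, clock := s.clock + 1 } := by
  simp [writeCell]

@[simp] theorem runs_setParent {x : Ivl α} {p : Option (Ivl α)} {s : CF α}
    {Q : Unit → CF α → Prop} :
    Runs (setParent x p) s Q ↔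
      Q () { s with
        cell := Function.update s.cell x { s.cell x with parent := p }, clock := s.clock + 2 } := by
  simp [setParent]

@[simp] theorem runs_setLeft {x : Ivl α} {p : Option (Ivl α)} {s : CF α}
    {Q : Unit → CF α → Prop} :
    Runs (setLeft x p) s Q ↔
      Q () { s with
        cell := Function.update s.cell x { s.cell x with left := p }, clock := s.clock + 2 } := by
  simp [setLeft]

@[simp] theorem runs_setRight {x : Ivl α} {p : Option (Ivl α)} {s : CF α}
    {Q : Unit → CF α → Prop} :
    Runs (setRight x p) s Q ↔
      Q () { s with
        cell := Function.update s.cell x { s.cell x with right := p }, clock := s.clock + 2 } := by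
  simp [setRight]

end Runs

/-! ### Trees, contexts and their representation in memory -/

/-- Binary trees of intervals. -/
inductive STree (α : Type) [LinearOrder α] where
  | nil
  | node (l : STree α) (x : Ivl α) (r : STree α)

/-- One level of a path from a node to the root: the parent, its other subtree, and whether the
path comes from the left. -/
structure Frame (α : Type) [LinearOrder α] where
  /-- Whether the step goes to the left child. -/
  fromLeft : Bool
  /-- The interval at the parent. -/
  key : Ivl α
  /-- The other subtree of the parent. -/
  sib : STree α

namespace STree

variable {α : Type} [LinearOrder α]

/-- The interval at the root. -/
def root : STree α → Option (Ivl α)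
  | nil => none
  | node _ x _ => some x

/-- The intervals of a tree in symmetric order. -/
def inorder : STree α → List (Ivl α)
  | nil => []
  | node l x r => l.inorder ++ x :: r.inorder

/-- The number of nodes. -/
def size (t : STree α) : ℕ := t.inorder.length

/-- The tree obtained by putting a subtree into a context. -/
def plug : STree α → List (Frame α) → STree α
  | t, [] => t
  | t, f :: fs => if f.fromLeft then plug (node t f.key f.sib) fs else plug (node f.sib f.key t) fs

/-- The intervals of a context. -/
def ctxKeys : List (Frame α) → List (Ivl α)
  | [] => []
  | f :: fs => f.key :: (f.sib.inorder ++ ctxKeys fs)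

/-- The parent of the subtree that is put into a context. -/
def ctxParent : List (Frame α) → Option (Ivl α)
  | [] => none
  | f :: _ => some f.key

/-- The records of the nodes of the tree have the links of the tree, the root having the parent
link `p`. -/
def Holds (c : Ivl α → Cell α) : Option (Ivl α) → STree α → Prop
  | _, nil => True
  | p, node l x r => c x = ⟨p, l.root, r.root⟩ ∧ Holds c (some x) l ∧ Holds c (some x) r

/-- The records `c` represent the context of a subtree with the given root. -/
def HoldsCtx (c : Ivl α → Cell α) : List (Frame α) → Option (Ivl α) → Prop
  | [], _ => True
  | f :: fs, x =>
    c f.key = (if f.fromLeft then ⟨ctxParent fs, x, f.sib.root⟩ else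
      ⟨ctxParent fs, f.sib.root, x⟩) ∧ Holds c (some f.key) f.sib ∧ HoldsCtx c fs (some f.key)

@[simp] theorem size_node (l r : STree α) (x : Ivl α) :
    (node l x r).size = l.size + r.size + 1 := by
  simp [size, inorder]; ring

@[simp] theorem root_nil : (nil : STree α).root = none := rfl
@[simp] theorem root_node (l r : STree α) (x : Ivl α) : (node l x r).root = some x := rfl

@[simp] theorem ctxParent_nil : ctxParent ([] : List (Frame α)) = none := rfl
@[simp] theorem ctxParent_cons (f : Frame α) (fs : List (Frame α)) :
    ctxParent (f :: fs) = some f.key := rfl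

theorem root_mem {t : STree α} {b : Ivl α} (h : t.root = some b) : b ∈ t.inorder := by
  cases t <;> simp_all [root, inorder]

theorem perm_plug (fs : List (Frame α)) :
    ∀ t : STree α, (plug t fs).inorder.Perm (t.inorder ++ ctxKeys fs) := by
  induction fs with
  | nil => intro t; simp [plug, ctxKeys]
  | cons f fs ih =>
    intro t
    obtain ⟨d, p, u⟩ := f
    cases d
    · simp only [plug, ctxKeys, Bool.false_eq_true, if_false]
      refine (ih _).trans ?_
      simp only [inorder]
      rw [List.perm_iff_count]
      intro a
      simp only [List.count_append, List.count_cons]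
      ring
    · simp only [plug, ctxKeys, if_true]
      refine (ih _).trans ?_
      simp [inorder]

theorem inorder_plug (fs : List (Frame α)) :
    ∃ A B : List (Ivl α), ∀ t : STree α, (plug t fs).inorder = A ++ t.inorder ++ B := by
  induction fs with
  | nil => exact ⟨[], [], by simp [plug]⟩
  | cons f fs ih =>
    obtain ⟨A, B, h⟩ := ih
    obtain ⟨d, p, u⟩ := f
    cases d
    · exact ⟨A ++ u.inorder ++ [p], B, by simp [plug, h, inorder]⟩
    · exact ⟨A, p :: u.inorder ++ B, by simp [plug, h, inorder]⟩

theorem inorder_plug_congr {t t' : STree α} (h : t.inorder = t'.inorder) (fs : List (Frame α)) :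
    (plug t fs).inorder = (plug t' fs).inorder := by
  obtain ⟨A, B, hp⟩ := inorder_plug fs
  rw [hp, hp, h]

theorem size_le_plug (t : STree α) (fs : List (Frame α)) : t.size ≤ (plug t fs).size := by
  obtain ⟨A, B, h⟩ := inorder_plug fs
  simp only [size, h, List.length_append]; omega

theorem exists_plug {t : STree α} {x : Ivl α} (h : x ∈ t.inorder) :
    ∃ l r fs, t = plug (node l x r) fs := by
  -- The context `gs` accumulates the path already walked from the root, which makes the statement
  -- inductive.
  suffices ∀ (t : STree α) (gs : List (Frame α)), x ∈ t.inorder →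
      ∃ l r fs, plug t gs = plug (node l x r) fs from this t [] h
  intro t
  induction t with
  | nil => intro gs h; simp [inorder] at h
  | node l y r ihl ihr =>
    intro gs h
    simp only [inorder, List.mem_append, List.mem_cons] at h
    rcases h with h | rfl | h
    · simpa [plug] using ihl (⟨true, y, r⟩ :: gs) h
    · exact ⟨l, r, gs, rfl⟩
    · simpa [plug] using ihr (⟨false, y, l⟩ :: gs) h

theorem Holds.congr {c c' : Ivl α → Cell α} {t : STree α} :
    ∀ {p : Option (Ivl α)}, Holds c p t → (∀ x ∈ t.inorder, c' x = c x) → Holds c' p t := by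
  induction t with
  | nil => intros; trivial
  | node l x r ihl ihr =>
    intro p h hc
    simp only [inorder, List.mem_append, List.mem_cons] at hc
    exact ⟨(hc x (by simp)).trans h.1, ihl h.2.1 fun y hy => hc y (by simp [hy]),
      ihr h.2.2 fun y hy => hc y (by simp [hy])⟩

theorem holds_update {c : Ivl α → Cell α} {t : STree α} {p : Option (Ivl α)} {k : Ivl α}
    {v : Cell α} (hk : k ∉ t.inorder) : Holds (Function.update c k v) p t ↔ Holds c p t := by
  have h : ∀ x ∈ t.inorder, Function.update c k v x = c x := fun x hx =>
    Function.update_of_ne (fun e => hk (by rwa [← e])) _ _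
  exact ⟨fun H => H.congr fun x hx => (h x hx).symm, fun H => H.congr h⟩

theorem HoldsCtx.congr {c c' : Ivl α → Cell α} {fs : List (Frame α)} :
    ∀ {p : Option (Ivl α)}, HoldsCtx c fs p → (∀ x ∈ ctxKeys fs, c' x = c x) →
      HoldsCtx c' fs p := by
  induction fs with
  | nil => intros; trivial
  | cons f fs ih =>
    intro p h hc
    simp only [ctxKeys, List.mem_append, List.mem_cons] at hc
    exact ⟨(hc f.key (by simp)).trans h.1, h.2.1.congr fun y hy => hc y (by simp [hy]),
      ih h.2.2 fun y hy => hc y (by simp [hy])⟩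

/-- Focusing on a subtree: a change of links near one node can be checked locally, the context being
touched only at its innermost frame. -/
theorem holds_plug {c : Ivl α → Cell α} (fs : List (Frame α)) : ∀ t : STree α, t ≠ nil →
    (Holds c none (plug t fs) ↔ Holds c (ctxParent fs) t ∧ HoldsCtx c fs t.root) := by
  induction fs with
  | nil => simp [plug, HoldsCtx, ctxParent]
  | cons f fs ih =>
    intro t _
    obtain ⟨d, p, u⟩ := f
    cases d
    · simp only [plug, Bool.false_eq_true, if_false, HoldsCtx, ctxParent]
      rw [ih _ (by simp), Holds, root_node]
      tauto
    · simp only [plug, if_true, HoldsCtx, ctxParent]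
      rw [ih _ (by simp), Holds, root_node]
      tauto

/-- Changing the parent link of the root. -/
theorem Holds.reparent {c c' : Ivl α → Cell α} {t : STree α} {p q : Option (Ivl α)}
    (h : Holds c p t) (hn : t.inorder.Nodup)
    (hr : ∀ b, t.root = some b → c' b = { c b with parent := q })
    (hc : ∀ y ∈ t.inorder, t.root ≠ some y → c' y = c y) : Holds c' q t := by
  cases t with
  | nil => trivial
  | node l x r =>
    simp only [inorder, List.nodup_append, List.nodup_cons, List.mem_cons] at hn
    obtain ⟨h1, h2, h3⟩ := h
    refine ⟨by rw [hr x rfl, h1], h2.congr fun y hy => hc y (by simp [inorder, hy]) ?_,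
      h3.congr fun y hy => hc y (by simp [inorder, hy]) ?_⟩
    · rintro ⟨⟩; exact hn.2.2 x hy x (by simp) rfl
    · rintro ⟨⟩; exact hn.2.1.1 hy

/-- Replacing the subtree of a context by one with the root `x` instead of `p`. -/
theorem HoldsCtx.replace {c c' : Ivl α → Cell α} {fs : List (Frame α)} {x p : Ivl α}
    (h : HoldsCtx c fs (some p)) (hn : (ctxKeys fs).Nodup) (hp : p ∉ ctxKeys fs)
    (hg : ∀ g, ctxParent fs = some g → c' g =
      if (c g).left = some p then { c g with left := some x } else { c g with right := some x })
    (hc : ∀ y ∈ ctxKeys fs, ctxParent fs ≠ some y → c' y = c y) : HoldsCtx c' fs (some x) := by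
  cases fs with
  | nil => trivial
  | cons f fs =>
    simp only [ctxKeys, List.nodup_append, List.nodup_cons, List.mem_append, List.mem_cons,
      not_or] at hn hp hc
    obtain ⟨h1, h2, h3⟩ := h
    refine ⟨?_, h2.congr fun y hy => hc y (by simp [hy]) ?_,
      h3.congr fun y hy => hc y (by simp [hy]) ?_⟩
    · rw [hg _ rfl, h1]
      obtain ⟨d, g, u⟩ := f
      cases d
      -- `rotate` decides which link of the grandparent to redirect by testing the left one. If `p`
      -- is the right child, that test fails only because the sibling does not have the root `p`.
      · have : u.root ≠ some p := fun e => hp.2.1 (root_mem e)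
        simp [this]
      · simp
    · rintro ⟨⟩; exact hn.1.1 hy
    · rintro ⟨⟩; exact hn.1.2 hy

theorem notMem_of_notMem_plug {t : STree α} {fs : List (Frame α)} {y : Ivl α}
    (h : y ∉ (plug t fs).inorder) : y ∉ t.inorder ∧ y ∉ ctxKeys fs := by
  rw [(perm_plug fs t).mem_iff] at h
  simpa using h

end STree

/-! ### Rotations of linked records. -/

namespace Splay

open STree

variable {α : Type} [LinearOrder α]

/-- The distinctness hypotheses say that `x`, `p`, the moved child `b` and the grandparent `q` are
not aliased, so that no write destroys another. Each of these four records is read and written at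
most once, which gives the 8 steps. -/
theorem runs_rotate_of_left {s : CF α} {x p : Ivl α} {l b r q : Option (Ivl α)}
    (hx : s.cell x = ⟨some p, l, b⟩) (hp : s.cell p = ⟨q, some x, r⟩) (hxp : x ≠ p)
    (hb : ∀ y, b = some y → y ≠ x ∧ y ≠ p) (hq : ∀ g, q = some g → g ≠ x ∧ g ≠ p ∧ b ≠ some g) :
    Runs (rotate x p) s fun _ s' =>
      s'.cell x = ⟨q, l, some p⟩ ∧ s'.cell p = ⟨some x, b, r⟩ ∧
      (∀ y, b = some y → s'.cell y = { s.cell y with parent := some p }) ∧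
      (∀ g, q = some g → s'.cell g = if (s.cell g).left = some p then
        { s.cell g with left := some x } else { s.cell g with right := some x }) ∧
      (∀ y, y ≠ x → y ≠ p → b ≠ some y → q ≠ some y → s'.cell y = s.cell y) ∧
      s'.tree = s.tree ∧ s'.clock ≤ s.clock + 8 := by
  have hb' : ∀ y, b = some y → x ≠ y ∧ p ≠ y := fun y hy => ⟨(hb y hy).1.symm, (hb y hy).2.symm⟩
  have hq' : ∀ y, q = some y → x ≠ y ∧ p ≠ y := fun y hy =>
    ⟨(hq y hy).1.symm, (hq y hy).2.1.symm⟩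
  have key : ∀ y, y ≠ x → y ≠ p → ∀ u v, Function.update (Function.update s.cell p u) x v y =
      s.cell y := fun y h1 h2 u v => by simp [h1, h2]
  rcases b with _ | b <;> rcases q with _ | g
  · simp [rotate, hx, hp, hxp.symm]
    exact fun y h1 h2 => key y h1 h2 _ _
  · obtain ⟨hgx, hgp, -⟩ := hq g rfl
    obtain ⟨hxg, hpg⟩ := hq' g rfl
    by_cases hg : (s.cell g).left = some p <;>
      simp [rotate, hx, hp, hxp.symm, hgx, hgp, hxg, hpg, hg] <;>
      exact fun y h1 h2 h3 => by simp [h1, h2, Ne.symm h3]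
  · obtain ⟨hbx, hbp⟩ := hb b rfl
    obtain ⟨hxb, hpb⟩ := hb' b rfl
    simp [rotate, hx, hp, hxp.symm, hbx, hbp, hxb, hpb]
    exact fun y h1 h2 h3 => by simp [h1, h2, Ne.symm h3]
  · obtain ⟨hgx, hgp, hbg⟩ := hq g rfl
    obtain ⟨hxg, hpg⟩ := hq' g rfl
    obtain ⟨hbx, hbp⟩ := hb b rfl
    obtain ⟨hxb, hpb⟩ := hb' b rfl
    have hbg : b ≠ g := fun e => hbg (e ▸ rfl)
    by_cases hg : (s.cell g).left = some p <;>
      simp [rotate, hx, hp, hxp.symm, hgx, hgp, hxg, hpg, hg, hbx, hbp, hxb, hpb, hbg,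
        hbg.symm] <;>
      exact fun y h1 h2 h3 h4 => by simp [h1, h2, Ne.symm h3, Ne.symm h4]

theorem runs_rotate_of_right {s : CF α} {x p : Ivl α} {l b r q : Option (Ivl α)}
    (hx : s.cell x = ⟨some p, b, l⟩) (hp : s.cell p = ⟨q, r, some x⟩) (hxp : x ≠ p) (hr : r ≠ some x)
    (hb : ∀ y, b = some y → y ≠ x ∧ y ≠ p) (hq : ∀ g, q = some g → g ≠ x ∧ g ≠ p ∧ b ≠ some g) :
    Runs (rotate x p) s fun _ s' =>
      s'.cell x = ⟨q, some p, l⟩ ∧ s'.cell p = ⟨some x, r, b⟩ ∧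
      (∀ y, b = some y → s'.cell y = { s.cell y with parent := some p }) ∧
      (∀ g, q = some g → s'.cell g = if (s.cell g).left = some p then
        { s.cell g with left := some x } else { s.cell g with right := some x }) ∧
      (∀ y, y ≠ x → y ≠ p → b ≠ some y → q ≠ some y → s'.cell y = s.cell y) ∧
      s'.tree = s.tree ∧ s'.clock ≤ s.clock + 8 := by
  have hb' : ∀ y, b = some y → x ≠ y ∧ p ≠ y := fun y hy => ⟨(hb y hy).1.symm, (hb y hy).2.symm⟩
  have hq' : ∀ y, q = some y → x ≠ y ∧ p ≠ y := fun y hy =>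
    ⟨(hq y hy).1.symm, (hq y hy).2.1.symm⟩
  have key : ∀ y, y ≠ x → y ≠ p → ∀ u v, Function.update (Function.update s.cell p u) x v y =
      s.cell y := fun y h1 h2 u v => by simp [h1, h2]
  rcases b with _ | b <;> rcases q with _ | g
  · simp [rotate, hx, hp, hxp.symm, hr]
    exact fun y h1 h2 => key y h1 h2 _ _
  · obtain ⟨hgx, hgp, -⟩ := hq g rfl
    obtain ⟨hxg, hpg⟩ := hq' g rfl
    by_cases hg : (s.cell g).left = some p <;>
      simp [rotate, hx, hp, hxp.symm, hgx, hgp, hxg, hpg, hg, hr] <;>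
      exact fun y h1 h2 h3 => by simp [h1, h2, Ne.symm h3]
  · obtain ⟨hbx, hbp⟩ := hb b rfl
    obtain ⟨hxb, hpb⟩ := hb' b rfl
    simp [rotate, hx, hp, hxp.symm, hbx, hbp, hxb, hpb, hr]
    exact fun y h1 h2 h3 => by simp [h1, h2, Ne.symm h3]
  · obtain ⟨hgx, hgp, hbg⟩ := hq g rfl
    obtain ⟨hxg, hpg⟩ := hq' g rfl
    obtain ⟨hbx, hbp⟩ := hb b rfl
    obtain ⟨hxb, hpb⟩ := hb' b rfl
    have hbg : b ≠ g := fun e => hbg (e ▸ rfl)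
    by_cases hg : (s.cell g).left = some p <;>
      simp [rotate, hx, hp, hxp.symm, hgx, hgp, hxg, hpg, hg, hbx, hbp, hxb, hpb, hbg,
        hbg.symm, hr] <;>
      exact fun y h1 h2 h3 h4 => by simp [h1, h2, Ne.symm h3, Ne.symm h4]

/-- The absence of repetitions in the inorder list supplies all the distinctness that the rotation
of records needs. The clause on the intervals outside the tree is what later isolates the other
splay trees. -/
theorem runs_rotate_right {s : CF α} {a b c : STree α} {x p : Ivl α} {fs : List (Frame α)}
    (h : Holds s.cell none (plug (node (node a x b) p c) fs))
    (hn : (plug (node (node a x b) p c) fs).inorder.Nodup) :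
    Runs (rotate x p) s fun _ s' =>
      Holds s'.cell none (plug (node a x (node b p c)) fs) ∧
      (∀ y ∉ (plug (node (node a x b) p c) fs).inorder, s'.cell y = s.cell y) ∧
      s'.tree = s.tree ∧ s'.clock ≤ s.clock + 8 := by
  rw [(perm_plug fs _).nodup_iff] at hn
  rw [holds_plug _ _ (by simp)] at h
  obtain ⟨⟨hp, ⟨hx, ha, hb⟩, hc⟩, hctx⟩ := h
  simp only [inorder, List.nodup_append, List.nodup_cons, List.mem_append, List.mem_cons] at hn
  have hxp : x ≠ p := by grind
  have hb' : ∀ y, b.root = some y → y ≠ x ∧ y ≠ p := fun y hy => by grind [root_mem hy]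
  have hK : ∀ y ∈ ctxKeys fs, y ≠ x ∧ y ≠ p ∧ y ∉ a.inorder ∧ y ∉ b.inorder ∧ y ∉ c.inorder := by
    grind
  have hP : ∀ g, ctxParent fs = some g → g ∈ ctxKeys fs := by
    cases fs <;> simp +contextual [ctxKeys]
  have hP' : ∀ y, y ∉ ctxKeys fs → ctxParent fs ≠ some y := fun y hy e => hy (hP y e)
  have hB : ∀ y, y ∉ b.inorder → b.root ≠ some y := fun y hy e => hy (root_mem e)
  refine (runs_rotate_of_left hx hp hxp hb' fun g hg => ⟨(hK g (hP g hg)).1,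
    (hK g (hP g hg)).2.1, hB g (hK g (hP g hg)).2.2.2.1⟩).mono ?_
  rintro _ s' ⟨h1, h2, h3, h4, h5, h6, h7⟩
  refine ⟨(holds_plug _ _ (by simp)).2 ⟨⟨h1, ?_, h2, ?_, ?_⟩, ?_⟩, ?_, h6, h7⟩
  · exact ha.congr fun y hy => h5 y (by grind) (by grind) (hB y (by grind)) (hP' y (by grind))
  · exact hb.reparent (by grind) h3 fun y hy hne =>
      h5 y (by grind) (by grind) hne (hP' y (by grind))
  · exact hc.congr fun y hy => h5 y (by grind) (by grind) (hB y (by grind)) (hP' y (by grind))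
  · exact hctx.replace (by grind) (by grind) h4 fun y hy hne =>
      h5 y (by grind) (by grind) (hB y (by grind)) hne
  · intro y hy
    obtain ⟨hy1, hy2⟩ := notMem_of_notMem_plug hy
    simp only [inorder, List.mem_append, List.mem_cons, not_or] at hy1
    exact h5 y (by grind) (by grind) (hB y (by grind)) (hP' y hy2)

theorem runs_rotate_left {s : CF α} {a b c : STree α} {x p : Ivl α} {fs : List (Frame α)}
    (h : Holds s.cell none (plug (node c p (node b x a)) fs))
    (hn : (plug (node c p (node b x a)) fs).inorder.Nodup) :
    Runs (rotate x p) s fun _ s' =>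
      Holds s'.cell none (plug (node (node c p b) x a) fs) ∧
      (∀ y ∉ (plug (node c p (node b x a)) fs).inorder, s'.cell y = s.cell y) ∧
      s'.tree = s.tree ∧ s'.clock ≤ s.clock + 8 := by
  rw [(perm_plug fs _).nodup_iff] at hn
  rw [holds_plug _ _ (by simp)] at h
  obtain ⟨⟨hp, hc, ⟨hx, hb, ha⟩⟩, hctx⟩ := h
  simp only [inorder, List.nodup_append, List.nodup_cons, List.mem_append, List.mem_cons] at hn
  have hxp : x ≠ p := by grind
  have hb' : ∀ y, b.root = some y → y ≠ x ∧ y ≠ p := fun y hy => by grind [root_mem hy]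
  have hK : ∀ y ∈ ctxKeys fs, y ≠ x ∧ y ≠ p ∧ y ∉ a.inorder ∧ y ∉ b.inorder ∧ y ∉ c.inorder := by
    grind
  have hP : ∀ g, ctxParent fs = some g → g ∈ ctxKeys fs := by
    cases fs <;> simp +contextual [ctxKeys]
  have hP' : ∀ y, y ∉ ctxKeys fs → ctxParent fs ≠ some y := fun y hy e => hy (hP y e)
  have hB : ∀ y, y ∉ b.inorder → b.root ≠ some y := fun y hy e => hy (root_mem e)
  -- Needed for the test `cp.left = some x` in `rotate` to fail.
  have hB' : ∀ y, y ∉ c.inorder → c.root ≠ some y := fun y hy e => hy (root_mem e)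
  refine (runs_rotate_of_right hx hp hxp (hB' _ (by grind)) hb' fun g hg => ⟨(hK g (hP g hg)).1,
    (hK g (hP g hg)).2.1, hB g (hK g (hP g hg)).2.2.2.1⟩).mono ?_
  rintro _ s' ⟨h1, h2, h3, h4, h5, h6, h7⟩
  refine ⟨(holds_plug _ _ (by simp)).2 ⟨⟨h1, ⟨h2, ?_, ?_⟩, ?_⟩, ?_⟩, ?_, h6, h7⟩
  · exact hc.congr fun y hy => h5 y (by grind) (by grind) (hB y (by grind)) (hP' y (by grind))
  · exact hb.reparent (by grind) h3 fun y hy hne =>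
      h5 y (by grind) (by grind) hne (hP' y (by grind))
  · exact ha.congr fun y hy => h5 y (by grind) (by grind) (hB y (by grind)) (hP' y (by grind))
  · exact hctx.replace (by grind) (by grind) h4 fun y hy hne =>
      h5 y (by grind) (by grind) (hB y (by grind)) hne
  · intro y hy
    obtain ⟨hy1, hy2⟩ := notMem_of_notMem_plug hy
    simp only [inorder, List.mem_append, List.mem_cons, not_or] at hy1
    exact h5 y (by grind) (by grind) (hB y (by grind)) (hP' y hy2)

end Splay

/-! ### The potential of splay trees. -/

namespace STree

variable {α : Type} [LinearOrder α]

/-- The potential of a splay tree: the sum of the logarithms of the sizes of its subtrees. -/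
noncomputable def pot : STree α → ℝ
  | nil => 0
  | node l x r => pot l + pot r + Real.logb 2 (node l x r).size

theorem pot_node (l r : STree α) (x : Ivl α) :
    (node l x r).pot = l.pot + r.pot + Real.logb 2 (l.size + r.size + 1 : ℕ) := by
  rw [pot, size_node]

theorem pot_nonneg (t : STree α) : 0 ≤ t.pot := by
  induction t with
  | nil => simp [pot]
  | node l x r ihl ihr =>
    rw [pot_node]
    have : (0 : ℝ) ≤ Real.logb 2 (l.size + r.size + 1 : ℕ) :=
      Real.logb_nonneg (by norm_num) (by push_cast; linarith [Nat.cast_nonneg (α := ℝ) l.size, Nat.cast_nonneg (α := ℝ) r.size])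
    linarith

/-- The terms of the ancestors depend only on the size of the subtree, so a local restructuring has
a local effect on the potential. -/
theorem pot_plug (fs : List (Frame α)) : ∀ {t t' : STree α}, t.size = t'.size →
    (plug t fs).pot - t.pot = (plug t' fs).pot - t'.pot := by
  induction fs with
  | nil => intros; simp [plug]
  | cons f fs ih =>
    intro t t' h
    simp only [plug]
    split_ifs
    · have := ih (t := node t f.key f.sib) (t' := node t' f.key f.sib) (by simp [h])
      rw [pot_node, pot_node, h] at this
      linarith
    · have := ih (t := node f.sib f.key t) (t' := node f.sib f.key t') (by simp [h])
      rw [pot_node, pot_node, h] at this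
      linarith

theorem size_plug_congr (fs : List (Frame α)) {t t' : STree α} (h : t.size = t'.size) :
    (plug t fs).size = (plug t' fs).size := by
  obtain ⟨A, B, hp⟩ := inorder_plug fs
  simp only [size, hp, List.length_append] at h ⊢
  omega

end STree

/-- This is $4ab\le(a+b)^2\le c^2$. The summand $-2$ is the drop of potential that pays for a double
rotation. -/
theorem logb_two_add_logb_two_le {a b c : ℕ} (ha : 0 < a) (hb : 0 < b) (h : a + b ≤ c) :
    Real.logb 2 a + Real.logb 2 b ≤ 2 * Real.logb 2 c - 2 := by
  have ha' : (0 : ℝ) < a := by exact_mod_cast ha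
  have hb' : (0 : ℝ) < b := by exact_mod_cast hb
  have h' : (a : ℝ) + b ≤ c := by exact_mod_cast h
  have h4 : Real.logb 2 4 = 2 := by
    rw [show (4 : ℝ) = 2 ^ (2 : ℝ) by norm_num, Real.logb_rpow (by norm_num) (by norm_num)]
  have : Real.logb 2 (4 * (a * b)) ≤ Real.logb 2 (c ^ 2) :=
    Real.logb_le_logb_of_le (by norm_num) (by positivity) (by nlinarith [sq_nonneg ((a : ℝ) - b)])
  rw [Real.logb_mul (by norm_num) (by positivity), Real.logb_mul (by positivity) (by positivity),
    Real.logb_pow, h4] at this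
  push_cast at this
  linarith

theorem logb_two_mono {a b : ℕ} (ha : 0 < a) (h : a ≤ b) : Real.logb 2 a ≤ Real.logb 2 b :=
  Real.logb_le_logb_of_le (by norm_num) (by exact_mod_cast ha) (by exact_mod_cast h)

/-! ### The amortised cost of splaying. -/

namespace Splay

open STree

variable {α : Type} [LinearOrder α]

/-- Splaying the node with a given context. The amortised time leaves two steps for each
level of the context. -/
theorem runs_splay_plug {x : Ivl α} : ∀ (fs : List (Frame α)) (l r : STree α) (s : CF α),
    Holds s.cell none (plug (node l x r) fs) → (plug (node l x r) fs).inorder.Nodup →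
    Runs (splay x) s fun _ s' => ∃ l' r', Holds s'.cell none (node l' x r') ∧
      (node l' x r').inorder = (plug (node l x r) fs).inorder ∧
      (∀ y ∉ (plug (node l x r) fs).inorder, s'.cell y = s.cell y) ∧ s'.tree = s.tree ∧
      (s'.clock : ℝ) + 2 * fs.length + 12 * (node l' x r').pot +
        36 * Real.logb 2 (node l x r).size ≤
        s.clock + 12 * (plug (node l x r) fs).pot + 36 * Real.logb 2 (plug (node l x r) fs).size
          + 12
  | [], l, r, s, h, hn => by
    rw [splay]
    simp only [runs_bind, runs_readCell]
    rw [show s.cell x = _ from h.1]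
    refine runs_pure.2 ⟨l, r, h, rfl, fun _ _ => rfl, rfl, ?_⟩
    simp [plug]; linarith
  | [f], l, r, s, h, hn => by
    obtain ⟨⟨hx, -⟩, hp, -⟩ := (holds_plug _ _ (by simp)).1 h
    obtain ⟨d, p, u⟩ := f
    rw [splay]
    simp only [runs_bind, runs_readCell]
    rw [hx]
    simp only [ctxParent_cons, runs_bind, runs_readCell]
    rw [hp]
    cases d
    · simp only [ctxParent_nil, Bool.false_eq_true, if_false]
      refine (runs_rotate_left (fs := []) (s := { s with clock := s.clock + 1 + 1}) h hn).mono ?_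
      rintro _ s' ⟨h1, h2, h3, h4⟩
      refine ⟨_, _, h1, by simp [plug, inorder], h2, h3, ?_⟩
      have h5 : (s'.clock : ℝ) ≤ s.clock + 1 + 1 + 8 := by exact_mod_cast h4
      have h6 := logb_two_mono (a := l.size + r.size + 1)
        (b := u.size + (l.size + r.size + 1) + 1) (by omega) (by omega)
      have h7 := logb_two_mono (a := u.size + l.size + 1)
        (b := u.size + (l.size + r.size + 1) + 1) (by omega) (by omega)
      rw [show plug (node l x r) [⟨false, p, u⟩] = node u p (node l x r) from rfl]
      simp only [pot_node, size_node, List.length_singleton]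
      rw [show u.size + l.size + 1 + r.size + 1 = u.size + (l.size + r.size + 1) + 1 by ring]
      push_cast at *
      linarith
    · simp only [ctxParent_nil, if_true]
      refine (runs_rotate_right (fs := []) (s := { s with clock := s.clock + 1 + 1}) h hn).mono ?_
      rintro _ s' ⟨h1, h2, h3, h4⟩
      refine ⟨_, _, h1, by simp [plug, inorder], h2, h3, ?_⟩
      have h5 : (s'.clock : ℝ) ≤ s.clock + 1 + 1 + 8 := by exact_mod_cast h4
      have h6 := logb_two_mono (a := l.size + r.size + 1)
        (b := l.size + (r.size + u.size + 1) + 1) (by omega) (by omega)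
      have h7 := logb_two_mono (a := r.size + u.size + 1)
        (b := l.size + (r.size + u.size + 1) + 1) (by omega) (by omega)
      rw [show plug (node l x r) [⟨true, p, u⟩] = node (node l x r) p u from rfl]
      simp only [pot_node, size_node, List.length_singleton]
      rw [show l.size + r.size + 1 + u.size + 1 = l.size + (r.size + u.size + 1) + 1 by ring]
      push_cast at *
      linarith
  | f :: g :: fs, l, r, s, h, hn => by
    obtain ⟨⟨hx, -⟩, hp, -, hg, -⟩ := (holds_plug _ _ (by simp)).1 h
    -- `T` is the subtree at the grandparent, the part that the double rotation restructures.
    obtain ⟨T, hT, hTi, hTs⟩ : ∃ T, plug (node l x r) (f :: g :: fs) = plug T fs ∧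
        T = plug (node l x r) [f, g] ∧
        T.size = l.size + r.size + f.sib.size + g.sib.size + 3 := by
      refine ⟨plug (node l x r) [f, g], ?_, rfl, ?_⟩ <;> simp only [plug] <;> split_ifs <;>
        simp <;> ring
    -- What remains after any of the four double rotations. The 19 steps are three reads and two
    -- rotations of 8; with the 4 steps to be left over for two levels they are covered by
    -- $12\cdot2$, the scaled drop in the last hypothesis. The terms $3(\log|T|-\log|x|)$ telescope,
    -- giving the factor $36=12\cdot3$.
    have key : ∀ l2 r2 s2, Holds s2.cell none (plug (node l2 x r2) fs) →
        (∀ y ∉ (plug T fs).inorder, s2.cell y = s.cell y) → s2.tree = s.tree →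
        s2.clock ≤ s.clock + 19 → (node l2 x r2).inorder = T.inorder →
        (node l2 x r2).pot - T.pot ≤
          3 * (Real.logb 2 T.size - Real.logb 2 (node l x r).size) - 2 →
        Runs (splay x) s2 fun _ s' => ∃ l' r', Holds s'.cell none (node l' x r') ∧
          (node l' x r').inorder = (plug T fs).inorder ∧
          (∀ y ∉ (plug T fs).inorder, s'.cell y = s.cell y) ∧ s'.tree = s.tree ∧
          (s'.clock : ℝ) + 2 * (f :: g :: fs).length + 12 * (node l' x r').pot +
            36 * Real.logb 2 (node l x r).size ≤
            s.clock + 12 * (plug T fs).pot + 36 * Real.logb 2 (plug T fs).size + 12 := by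
      intro l2 r2 s2 h1 h2 h3 h4 h5 h6
      have h7 := inorder_plug_congr h5 fs
      have h8 : (node l2 x r2).size = T.size := by rw [size, size, h5]
      refine (runs_splay_plug fs l2 r2 s2 h1 (by rw [h7, ← hT]; exact hn)).mono ?_
      rintro _ s' ⟨l', r', h9, h10, h11, h12, h13⟩
      rw [h7] at h10 h11
      refine ⟨l', r', h9, h10, fun y hy => (h11 y hy).trans (h2 y hy), h12.trans h3, ?_⟩
      have h14 := pot_plug fs h8
      rw [size_plug_congr fs h8, h8] at h13
      have h15 : (s2.clock : ℝ) ≤ s.clock + 19 := by exact_mod_cast h4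
      simp only [List.length_cons]
      push_cast
      linarith
    rw [hT] at h hn ⊢
    obtain ⟨d, p, u⟩ := f
    obtain ⟨e, q, v⟩ := g
    have hn' := (perm_plug fs _).nodup_iff.1 hn
    rw [splay]
    simp only [runs_bind, runs_readCell]
    rw [hx]
    -- These two facts decide the zig-zig test of `splay` when the left child is the sibling and not
    -- the node on the path.
    have hux : p ∉ v.inorder → v.root ≠ some p := fun h e => h (root_mem e)
    have hvp : x ∉ u.inorder → u.root ≠ some x := fun h e => h (root_mem e)
    cases d <;> cases e <;> simp only [plug, Bool.false_eq_true, if_false, if_true] at hTi hp hg <;>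
      subst hTi <;>
      simp only [inorder, List.nodup_append, List.nodup_cons, List.mem_append, List.mem_cons]
        at hn' <;>
      specialize hux (by grind) <;> specialize hvp (by grind) <;>
      simp only [ctxParent_cons, runs_bind, runs_readCell, hp, hg, hux, hvp, if_true,
        root_node, iff_true, iff_false, not_true, if_false,
        not_false_eq_true, runs_bind]
    · refine (runs_rotate_left (s := { s with clock := s.clock + 1 + 1 + 1 }) h hn).mono ?_
      rintro _ s1 ⟨a1, a2, a3, a4⟩
      change Holds s1.cell none (plug (node (node v q u) p (node l x r)) fs) at a1
      have hn1 := hn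
      rw [inorder_plug_congr (t' := node (node v q u) p (node l x r)) (by simp [inorder]) fs] at hn1
      refine (runs_rotate_left a1 hn1).mono ?_
      rintro _ s2 ⟨b1, b2, b3, b4⟩
      refine key _ _ _ b1 (fun y hy => (b2 y ?_).trans (a2 y hy)) (b3.trans a3) ?_ ?_ ?_
      · rwa [inorder_plug_congr (t' := node (node v q u) p (node l x r)) (by simp [inorder]) fs] at hy
      · simp only at a4; omega
      · simp [inorder]
      · simp only [pot_node, size_node]
        have e1 := logb_two_add_logb_two_le (a := v.size + u.size + 1) (b := l.size + r.size + 1)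
          (c := v.size + (u.size + (l.size + r.size + 1) + 1) + 1) (by omega) (by omega) (by omega)
        have e2 := logb_two_mono (a := v.size + u.size + 1 + l.size + 1)
          (b := v.size + (u.size + (l.size + r.size + 1) + 1) + 1) (by omega) (by omega)
        have e3 := logb_two_mono (a := l.size + r.size + 1)
          (b := u.size + (l.size + r.size + 1) + 1) (by omega) (by omega)
        rw [show v.size + u.size + 1 + l.size + 1 + r.size + 1 =
          v.size + (u.size + (l.size + r.size + 1) + 1) + 1 by ring]
        push_cast at *
        linarith
    · refine (runs_rotate_left (s := { s with clock := s.clock + 1 + 1 + 1 }) (fs := ⟨true, q, v⟩ :: fs) h hn).mono ?_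
      rintro _ s1 ⟨a1, a2, a3, a4⟩
      change Holds s1.cell none (plug (node (node (node u p l) x r) q v) fs) at a1
      have hn1 := hn
      rw [inorder_plug_congr (t' := node (node (node u p l) x r) q v) (by simp [inorder]) fs] at hn1
      refine (runs_rotate_right a1 hn1).mono ?_
      rintro _ s2 ⟨b1, b2, b3, b4⟩
      refine key _ _ _ b1 (fun y hy => (b2 y ?_).trans (a2 y hy)) (b3.trans a3) ?_ ?_ ?_
      · rwa [inorder_plug_congr (t' := node (node (node u p l) x r) q v) (by simp [inorder]) fs] at hy
      · simp only at a4; omega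
      · simp [inorder]
      · simp only [pot_node, size_node]
        have e1 := logb_two_add_logb_two_le (a := u.size + l.size + 1) (b := r.size + v.size + 1)
          (c := u.size + (l.size + r.size + 1) + 1 + v.size + 1) (by omega) (by omega) (by omega)
        have e2 := logb_two_mono (a := l.size + r.size + 1)
          (b := u.size + (l.size + r.size + 1) + 1 + v.size + 1) (by omega) (by omega)
        have e3 := logb_two_mono (a := l.size + r.size + 1)
          (b := u.size + (l.size + r.size + 1) + 1) (by omega) (by omega)
        rw [show u.size + l.size + 1 + (r.size + v.size + 1) + 1 =
          u.size + (l.size + r.size + 1) + 1 + v.size + 1 by ring]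
        push_cast at *
        linarith
    · refine (runs_rotate_right (s := { s with clock := s.clock + 1 + 1 + 1 }) (fs := ⟨false, q, v⟩ :: fs) h hn).mono ?_
      rintro _ s1 ⟨a1, a2, a3, a4⟩
      change Holds s1.cell none (plug (node v q (node l x (node r p u))) fs) at a1
      have hn1 := hn
      rw [inorder_plug_congr (t' := node v q (node l x (node r p u))) (by simp [inorder]) fs] at hn1
      refine (runs_rotate_left a1 hn1).mono ?_
      rintro _ s2 ⟨b1, b2, b3, b4⟩
      refine key _ _ _ b1 (fun y hy => (b2 y ?_).trans (a2 y hy)) (b3.trans a3) ?_ ?_ ?_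
      · rwa [inorder_plug_congr (t' := node v q (node l x (node r p u))) (by simp [inorder]) fs] at hy
      · simp only at a4; omega
      · simp [inorder]
      · simp only [pot_node, size_node]
        have e1 := logb_two_add_logb_two_le (a := v.size + l.size + 1) (b := r.size + u.size + 1)
          (c := v.size + (l.size + r.size + 1 + u.size + 1) + 1) (by omega) (by omega) (by omega)
        have e2 := logb_two_mono (a := l.size + r.size + 1)
          (b := v.size + (l.size + r.size + 1 + u.size + 1) + 1) (by omega) (by omega)
        have e3 := logb_two_mono (a := l.size + r.size + 1)
          (b := l.size + r.size + 1 + u.size + 1) (by omega) (by omega)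
        rw [show v.size + l.size + 1 + (r.size + u.size + 1) + 1 =
          v.size + (l.size + r.size + 1 + u.size + 1) + 1 by ring]
        push_cast at *
        linarith
    · refine (runs_rotate_right (s := { s with clock := s.clock + 1 + 1 + 1 }) h hn).mono ?_
      rintro _ s1 ⟨a1, a2, a3, a4⟩
      change Holds s1.cell none (plug (node (node l x r) p (node u q v)) fs) at a1
      have hn1 := hn
      rw [inorder_plug_congr (t' := node (node l x r) p (node u q v)) (by simp [inorder]) fs] at hn1
      refine (runs_rotate_right a1 hn1).mono ?_
      rintro _ s2 ⟨b1, b2, b3, b4⟩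
      refine key _ _ _ b1 (fun y hy => (b2 y ?_).trans (a2 y hy)) (b3.trans a3) ?_ ?_ ?_
      · rwa [inorder_plug_congr (t' := node (node l x r) p (node u q v)) (by simp [inorder]) fs] at hy
      · simp only at a4; omega
      · simp [inorder]
      · simp only [pot_node, size_node]
        have e1 := logb_two_add_logb_two_le (a := u.size + v.size + 1) (b := l.size + r.size + 1)
          (c := l.size + r.size + 1 + u.size + 1 + v.size + 1) (by omega) (by omega) (by omega)
        have e2 := logb_two_mono (a := r.size + (u.size + v.size + 1) + 1)
          (b := l.size + r.size + 1 + u.size + 1 + v.size + 1) (by omega) (by omega)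
        have e3 := logb_two_mono (a := l.size + r.size + 1)
          (b := l.size + r.size + 1 + u.size + 1) (by omega) (by omega)
        rw [show l.size + (r.size + (u.size + v.size + 1) + 1) + 1 =
          l.size + r.size + 1 + u.size + 1 + v.size + 1 by ring]
        push_cast at *
        linarith
  termination_by fs => fs.length

end Splay

/-- The logarithmic factor of the time bounds. -/
noncomputable def lg (n : ℕ) : ℝ := Real.logb 2 (n + 2)

theorem one_le_lg (n : ℕ) : 1 ≤ lg n := by
  rw [lg, Real.le_logb_iff_rpow_le (by norm_num) (by positivity)]
  have : (0 : ℝ) ≤ n := n.cast_nonneg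
  norm_num

theorem lg_mono {m n : ℕ} (h : m ≤ n) : lg m ≤ lg n := by
  have : (m : ℝ) ≤ n := by exact_mod_cast h
  exact Real.logb_le_logb_of_le (by norm_num) (by positivity) (by linarith)

theorem logb_le_lg {m n : ℕ} (hm : 0 < m) (h : m ≤ n) : Real.logb 2 m ≤ lg n := by
  have : (m : ℝ) ≤ n := by exact_mod_cast h
  exact Real.logb_le_logb_of_le (by norm_num) (by exact_mod_cast hm) (by linarith)

theorem logb_nonneg_of_pos {m : ℕ} (hm : 0 < m) : 0 ≤ Real.logb 2 m :=
  Real.logb_nonneg (by norm_num) (by exact_mod_cast hm)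

/-! ### Families of disjoint splay trees and their operations. -/

section Forest

open STree

variable {α : Type} [LinearOrder α]

@[simp] theorem STree.pot_nil : (nil : STree α).pot = 0 := rfl
@[simp] theorem STree.size_nil : (nil : STree α).size = 0 := rfl

theorem STree.plug_append (fs gs : List (Frame α)) : ∀ t : STree α,
    plug t (fs ++ gs) = plug (plug t fs) gs := by
  induction fs with
  | nil => intro t; rfl
  | cons f fs ih => intro t; simp only [List.cons_append, plug, ih]; split_ifs <;> rfl

/-- The intervals stored in a list of trees. -/
def keys (F : List (STree α)) : List (Ivl α) := F.flatMap inorder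

@[simp] theorem keys_nil : keys ([] : List (STree α)) = [] := rfl
@[simp] theorem keys_cons (t : STree α) (F : List (STree α)) :
    keys (t :: F) = t.inorder ++ keys F := rfl
@[simp] theorem keys_append (F G : List (STree α)) : keys (F ++ G) = keys F ++ keys G :=
  List.flatMap_append

theorem mem_keys {F : List (STree α)} {x : Ivl α} : x ∈ keys F ↔ ∃ t ∈ F, x ∈ t.inorder := by
  simp [keys]

theorem keys_perm {F G : List (STree α)} (h : F.Perm G) : (keys F).Perm (keys G) :=
  h.flatMap_right _

/-- The memory holds exactly the splay trees `F`, which are disjoint and have at most `n` nodes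
altogether. -/
structure Stores (n : ℕ) (F : List (STree α)) (s : CF α) : Prop where
  holds : ∀ t ∈ F, Holds s.cell none t
  nodup : (keys F).Nodup
  blank : ∀ x ∉ keys F, s.cell x = Cell.blank
  length_le : (keys F).length ≤ n

/-- The clock together with the potential of the splay trees. -/
noncomputable def energy (F : List (STree α)) (s : CF α) : ℝ :=
  s.clock + 12 * (F.map pot).sum

@[simp] theorem energy_cons (t : STree α) (F : List (STree α)) (s : CF α) :
    energy (t :: F) s = 12 * t.pot + energy F s := by
  simp [energy]; ring

theorem energy_perm {F G : List (STree α)} (h : F.Perm G) (s : CF α) :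
    energy F s = energy G s := by
  rw [energy, energy, (h.map pot).sum_eq]

theorem energy_of_clock {F : List (STree α)} {s s' : CF α} {k : ℕ}
    (h : s'.clock ≤ s.clock + k) : energy F s' ≤ energy F s + k := by
  have : (s'.clock : ℝ) ≤ s.clock + k := by exact_mod_cast h
  simp only [energy]; linarith

theorem clock_le_energy (F : List (STree α)) (s : CF α) : (s.clock : ℝ) ≤ energy F s := by
  have : 0 ≤ (F.map pot).sum := List.sum_nonneg fun x hx => by
    obtain ⟨t, -, rfl⟩ := List.mem_map.1 hx
    exact t.pot_nonneg
  simp only [energy]; linarith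

namespace Stores

variable {n : ℕ} {F G : List (STree α)} {s s' : CF α} {t : STree α}

theorem perm (h : Stores n F s) (hp : F.Perm G) : Stores n G s where
  holds t ht := h.holds t (hp.mem_iff.2 ht)
  nodup := (keys_perm hp).nodup_iff.1 h.nodup
  blank x hx := h.blank x (by rwa [(keys_perm hp).mem_iff])
  length_le := (keys_perm hp).length_eq ▸ h.length_le

theorem of_cell_eq (h : Stores n F s) (hc : s'.cell = s.cell) : Stores n F s' :=
  ⟨hc ▸ h.holds, h.nodup, hc ▸ h.blank, h.length_le⟩

/-- The frame rule: an operation that touches only the records of `T` and keeps their set of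
intervals leaves all other trees intact. -/
theorem replace {T T' : List (STree α)} (h : Stores n (T ++ F) s)
    (hT : ∀ t ∈ T', Holds s'.cell none t) (hk : (keys T').Perm (keys T))
    (hc : ∀ y ∉ keys T, s'.cell y = s.cell y) : Stores n (T' ++ F) s' := by
  have hk' : (keys (T' ++ F)).Perm (keys (T ++ F)) := by
    simpa using hk.append_right (keys F)
  have hn := h.nodup
  rw [keys_append, List.nodup_append] at hn
  refine ⟨fun t ht => ?_, hk'.nodup_iff.2 h.nodup, fun x hx => ?_, hk'.length_eq ▸ h.length_le⟩
  · rcases List.mem_append.1 ht with ht | ht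
    · exact hT t ht
    · exact (h.holds t (by simp [ht])).congr fun x hx =>
        hc x fun hx' => hn.2.2 x hx' x (mem_keys.2 ⟨t, ht, hx⟩) rfl
  · rw [hk'.mem_iff] at hx
    rw [hc x fun hx' => hx (by simp [hx']), h.blank x hx]

theorem holds_head (h : Stores n (t :: F) s) : Holds s.cell none t := h.holds t (by simp)

theorem nodup_head (h : Stores n (t :: F) s) : t.inorder.Nodup := by
  have := h.nodup
  rw [keys_cons, List.nodup_append] at this
  exact this.1

theorem size_head_le (h : Stores n (t :: F) s) : t.size ≤ n := by
  have := h.length_le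
  rw [keys_cons, List.length_append] at this
  exact le_trans (by simp [size]) this

/-- The bound 48 is $36+12$, as $\mathrm{lg}\,n\ge1$. The surplus of two steps per level is kept,
since it pays for the walk down to `x` that precedes the splaying. -/
theorem splay_plug {l r : STree α} {x : Ivl α} {fs : List (Frame α)}
    (h : Stores n (plug (node l x r) fs :: F) s) :
    Runs (Splay.splay x) s fun _ s' => ∃ l' r', Stores n (node l' x r' :: F) s' ∧
      (node l' x r').inorder = (plug (node l x r) fs).inorder ∧ s'.tree = s.tree ∧
      energy (node l' x r' :: F) s' + 2 * fs.length ≤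
        energy (plug (node l x r) fs :: F) s + 48 * lg n := by
  refine (Splay.runs_splay_plug fs l r s (h.holds _ (by simp)) h.nodup_head).mono ?_
  rintro _ s' ⟨l', r', h1, h2, h3, h4, h5⟩
  refine ⟨l', r', replace (T := [plug (node l x r) fs]) (T' := [node l' x r']) h (by simpa)
    (by simp [keys, h2]) (by simpa [keys] using h3), h2, h4, ?_⟩
  have h6 := logb_nonneg_of_pos (m := (node l x r).size) (by simp)
  have h7 := size_le_plug (node l x r) fs
  rw [size_node] at h7
  have h8 := logb_le_lg (by omega) h.size_head_le
  have h9 := one_le_lg n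
  simp only [energy, List.map_cons, List.sum_cons]
  linarith

theorem splay {x : Ivl α} (h : Stores n (t :: F) s) (hx : x ∈ t.inorder) :
    Runs (Splay.splay x) s fun _ s' => ∃ l' r', Stores n (node l' x r' :: F) s' ∧
      (node l' x r').inorder = t.inorder ∧ s'.tree = s.tree ∧
      energy (node l' x r' :: F) s' ≤ energy (t :: F) s + 48 * lg n := by
  obtain ⟨l, r, fs, rfl⟩ := exists_plug hx
  refine h.splay_plug.mono ?_
  rintro _ s' ⟨l', r', h1, h2, h3, h4⟩
  exact ⟨l', r', h1, h2, h3, by linarith [Nat.cast_nonneg (α := ℝ) fs.length]⟩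

end Stores

/-- The length of the context `fs` is the length of the walk, in the form in which
`Stores.splay_plug` refunds it. The same holds for `runs_descend`. -/
theorem runs_rightmost (t : STree α) : ∀ {l r : STree α} {x : Ivl α} {p : Option (Ivl α)}
    {s : CF α}, t = node l x r → Holds s.cell p t →
    Runs (Splay.rightmost x) s fun y s' => ∃ fs l', t = plug (node l' y nil) fs ∧
      t.inorder.getLast? = some y ∧ s' = { s with clock := s.clock + (fs.length + 1) } := by
  induction t with
  | nil => intro l r x p s h; cases h
  | node l x r _ ih =>
    intro l' r' x' p s h hh
    cases h
    rw [Splay.rightmost]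
    simp only [runs_bind, runs_readCell]
    rw [hh.1]
    cases r with
    | nil => exact runs_pure.2 ⟨[], l, rfl, by simp [inorder], rfl⟩
    | node l2 y r2 =>
      simp only [root_node]
      refine (ih rfl (s := { s with clock := s.clock + 1 }) hh.2.2).mono ?_
      rintro z s' ⟨fs, l', h1, h2, h3⟩
      refine ⟨fs ++ [⟨false, x, l⟩], l', ?_, ?_, ?_⟩
      · rw [plug_append, ← h1]; rfl
      · rw [inorder, List.getLast?_append, List.getLast?_cons, h2]; simp
      · rw [h3]; simp; ring

theorem runs_descend (i : Ivl α) (t : STree α) : ∀ {l r : STree α} {x : Ivl α}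
    {p : Option (Ivl α)} {s : CF α}, t = node l x r → Holds s.cell p t →
    t.inorder.Pairwise (fun a b => a.f < b.f) →
    Runs (Splay.descend i x) s fun y s' => ∃ fs l' r', t = plug (node l' y r') fs ∧
      (i ∈ t.inorder → y = i) ∧ s' = { s with clock := s.clock + (fs.length + 1) } := by
  induction t with
  | nil => intro l r x p s h; cases h
  | node l x r ihl ihr =>
    intro l' r' x' p s h hh hs
    cases h
    rw [inorder, List.pairwise_append, List.pairwise_cons] at hs
    obtain ⟨hs1, ⟨hs2, hs3⟩, hs4⟩ := hs
    rw [Splay.descend]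
    simp only [runs_bind, runs_readCell]
    rw [hh.1]
    by_cases hix : i = x
    · simp only [hix, if_true]
      exact runs_pure.2 ⟨[], l, r, rfl, fun _ => rfl, rfl⟩
    simp only [hix, if_false]
    by_cases hlt : i.f < x.f
    · simp only [hlt, if_true]
      have hr : i ∈ (node l x r).inorder → i ∈ l.inorder := by
        simp only [inorder, List.mem_append, List.mem_cons, hix, false_or]
        rintro (h | h)
        · exact h
        · exact absurd hlt (hs2 i h).not_gt
      cases l with
      | nil => exact runs_pure.2 ⟨[], nil, r, rfl, fun h => by simpa [inorder] using hr h, rfl⟩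
      | node l2 y r2 =>
        simp only [root_node]
        refine (ihl rfl (s := { s with clock := s.clock + 1 }) hh.2.1 hs1).mono ?_
        rintro z s' ⟨fs, l', r', h1, h2, h3⟩
        refine ⟨fs ++ [⟨true, x, r⟩], l', r', ?_, fun h => h2 (hr h), ?_⟩
        · rw [plug_append, ← h1]; rfl
        · rw [h3]; simp; ring
    · simp only [hlt, if_false]
      have hr : i ∈ (node l x r).inorder → i ∈ r.inorder := by
        simp only [inorder, List.mem_append, List.mem_cons, hix, false_or]
        rintro (h | h)
        · exact absurd (hs4 i h x (by simp)) hlt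
        · exact h
      cases r with
      | nil => exact runs_pure.2 ⟨[], l, nil, rfl, fun h => by simpa [inorder] using hr h, rfl⟩
      | node l2 y r2 =>
        simp only [root_node]
        refine (ihr rfl (s := { s with clock := s.clock + 1 }) hh.2.2 hs3).mono ?_
        rintro z s' ⟨fs, l', r', h1, h2, h3⟩
        refine ⟨fs ++ [⟨false, x, l⟩], l', r', ?_, fun h => h2 (hr h), ?_⟩
        · rw [plug_append, ← h1]; rfl
        · rw [h3]; simp; ring

namespace Stores

variable {n : ℕ} {F G : List (STree α)} {s s' : CF α} {t : STree α}

/-- Two splayings at 48 each; the walk between them is refunded by the second one up to a single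
step. -/
theorem maximum {x : Ivl α} (h : Stores n (t :: F) s) (hx : x ∈ t.inorder) :
    Runs (Splay.maximum x) s fun m s' => ∃ l', Stores n (node l' m nil :: F) s' ∧
      (node l' m nil).inorder = t.inorder ∧ s'.tree = s.tree ∧
      energy (node l' m nil :: F) s' ≤ energy (t :: F) s + 97 * lg n := by
  refine (h.splay hx).bind ?_
  rintro _ s1 ⟨l1, r1, a1, a2, a3, a4⟩
  refine (runs_rightmost _ rfl (a1.holds_head)).bind ?_
  rintro m s2 ⟨fs, l2, b1, b2, rfl⟩
  rw [b1] at a1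
  refine Runs.bind (splay_plug (a1.of_cell_eq rfl)) ?_
  rintro _ s3 ⟨l3, r3, c1, c2, c3, c4⟩
  rw [← b1] at c2 c4
  -- The root `m` is also the last element of a list without repetitions, so nothing stands to its
  -- right.
  have hr : r3 = nil := by
    have hnd := c1.nodup_head
    rw [← c2, inorder] at b2
    rw [inorder, List.nodup_append, List.nodup_cons] at hnd
    cases r3 with
    | nil => rfl
    | node l4 y r4 =>
      exfalso
      rw [List.getLast?_append, List.getLast?_cons] at b2
      simp only [Option.some_or, Option.some.injEq] at b2
      rcases hL : (l4.node y r4).inorder.getLast? with _ | z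
      · simp [inorder] at hL
      · rw [hL] at b2
        simp only [Option.getD_some] at b2
        exact hnd.2.1.1 (b2 ▸ List.mem_of_getLast? hL)
  subst hr
  refine runs_pure.2 ⟨l3, c1, c2.trans a2, c3.trans a3, ?_⟩
  have := one_le_lg n
  simp only [energy_cons] at *
  simp only [energy] at *
  push_cast at *
  linarith [Nat.cast_nonneg (α := ℝ) fs.length]

theorem find {x i : Ivl α} (h : Stores n (t :: F) s) (hx : x ∈ t.inorder)
    (hs : t.inorder.Pairwise fun a b => a.f < b.f) :
    Runs (Splay.find x i) s fun y s' => ∃ t', Stores n (t' :: F) s' ∧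
      t'.inorder = t.inorder ∧ (y = i ↔ i ∈ t.inorder) ∧ s'.tree = s.tree ∧
      energy (t' :: F) s' ≤ energy (t :: F) s + 97 * lg n := by
  refine (h.splay hx).bind ?_
  rintro _ s1 ⟨l1, r1, a1, a2, a3, a4⟩
  refine (runs_descend i _ rfl (a1.holds_head) (a2 ▸ hs)).bind ?_
  rintro m s2 ⟨fs, l2, r2, b1, b2, rfl⟩
  rw [b1] at a1
  refine Runs.bind (splay_plug (a1.of_cell_eq rfl)) ?_
  rintro _ s3 ⟨l3, r3, c1, c2, c3, c4⟩
  rw [← b1] at c2 c4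
  rw [a2] at b2
  refine runs_pure.2 ⟨_, c1, c2.trans a2, ⟨?_, b2⟩, c3.trans a3, ?_⟩
  · rintro rfl
    rw [← a2, ← c2]
    simp [inorder]
  have := one_le_lg n
  simp only [energy_cons] at *
  simp only [energy] at *
  push_cast at *
  linarith [Nat.cast_nonneg (α := ℝ) fs.length]

theorem predecessor {r : Ivl α} (h : Stores n (t :: F) s) (hr : r ∈ t.inorder) :
    Runs (Splay.predecessor r) s fun o s' => ∃ t' A B, Stores n (t' :: F) s' ∧
      t'.inorder = t.inorder ∧ t.inorder = A ++ r :: B ∧ o = A.getLast? ∧ s'.tree = s.tree ∧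
      energy (t' :: F) s' ≤ energy (t :: F) s + 98 * lg n := by
  refine (h.splay hr).bind ?_
  rintro _ s1 ⟨l1, r1, a1, a2, a3, a4⟩
  have hlg := one_le_lg n
  simp only [runs_bind, runs_readCell]
  obtain ⟨hc, hl, -⟩ := a1.holds_head
  rw [hc]
  cases l1 with
  | nil =>
    refine runs_pure.2 ⟨_, [], r1.inorder, a1.of_cell_eq rfl, a2, a2.symm, rfl, a3, ?_⟩
    simp only [energy_cons] at *
    simp only [energy] at *
    push_cast at *
    linarith
  | node l2 y r2 =>
    simp only [root_node, runs_bind]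
    refine (runs_rightmost _ (s := { s1 with clock := s1.clock + 1 }) rfl hl).mono ?_
    rintro m s2 ⟨fs, l3, b1, b2, rfl⟩
    -- The walk starts at the left child of `r`. Adding the frame of `r` describes it inside the
    -- whole tree, which is the tree that gets splayed.
    have e : node (l2.node y r2) r r1 = plug (node l3 m nil) (fs ++ [⟨true, r, r1⟩]) := by
      rw [plug_append, ← b1]; rfl
    rw [e] at a1
    refine Runs.mono (splay_plug (a1.of_cell_eq rfl)) ?_
    rintro _ s3 ⟨l4, r4, c1, c2, c3, c4⟩
    rw [← e] at c2 c4
    refine runs_pure.2 ⟨_, _, _, c1, c2.trans a2, a2.symm, b2.symm, c3.trans a3, ?_⟩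
    simp only [energy_cons] at *
    simp only [energy, List.length_append, List.length_singleton] at *
    push_cast at *
    linarith [Nat.cast_nonneg (α := ℝ) fs.length]

theorem split {u : Ivl α} (h : Stores n (t :: F) s) (hu : u ∈ t.inorder) :
    Runs (Splay.split u) s fun _ s' => ∃ l r, Stores n (l :: node nil u r :: F) s' ∧
      t.inorder = l.inorder ++ u :: r.inorder ∧ s'.tree = s.tree ∧
      energy (l :: node nil u r :: F) s' ≤ energy (t :: F) s + 53 * lg n := by
  refine (h.splay hu).bind ?_
  rintro _ s1 ⟨l1, r1, a1, a2, a3, a4⟩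
  have hlg := one_le_lg n
  simp only [runs_bind, runs_readCell]
  obtain ⟨hc, hl, hr⟩ := a1.holds_head
  have hn := a1.nodup_head
  rw [hc]
  cases l1 with
  | nil =>
    -- If nothing precedes `u`, an empty tree is listed as the left part. It has no records and no
    -- potential, and it saves a case distinction for the callers.
    refine runs_pure.2 ⟨nil, r1, ?_, a2.symm, a3, ?_⟩
    · exact replace (T := [node nil u r1]) (T' := [nil, node nil u r1]) a1
        (by simpa [Holds] using ⟨hc, hr⟩) (by simp [inorder]) (fun _ _ => rfl)
    · simp only [energy_cons] at *
      simp only [energy, pot_nil] at *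
      push_cast at *
      linarith
  | node l2 y r2 =>
    simp only [inorder, List.nodup_append, List.nodup_cons, List.mem_append, List.mem_cons] at hn
    have huy : u ≠ y := by grind
    simp only [root_node, runs_bind, runs_setParent, runs_setLeft]
    refine ⟨node l2 y r2, r1, ?_, a2.symm, a3, ?_⟩
    · refine replace (T := [node (node l2 y r2) u r1]) (T' := [node l2 y r2, node nil u r1]) a1
        ?_ (by simp [inorder]) ?_
      · simp only [List.mem_cons, List.not_mem_nil, or_false, forall_eq_or_imp, forall_eq]
        constructor
        · refine hl.reparent (by simp [inorder]; grind) ?_ ?_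
          · rintro b ⟨⟩
            simp [huy.symm]
          · intro z hz hz'
            simp only [inorder, List.mem_append, List.mem_cons] at hz
            have h1 : z ≠ y := fun e => hz' (by simp [e])
            have h2 : z ≠ u := by grind
            simp [h1, h2]
        · refine ⟨by simp [huy, hc], trivial, hr.congr fun z hz => ?_⟩
          have h1 : z ≠ y := by grind
          have h2 : z ≠ u := by grind
          simp [h1, h2]
      · intro z hz
        simp only [keys_cons, keys_nil, inorder, List.mem_append, List.mem_cons, not_or] at hz
        simp [hz]
    -- Cutting off the left subtree only shrinks the subtree of `u`, so the potential does not grow.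
    -- The 5 steps for one read and two link changes raise 48 to 53.
    · have h1 := logb_two_mono (a := r1.size + 1) (b := l2.size + r2.size + 1 + r1.size + 1)
        (by omega) (by omega)
      simp only [energy_cons] at *
      simp only [energy, pot_node, size_node, pot_nil, size_nil, zero_add] at *
      push_cast at *
      linarith

theorem remove {i : Ivl α} (h : Stores n (t :: F) s) (hi : i ∈ t.inorder) :
    Runs (Splay.remove i) s fun _ s' => ∃ l r, Stores n (l :: node nil i nil :: r :: F) s' ∧
      t.inorder = l.inorder ++ i :: r.inorder ∧ s'.tree = s.tree ∧
      energy (l :: node nil i nil :: r :: F) s' ≤ energy (t :: F) s + 58 * lg n := by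
  refine (h.split hi).bind ?_
  rintro _ s1 ⟨l, r, a1, a2, a3, a4⟩
  have hlg := one_le_lg n
  simp only [runs_bind, runs_readCell]
  replace a1 := a1.perm (List.Perm.swap _ _ _)
  obtain ⟨hc, -, hr⟩ := a1.holds_head
  have hn := a1.nodup_head
  rw [hc]
  cases r with
  | nil =>
    refine runs_pure.2 ⟨l, nil, ?_, a2, a3, ?_⟩
    · refine Stores.perm (F := node nil i nil :: nil :: l :: F) ?_ ?_
      · exact replace (T := [node nil i nil]) (T' := [node nil i nil, nil]) a1
          (by simpa [Holds] using hc) (by simp [inorder]) (fun _ _ => rfl)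
      · exact (List.perm_append_comm (l₁ := [node nil i nil, nil]) (l₂ := [l])).append_right F
    · simp only [energy_cons] at *
      simp only [energy, pot_nil] at *
      push_cast at *
      linarith
  | node l2 y r2 =>
    simp only [inorder, List.nodup_append, List.nodup_cons, List.mem_append, List.mem_cons,
      List.nil_append] at hn
    have hiy : i ≠ y := by grind
    simp only [root_node, runs_bind, runs_setParent, runs_setRight]
    refine ⟨l, node l2 y r2, ?_, a2, a3, ?_⟩
    · refine Stores.perm (F := node nil i nil :: node l2 y r2 :: l :: F) ?_ ?_
      · refine replace (T := [node nil i (node l2 y r2)]) (T' := [node nil i nil, node l2 y r2])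
          a1 ?_ (by simp [inorder]) ?_
        · simp only [List.mem_cons, List.not_mem_nil, or_false, forall_eq_or_imp, forall_eq]
          constructor
          · refine ⟨by simp [hiy, hc], trivial, trivial⟩
          · refine hr.reparent (by simp [inorder]; grind) ?_ ?_
            · rintro b ⟨⟩
              simp [hiy.symm]
            · intro z hz hz'
              simp only [inorder, List.mem_append, List.mem_cons] at hz
              have h1 : z ≠ y := fun e => hz' (by simp [e])
              have h2 : z ≠ i := by grind
              simp [h1, h2]
        · intro z hz
          simp only [keys_cons, keys_nil, inorder, List.mem_append, List.mem_cons, not_or] at hz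
          simp [hz]
      · exact (List.perm_append_comm (l₁ := [node nil i nil, node l2 y r2])
          (l₂ := [l])).append_right F |>.trans (by simp)
    · have h1 := logb_nonneg_of_pos (m := l2.size + r2.size + 1 + 1) (by omega)
      simp only [energy_cons] at *
      simp only [energy, pot_node, size_node, pot_nil, size_nil, zero_add] at *
      norm_num at *
      linarith

theorem join {a b : Ivl α} {u : STree α} (h : Stores n (t :: u :: F) s) (ha : a ∈ t.inorder)
    (hb : b ∈ u.inorder) :
    Runs (Splay.join a b) s fun _ s' => ∃ t', Stores n (t' :: F) s' ∧
      t'.inorder = t.inorder ++ u.inorder ∧ s'.tree = s.tree ∧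
      energy (t' :: F) s' ≤ energy (t :: u :: F) s + 161 * lg n := by
  refine (h.maximum ha).bind ?_
  rintro m s1 ⟨l1, a1, a2, a3, a4⟩
  replace a1 := a1.perm (List.Perm.swap _ _ _)
  refine (a1.splay hb).bind ?_
  rintro _ s2 ⟨l2, r2, b1, b2, b3, b4⟩
  have hlg := one_le_lg n
  obtain ⟨hc, hl, hr⟩ := b1.holds _ (by simp : node l2 b r2 ∈ _)
  obtain ⟨hc', hl', -⟩ := b1.holds _ (by simp : node l1 m nil ∈ _)
  have hn := b1.nodup
  simp only [keys_cons, inorder, List.nodup_append, List.nodup_cons, List.mem_append,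
    List.mem_cons, List.not_mem_nil] at hn
  have hbm : b ≠ m := by grind
  simp only [runs_bind, runs_setParent, runs_setRight]
  have b1' := replace (s' := ⟨s2.tree, Function.update (Function.update s2.cell m
      ⟨(s2.cell m).parent, (s2.cell m).left, some b⟩) b ⟨some m,
      (Function.update s2.cell m ⟨(s2.cell m).parent, (s2.cell m).left, some b⟩ b).left,
      (Function.update s2.cell m ⟨(s2.cell m).parent, (s2.cell m).left, some b⟩ b).right⟩,
      s2.clock + 2 + 2⟩) (T := [node l2 b r2, node l1 m nil])
      (T' := [node l1 m (node l2 b r2)]) b1 ?_ ?_ ?_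
  · refine ⟨node l1 m (node l2 b r2), b1', ?_, b3.trans a3, ?_⟩
    · rw [← a2, ← b2]; simp [inorder]
    -- The new root `m` gains the whole second tree, which adds at most $12\,\mathrm{lg}\,n$ to the
    -- energy: $161=97+48+4+12$.
    · have h1 := logb_nonneg_of_pos (m := l1.size + 1) (by omega)
      have h2 := logb_le_lg (m := l1.size + (l2.size + r2.size + 1) + 1) (by omega)
        (by simpa using b1'.size_head_le)
      simp only [energy_cons] at *
      simp only [energy, pot_node, size_node, pot_nil, size_nil] at *
      push_cast at *
      norm_num at *
      linarith
  · simp only [List.mem_cons, List.not_mem_nil, or_false, forall_eq]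
    refine ⟨by simp [hbm.symm, hc'], hl'.congr fun z hz => ?_, ?_⟩
    · have h1 : z ≠ b := by grind
      have h2 : z ≠ m := by grind
      simp [h1, h2]
    · refine ⟨by simp [hbm, hc], hl.congr fun z hz => ?_, hr.congr fun z hz => ?_⟩
      all_goals
        have h1 : z ≠ b := by grind
        have h2 : z ≠ m := by grind
        simp [h1, h2]
  · rw [List.perm_iff_count]
    intro z
    simp only [keys_cons, keys_nil, inorder, List.count_append, List.count_cons, List.count_nil]
    ring
  · intro z hz
    simp only [keys_cons, keys_nil, inorder, List.mem_append, List.mem_cons, not_or] at hz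
    simp [hz]

end Stores

end Forest

/-! ### Balance, cost and correctness of the search tree. -/

namespace AVL

variable {α : Type} [LinearOrder α]

/-- The intervals of a tree in symmetric order. -/
def toList : AVL α → List (Ivl α)
  | nil => []
  | node _ l x r => l.toList ++ x :: r.toList

/-- The stored heights are correct and the subtrees of each node differ in height by at most
one. -/
def Balanced : AVL α → Prop
  | nil => True
  | node h l _ r => h = max l.height r.height + 1 ∧ l.height ≤ r.height + 1 ∧
      r.height ≤ l.height + 1 ∧ l.Balanced ∧ r.Balanced

/-- The tree is a search tree for the starting times. -/
def Sorted (t : AVL α) : Prop := t.toList.Pairwise fun a b => a.s < b.s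

theorem mem_iff {i : Ivl α} {t : AVL α} : Mem i t ↔ i ∈ t.toList := by
  induction t with
  | nil => simp [Mem, toList]
  | node h l x r ihl ihr => simp [Mem, toList, ihl, ihr]

theorem sorted_node {h : ℕ} {l r : AVL α} {x : Ivl α} : (node h l x r).Sorted ↔
    l.Sorted ∧ r.Sorted ∧ (∀ y ∈ l.toList, y.s < x.s) ∧ (∀ y ∈ r.toList, x.s < y.s) := by
  simp only [Sorted, toList, List.pairwise_append, List.pairwise_cons, List.mem_cons]
  constructor
  · rintro ⟨h1, ⟨h2, h3⟩, h4⟩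
    exact ⟨h1, h3, fun y hy => h4 y hy x (.inl rfl), h2⟩
  · rintro ⟨h1, h2, h3, h4⟩
    refine ⟨h1, ⟨h4, h2⟩, fun y hy z hz => ?_⟩
    rcases hz with rfl | hz
    · exact h3 y hy
    · exact (h3 y hy).trans (h4 z hz)

theorem sorted_of_toList {t : AVL α} {l r : AVL α} {x : Ivl α}
    (ht : t.toList = l.toList ++ x :: r.toList) (hl : l.Sorted) (hr : r.Sorted)
    (hlx : ∀ y ∈ l.toList, y.s < x.s) (hrx : ∀ y ∈ r.toList, x.s < y.s) : t.Sorted := by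
  have := (sorted_node (h := 0)).2 ⟨hl, hr, hlx, hrx⟩
  rw [Sorted, toList] at this
  rwa [Sorted, ht]

@[simp] theorem height_nil : (nil : AVL α).height = 0 := rfl
@[simp] theorem height_node (h : ℕ) (l r : AVL α) (x : Ivl α) : (node h l x r).height = h := rfl

@[simp] theorem toList_mk (l r : AVL α) (x : Ivl α) :
    (mk l x r).toList = l.toList ++ x :: r.toList := rfl

@[simp] theorem height_mk (l r : AVL α) (x : Ivl α) :
    (mk l x r).height = max l.height r.height + 1 := rfl

theorem balanced_mk {l r : AVL α} {x : Ivl α} : (mk l x r).Balanced ↔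
    l.height ≤ r.height + 1 ∧ r.height ≤ l.height + 1 ∧ l.Balanced ∧ r.Balanced := by
  simp [mk, Balanced]

@[simp] theorem toList_balance (l r : AVL α) (x : Ivl α) :
    (balance l x r).toList = l.toList ++ x :: r.toList := by
  unfold balance
  split_ifs <;> repeat' split
  all_goals simp [toList]

/-- After an update in one subtree the heights differ by at most 2. If no rotation is needed the
height is exact, otherwise it may be one less; the last clause separates the two cases, so that the
height of the whole tree is seen to change by at most one. -/
theorem balanced_balance {l r : AVL α} (x : Ivl α) (hl : l.Balanced) (hr : r.Balanced)
    (h1 : l.height ≤ r.height + 2) (h2 : r.height ≤ l.height + 2) :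
    (balance l x r).Balanced ∧ max l.height r.height ≤ (balance l x r).height ∧
      (balance l x r).height ≤ max l.height r.height + 1 ∧
      (l.height ≤ r.height + 1 → r.height ≤ l.height + 1 →
        (balance l x r).height = max l.height r.height + 1) := by
  unfold balance
  split_ifs with h3 h4
  · cases l with
    | nil => simp at h3
    | node h ll lx lr =>
      simp only [Balanced, height_node] at *
      obtain ⟨rfl, h5, h6, h7, h8⟩ := hl
      split_ifs with h9
      · simp only [balanced_mk, height_mk]
        refine ⟨⟨?_, ?_, h7, ?_, ?_, h8, hr⟩, ?_, ?_, ?_⟩ <;> omega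
      · cases lr with
        | nil => simp at h9
        | node k a b c =>
          simp only [Balanced, height_node] at *
          obtain ⟨rfl, h10, h11, h12, h13⟩ := h8
          simp only [balanced_mk, height_mk]
          refine ⟨⟨?_, ?_, ⟨?_, ?_, h7, h12⟩, ?_, ?_, h13, hr⟩, ?_, ?_, ?_⟩ <;> omega
  · cases r with
    | nil => simp at h4
    | node h rl rx rr =>
      simp only [Balanced, height_node] at *
      obtain ⟨rfl, h5, h6, h7, h8⟩ := hr
      split_ifs with h9
      · simp only [balanced_mk, height_mk]
        refine ⟨⟨?_, ?_, ⟨?_, ?_, hl, h7⟩, h8⟩, ?_, ?_, ?_⟩ <;> omega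
      · cases rl with
        | nil => simp at h9
        | node k a b c =>
          simp only [Balanced, height_node] at *
          obtain ⟨rfl, h10, h11, h12, h13⟩ := h7
          simp only [balanced_mk, height_mk]
          refine ⟨⟨?_, ?_, ⟨?_, ?_, hl, h12⟩, ?_, ?_, h13, h8⟩, ?_, ?_, ?_⟩ <;> omega
  · simp only [balanced_mk, height_mk]
    refine ⟨⟨?_, ?_, hl, hr⟩, ?_, ?_, fun _ _ => by simp⟩ <;> omega

/-- Squaring the size avoids Fibonacci numbers: the lower subtree has height at least $h-2$, both
subtrees obey its bound $2^{h-2}$, and $4\min(a,b)^2\le(a+b)^2$. -/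
theorem two_pow_height_le {t : AVL α} (h : t.Balanced) :
    2 ^ t.height ≤ (t.toList.length + 1) ^ 2 := by
  induction t with
  | nil => simp [toList]
  | node h l x r ihl ihr =>
    obtain ⟨rfl, h1, h2, h3, h4⟩ := h
    specialize ihl h3
    specialize ihr h4
    simp only [height_node, toList, List.length_append, List.length_cons]
    set a := l.toList.length + 1
    set b := r.toList.length + 1
    have e : l.toList.length + (r.toList.length + 1) + 1 = a + b := by omega
    rw [e]
    have h5 : 2 ^ min l.height r.height ≤ a ^ 2 :=
      (Nat.pow_le_pow_right (by norm_num) (min_le_left _ _)).trans ihl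
    have h6 : 2 ^ min l.height r.height ≤ b ^ 2 :=
      (Nat.pow_le_pow_right (by norm_num) (min_le_right _ _)).trans ihr
    calc 2 ^ (max l.height r.height + 1) ≤ 2 ^ (min l.height r.height + 2) :=
          Nat.pow_le_pow_right (by norm_num) (by omega)
      _ = 4 * 2 ^ min l.height r.height := by ring
      _ ≤ (a + b) ^ 2 := by
        rcases le_total a b with h | h <;> nlinarith

theorem height_le_lg {t : AVL α} (h : t.Balanced) {n : ℕ} (hn : t.toList.length ≤ n) :
    (t.height : ℝ) ≤ 2 * lg n := by
  have h1 : ((2 : ℝ) ^ t.height) ≤ ((t.toList.length + 1 : ℕ) : ℝ) ^ 2 := by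
    exact_mod_cast two_pow_height_le h
  have h2 : Real.logb 2 ((2 : ℝ) ^ t.height) ≤ Real.logb 2 (((t.toList.length + 1 : ℕ) : ℝ) ^ 2) :=
    Real.logb_le_logb_of_le (by norm_num) (by positivity) h1
  rw [Real.logb_pow, Real.logb_pow, Real.logb_self_eq_one (by norm_num)] at h2
  have h3 : Real.logb 2 ((t.toList.length + 1 : ℕ) : ℝ) ≤ lg n := by
    have : (t.toList.length : ℝ) ≤ n := by exact_mod_cast hn
    refine Real.logb_le_logb_of_le (by norm_num) (by positivity) ?_
    push_cast
    linarith
  push_cast at *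
  linarith

/-- The only effect on the state is that at most `k` steps pass. -/
structure Waits (k : ℕ) (s s' : CF α) : Prop where
  cell : s'.cell = s.cell
  tree : s'.tree = s.tree
  clock : s'.clock ≤ s.clock + k

theorem Waits.succ {k m : ℕ} {s s' : CF α} (h : Waits k { s with clock := s.clock + 1 } s')
    (hm : k + 1 ≤ m) : Waits m s s' :=
  ⟨h.cell, h.tree, h.clock.trans (by simp only; omega)⟩

theorem runs_insert (i : Ivl α) (t : AVL α) : ∀ {s : CF α}, t.Balanced → t.Sorted →
    (∀ y ∈ t.toList, y.s ≠ i.s) →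
    Runs (t.insert i) s fun t' s' => t'.Balanced ∧ t'.Sorted ∧
      (∀ y, y ∈ t'.toList ↔ y = i ∨ y ∈ t.toList) ∧ t.height ≤ t'.height ∧
      t'.height ≤ t.height + 1 ∧ Waits (t.height + 1) s s' := by
  induction t with
  | nil =>
    intro s _ _ _
    simp only [insert, runs_bind, runs_tick, runs_pure]
    exact ⟨by simp [balanced_mk, Balanced], by simp [Sorted, toList], by simp [toList],
      by simp, by simp, rfl, rfl, le_rfl⟩
  | node h l x r ihl ihr =>
    intro s hb hs hi
    have hb' := hb
    obtain ⟨rfl, h1, h2, h3, h4⟩ := hb'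
    obtain ⟨hl, hr, hlx, hrx⟩ := sorted_node.1 hs
    simp only [toList, List.mem_append, List.mem_cons] at hi
    simp only [insert, runs_bind, runs_tick]
    rcases lt_trichotomy i.s x.s with hlt | heq | hgt
    · simp only [hlt, if_true, runs_bind]
      refine (ihl h3 hl fun y hy => hi y (.inl hy)).mono ?_
      rintro l' s' ⟨a1, a2, a3, a4, a5, a6⟩
      obtain ⟨b1, b2, b3, b4⟩ := balanced_balance x a1 h4 (by omega) (by omega)
      refine runs_pure.2 ⟨b1, sorted_of_toList (toList_balance _ _ _) a2 hr ?_ hrx, ?_, ?_, ?_,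
        a6.succ (by simp only [height_node]; omega)⟩
      · intro y hy
        rcases (a3 y).1 hy with rfl | hy
        exacts [hlt, hlx y hy]
      · intro y
        simp only [toList_balance, toList, List.mem_append, List.mem_cons, a3]
        tauto
      · simp only [height_node] at *; omega
      · simp only [height_node] at *; omega
    · exact absurd heq.symm (hi x (by simp))
    · simp only [hgt, hgt.not_gt, if_true, if_false, runs_bind]
      refine (ihr h4 hr fun y hy => hi y (by simp [hy])).mono ?_
      rintro r' s' ⟨a1, a2, a3, a4, a5, a6⟩
      obtain ⟨b1, b2, b3, b4⟩ := balanced_balance x h3 a1 (by omega) (by omega)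
      refine runs_pure.2 ⟨b1, sorted_of_toList (toList_balance _ _ _) hl a2 hlx ?_, ?_, ?_, ?_,
        a6.succ (by simp only [height_node]; omega)⟩
      · intro y hy
        rcases (a3 y).1 hy with rfl | hy
        exacts [hgt, hrx y hy]
      · intro y
        simp only [toList_balance, toList, List.mem_append, List.mem_cons, a3]
        tauto
      · simp only [height_node] at *; omega
      · simp only [height_node] at *; omega

theorem runs_extractMin (t : AVL α) : ∀ {s : CF α}, t.Balanced →
    Runs t.extractMin s fun o s' => Waits (t.height + 1) s s' ∧
      ((o = none ∧ t = nil) ∨ ∃ m t', o = some (m, t') ∧ t.toList = m :: t'.toList ∧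
        t'.Balanced ∧ t'.height ≤ t.height ∧ t.height ≤ t'.height + 1) := by
  induction t with
  | nil =>
    intro s _
    simp only [extractMin, runs_bind, runs_tick, runs_pure]
    exact ⟨⟨rfl, rfl, le_rfl⟩, by simp⟩
  | node h l x r ihl _ =>
    rintro s ⟨rfl, h1, h2, h3, h4⟩
    simp only [extractMin, runs_bind, runs_tick]
    refine (ihl h3).mono ?_
    rintro o s' ⟨a1, ⟨rfl, rfl⟩ | ⟨m, l', rfl, a2, a3, a4, a5⟩⟩
    · refine runs_pure.2 ⟨a1.succ (by simp only [height_nil, height_node]; omega), .inr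
        ⟨x, r, rfl, rfl, h4, ?_, ?_⟩⟩ <;> simp only [height_nil, height_node] at * <;> omega
    · obtain ⟨b1, b2, b3, b4⟩ := balanced_balance x a3 h4 (by omega) (by omega)
      refine runs_pure.2 ⟨a1.succ (by simp only [height_node]; omega), .inr
        ⟨m, _, rfl, by simp [toList, a2], b1, ?_, ?_⟩⟩ <;> simp only [height_node] at * <;> omega

theorem runs_remove (i : Ivl α) (t : AVL α) : ∀ {s : CF α}, t.Balanced → t.Sorted →
    i ∈ t.toList →
    Runs (t.remove i) s fun t' s' => t'.Balanced ∧ t'.Sorted ∧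
      (∀ y, y ∈ t'.toList ↔ y ≠ i ∧ y ∈ t.toList) ∧ t'.height ≤ t.height ∧
      t.height ≤ t'.height + 1 ∧ Waits (t.height + 1) s s' := by
  induction t with
  | nil => intro s _ _ h; simp [toList] at h
  | node h l x r ihl ihr =>
    intro s hb hs hi
    have hb' := hb
    obtain ⟨rfl, h1, h2, h3, h4⟩ := hb'
    obtain ⟨hl, hr, hlx, hrx⟩ := sorted_node.1 hs
    simp only [toList, List.mem_append, List.mem_cons] at hi
    simp only [remove, runs_bind, runs_tick]
    rcases lt_trichotomy i.s x.s with hlt | heq | hgt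
    · have hxi : x ≠ i := by rintro rfl; exact hlt.false
      have hri : ∀ y ∈ r.toList, y ≠ i := by
        rintro y hy rfl; exact (hrx y hy).not_gt hlt
      have hil : i ∈ l.toList := by grind
      simp only [hlt, if_true, runs_bind]
      refine (ihl h3 hl hil).mono ?_
      rintro l' s' ⟨a1, a2, a3, a4, a5, a6⟩
      obtain ⟨b1, b2, b3, b4⟩ := balanced_balance x a1 h4 (by omega) (by omega)
      refine runs_pure.2 ⟨b1, sorted_of_toList (toList_balance _ _ _) a2 hr ?_ hrx, ?_, ?_, ?_,
        a6.succ (by simp only [height_node]; omega)⟩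
      · exact fun y hy => hlx y ((a3 y).1 hy).2
      · intro y
        simp only [toList_balance, toList, List.mem_append, List.mem_cons, a3]
        grind
      · simp only [height_node] at *; omega
      · simp only [height_node] at *; omega
    · have hli : ∀ y ∈ l.toList, y ≠ i := by
        rintro y hy rfl; exact (hlx y hy).ne heq
      have hri : ∀ y ∈ r.toList, y ≠ i := by
        rintro y hy rfl; exact (hrx y hy).ne heq.symm
      obtain rfl : i = x := by grind
      simp only [lt_irrefl, if_false, runs_bind]
      refine (runs_extractMin r h4).mono ?_
      rintro o s' ⟨a1, ⟨rfl, rfl⟩ | ⟨m, r', rfl, a2, a3, a4, a5⟩⟩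
      · refine runs_pure.2 ⟨h3, hl, ?_, ?_, ?_, a1.succ (by simp only [height_nil, height_node]; omega)⟩
        · intro y
          simp only [toList, List.mem_append, List.mem_cons, List.not_mem_nil]
          grind
        · simp only [height_nil, height_node] at *; omega
        · simp only [height_nil, height_node] at *; omega
      · obtain ⟨b1, b2, b3, b4⟩ := balanced_balance m h3 a3 (by omega) (by omega)
        have hr' := hr
        rw [Sorted, a2, List.pairwise_cons] at hr'
        refine runs_pure.2 ⟨b1, sorted_of_toList (toList_balance _ _ _) hl hr'.2 ?_ hr'.1, ?_, ?_,
          ?_, a1.succ (by simp only [height_node]; omega)⟩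
        · exact fun y hy => (hlx y hy).trans (hrx m (by simp [a2]))
        · intro y
          simp only [toList_balance, toList, List.mem_append, List.mem_cons, a2] at hri ⊢
          grind
        · simp only [height_node] at *; omega
        · simp only [height_node] at *; omega
    · have hxi : x ≠ i := by rintro rfl; exact hgt.false
      have hli : ∀ y ∈ l.toList, y ≠ i := by
        rintro y hy rfl; exact (hlx y hy).not_gt hgt
      have hir : i ∈ r.toList := by grind
      simp only [hgt, hgt.not_gt, if_true, if_false, runs_bind]
      refine (ihr h4 hr hir).mono ?_
      rintro r' s' ⟨a1, a2, a3, a4, a5, a6⟩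
      obtain ⟨b1, b2, b3, b4⟩ := balanced_balance x h3 a1 (by omega) (by omega)
      refine runs_pure.2 ⟨b1, sorted_of_toList (toList_balance _ _ _) hl a2 hlx ?_, ?_, ?_, ?_,
        a6.succ (by simp only [height_node]; omega)⟩
      · exact fun y hy => hrx y ((a3 y).1 hy).2
      · intro y
        simp only [toList_balance, toList, List.mem_append, List.mem_cons, a3]
        grind
      · simp only [height_node] at *; omega
      · simp only [height_node] at *; omega

theorem runs_find (i : Ivl α) (t : AVL α) : ∀ {s : CF α}, t.Balanced → t.Sorted →
    i ∈ t.toList → Runs (t.find i) s fun o s' => o = some i ∧ Waits (t.height + 1) s s' := by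
  induction t with
  | nil => intro s _ _ h; simp [toList] at h
  | node h l x r ihl ihr =>
    rintro s ⟨rfl, h1, h2, h3, h4⟩ hs hi
    obtain ⟨hl, hr, hlx, hrx⟩ := sorted_node.1 hs
    simp only [toList, List.mem_append, List.mem_cons] at hi
    simp only [find, runs_bind, runs_tick]
    rcases hi with hi | rfl | hi
    · simp only [hlx i hi, if_true]
      exact (ihl h3 hl hi).mono fun o s' H => ⟨H.1, H.2.succ (by simp only [height_node]; omega)⟩
    · simp only [lt_irrefl, if_false]
      exact runs_pure.2 ⟨rfl, rfl, rfl, by simp only; omega⟩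
    · simp only [hrx i hi, (hrx i hi).not_gt, if_true, if_false]
      exact (ihr h4 hr hi).mono fun o s' H => ⟨H.1, H.2.succ (by simp only [height_node]; omega)⟩

theorem runs_minimum (t : AVL α) : ∀ {s : CF α} (a : Option (Ivl α)), t.Balanced →
    Runs (t.minimum a) s fun o s' => o = t.toList.head?.or a ∧ Waits (t.height + 1) s s' := by
  induction t with
  | nil =>
    intro s a _
    simp only [minimum, runs_bind, runs_tick, runs_pure]
    exact ⟨by simp [toList], rfl, rfl, le_rfl⟩
  | node h l x r ihl ihr =>
    rintro s a ⟨rfl, h1, h2, h3, h4⟩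
    simp only [minimum, runs_bind, runs_tick]
    refine (ihl _ h3).mono fun o s' H => ⟨?_, H.2.succ (by simp only [height_node]; omega)⟩
    rw [H.1, toList, List.head?_append]
    cases l.toList.head? <;> simp

/-- For a property that persists from left to right, the first element having it lies in the left
subtree or at the root if the root has it, and in the right subtree otherwise. The value `a` is the
candidate carried down the descent. -/
theorem find?_node {p : Ivl α → Prop} [DecidablePred p] {h : ℕ} {l r : AVL α} {x : Ivl α}
    (hp : (node h l x r).toList.Pairwise fun a b => p a → p b) (a : Option (Ivl α)) :
    l.toList.Pairwise (fun a b => p a → p b) ∧ r.toList.Pairwise (fun a b => p a → p b) ∧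
    (p x → ((node h l x r).toList.find? p).or a = (l.toList.find? p).or (some x)) ∧
    (¬ p x → ((node h l x r).toList.find? p).or a = (r.toList.find? p).or a) := by
  rw [toList, List.pairwise_append, List.pairwise_cons] at hp
  obtain ⟨h1, ⟨h2, h3⟩, h4⟩ := hp
  refine ⟨h1, h3, fun hx => ?_, fun hx => ?_⟩
  · rw [toList, List.find?_append, List.find?_cons]
    simp only [hx, decide_true]
    cases l.toList.find? p <;> simp
  · have : l.toList.find? p = none := by
      rw [List.find?_eq_none]
      intro y hy
      simpa using fun e => hx (h4 y hy x (by simp) e)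
    rw [toList, List.find?_append, List.find?_cons, this]
    simp [hx]

theorem runs_next (i : Ivl α) (t : AVL α) : ∀ {s : CF α} (a : Option (Ivl α)), t.Balanced →
    t.toList.Pairwise (fun a b => i.s < a.s → i.s < b.s) →
    Runs (t.next i a) s fun o s' => o = (t.toList.find? fun x => i.s < x.s).or a ∧
      Waits (t.height + 1) s s' := by
  induction t with
  | nil =>
    intro s a _ _
    simp only [next, runs_bind, runs_tick, runs_pure]
    exact ⟨by simp [toList], rfl, rfl, le_rfl⟩
  | node h l x r ihl ihr =>
    rintro s a ⟨rfl, h1, h2, h3, h4⟩ hp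
    obtain ⟨p1, p2, p3, p4⟩ := find?_node (p := fun x => i.s < x.s) hp a
    simp only [next, runs_bind, runs_tick]
    split_ifs with hx
    · rw [p3 hx]
      exact (ihl _ h3 p1).mono fun o s' H => ⟨H.1, H.2.succ (by simp only [height_node]; omega)⟩
    · rw [p4 hx]
      exact (ihr _ h4 p2).mono fun o s' H => ⟨H.1, H.2.succ (by simp only [height_node]; omega)⟩

theorem runs_rightCompatible (i : Ivl α) (t : AVL α) : ∀ {s : CF α} (a : Option (Ivl α)),
    t.Balanced → t.toList.Pairwise (fun a b => ¬ (a.f ≤ i.f ∨ ¬ Ivl.Compatible a i) →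
      ¬ (b.f ≤ i.f ∨ ¬ Ivl.Compatible b i)) →
    Runs (t.rightCompatible i a) s fun o s' =>
      o = (t.toList.find? fun j => ¬ (j.f ≤ i.f ∨ ¬ Ivl.Compatible j i)).or a ∧
      Waits (t.height + 1) s s' := by
  induction t with
  | nil =>
    intro s a _ _
    simp only [rightCompatible, runs_bind, runs_tick, runs_pure]
    exact ⟨by simp [toList], rfl, rfl, le_rfl⟩
  | node h l x r ihl ihr =>
    rintro s a ⟨rfl, h1, h2, h3, h4⟩ hp
    obtain ⟨p1, p2, p3, p4⟩ := find?_node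
      (p := fun j => ¬ (j.f ≤ i.f ∨ ¬ Ivl.Compatible j i)) hp a
    simp only [rightCompatible, runs_bind, runs_tick]
    split_ifs with hx
    · rw [p4 (not_not.2 hx)]
      exact (ihr _ h4 p2).mono fun o s' H => ⟨H.1, H.2.succ (by simp only [height_node]; omega)⟩
    · rw [p3 hx]
      exact (ihl _ h3 p1).mono fun o s' H => ⟨H.1, H.2.succ (by simp only [height_node]; omega)⟩

end AVL

/-! ### The compatibility forest and its heavy and light edges. -/

namespace Ivl

open Relation

variable {α : Type} [LinearOrder α] {I : Finset (Ivl α)} {i j k v : Ivl α}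

theorem Monotonic.s_lt_of_f_lt (hI : Monotonic I) (hi : i ∈ I) (hj : j ∈ I) (h : i.f < j.f) :
    i.s < j.s := by
  by_contra hs
  exact hI i hi j hj (by rintro rfl; exact h.false) ⟨not_lt.1 hs, h.le⟩

theorem Monotonic.f_lt_of_s_lt (hI : Monotonic I) (hi : i ∈ I) (hj : j ∈ I) (h : i.s < j.s) :
    i.f < j.f := by
  by_contra hs
  exact hI j hj i hi (by rintro rfl; exact h.false) ⟨h.le, not_lt.1 hs⟩

theorem Monotonic.eq_of_f_eq (hI : Monotonic I) (hi : i ∈ I) (hj : j ∈ I) (h : i.f = j.f) :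
    i = j := by
  by_contra hne
  rcases le_total j.s i.s with hs | hs
  · exact hI i hi j hj hne ⟨hs, h.le⟩
  · exact hI j hj i hi (Ne.symm hne) ⟨hs, h.ge⟩

theorem Monotonic.eq_of_s_eq (hI : Monotonic I) (hi : i ∈ I) (hj : j ∈ I) (h : i.s = j.s) :
    i = j := by
  by_contra hne
  rcases le_total i.f j.f with hs | hs
  · exact hI i hi j hj hne ⟨h.ge, hs⟩
  · exact hI j hj i hi (Ne.symm hne) ⟨h.le, hs⟩

theorem Monotonic.subset {J : Finset (Ivl α)} (hI : Monotonic I) (h : J ⊆ I) : Monotonic J :=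
  fun a ha b hb => hI a (h ha) b (h hb)

/-- In the order of starting times this condition is monotone in `j`, which makes a right compatible
interval accessible to binary search. -/
theorem lt_s_iff : (Compatible i j ∧ i.f < j.f) ↔ i.f < j.s := by
  constructor
  · rintro ⟨h | h, h'⟩
    · exact h
    · exact absurd (h.trans i.lt) h'.not_gt
  · exact fun h => ⟨.inl h, h.trans j.lt⟩

theorem isRightCompatible_iff :
    IsRightCompatible I i j ↔ (j ∈ I ∧ i.f < j.s) ∧ ∀ k ∈ I, i.f < k.s → j.f ≤ k.f := by
  simp only [IsRightCompatible, lt_s_iff]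
  refine and_congr_right fun _ => forall₂_congr fun k _ => ?_
  rw [← lt_s_iff (i := i) (j := k), and_imp]

theorem IsRightCompatible.mem (h : IsRightCompatible I i j) : j ∈ I := h.1.1

theorem IsRightCompatible.f_lt (h : IsRightCompatible I i j) : i.f < j.f := h.1.2.2

theorem IsRightCompatible.lt_s (h : IsRightCompatible I i j) : i.f < j.s :=
  (isRightCompatible_iff.1 h).1.2

theorem IsRightCompatible.unique (hI : Monotonic I) (h : IsRightCompatible I i j)
    (h' : IsRightCompatible I i k) : j = k := by
  rw [isRightCompatible_iff] at h h'
  exact hI.eq_of_f_eq h.1.1 h'.1.1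
    (le_antisymm (h.2 k h'.1.1 h'.1.2) (h'.2 j h.1.1 h.1.2))

theorem f_le_of_path (h : ReflTransGen (IsRightCompatible I) i j) : i.f ≤ j.f := by
  induction h with
  | refl => exact le_rfl
  | tail _ h ih => exact ih.trans h.f_lt.le

theorem mem_of_path (h : ReflTransGen (IsRightCompatible I) i j) (hi : i ∈ I) : j ∈ I := by
  cases h with
  | refl => exact hi
  | tail _ h => exact h.mem

theorem path_total (hI : Monotonic I) (hj : ReflTransGen (IsRightCompatible I) i j)
    (hk : ReflTransGen (IsRightCompatible I) i k) :
    ReflTransGen (IsRightCompatible I) j k ∨ ReflTransGen (IsRightCompatible I) k j :=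
  ReflTransGen.total_of_right_unique (fun _ _ _ h h' => h.unique hI h') hj hk

open Classical in
/-- The intervals of the subtree of `v` in the compatibility forest. -/
noncomputable def descendants (I : Finset (Ivl α)) (v : Ivl α) : Finset (Ivl α) :=
  I.filter fun j => ReflTransGen (IsRightCompatible I) j v

/-- The logarithmic size of a subtree of the compatibility forest. An edge of the forest is heavy
if its ends have the same level, and light otherwise. -/
noncomputable def level (I : Finset (Ivl α)) (v : Ivl α) : ℕ := Nat.log 2 (descendants I v).card

theorem mem_descendants : j ∈ descendants I v ↔ j ∈ I ∧ ReflTransGen (IsRightCompatible I) j v := by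
  simp [descendants]

theorem descendants_mono (h : IsRightCompatible I i j) : descendants I i ⊆ descendants I j := by
  intro k hk
  rw [mem_descendants] at hk ⊢
  exact ⟨hk.1, hk.2.tail h⟩

theorem level_mono (h : IsRightCompatible I i j) : level I i ≤ level I j :=
  Nat.log_mono_right (Finset.card_le_card (descendants_mono h))

theorem level_mono_path (h : ReflTransGen (IsRightCompatible I) i j) :
    level I i ≤ level I j := by
  induction h with
  | refl => exact le_rfl
  | tail _ h ih => exact ih.trans (level_mono h)

theorem level_le (I : Finset (Ivl α)) (v : Ivl α) : level I v ≤ Nat.log 2 I.card :=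
  by
  classical exact Nat.log_mono_right (Finset.card_le_card (Finset.filter_subset _ _))

/-- Distinct children of `v` have disjoint sets of descendants. Two heavy ones of level $\ell$ would
give `v` at least $2\cdot2^\ell$ descendants and hence a higher level. -/
theorem heavy_unique (hI : Monotonic I) (hi : i ∈ I) (hj : j ∈ I) (hiv : IsRightCompatible I i v)
    (hjv : IsRightCompatible I j v) (hli : level I i = level I v) (hlj : level I j = level I v) :
    i = j := by
  by_contra hne
  -- A path from one child to another would pass through their common parent `v`, although finishing
  -- times increase along paths.
  have key : ∀ a b, a ≠ b → IsRightCompatible I a v → IsRightCompatible I b v →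
      ¬ ReflTransGen (IsRightCompatible I) a b := by
    intro a b hab ha hb h
    rcases h.cases_head with h | ⟨c, hac, hcb⟩
    · exact hab h
    · rw [hac.unique hI ha] at hcb
      exact (f_le_of_path hcb).not_gt hb.f_lt
  have hd : Disjoint (descendants I i) (descendants I j) := by
    rw [Finset.disjoint_left]
    intro k hki hkj
    rw [mem_descendants] at hki hkj
    rcases path_total hI hki.2 hkj.2 with h | h
    · exact key i j hne hiv hjv h
    · exact key j i (Ne.symm hne) hjv hiv h
  have hc := Finset.card_le_card (Finset.union_subset (descendants_mono hiv) (descendants_mono hjv))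
  rw [Finset.card_union_of_disjoint hd] at hc
  have h0 : ∀ a ∈ I, (descendants I a).card ≠ 0 := fun a ha =>
    Finset.card_ne_zero_of_mem (mem_descendants.2 ⟨ha, .refl⟩)
  have h1 := Nat.pow_log_le_self 2 (h0 i hi)
  have h2 := Nat.pow_log_le_self 2 (h0 j hj)
  have h3 := Nat.lt_pow_succ_log_self (b := 2) (by norm_num) (descendants I v).card
  change 2 ^ level I i ≤ _ at h1
  change 2 ^ level I j ≤ _ at h2
  change _ < 2 ^ (level I v + 1) at h3
  rw [hli] at h1
  rw [hlj] at h2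
  rw [pow_succ] at h3
  omega

open Classical in
/-- The number of heavy edges of the compatibility forest that are not in `S`. -/
noncomputable def loose (I : Finset (Ivl α)) (S : Ivl α → Ivl α → Prop) : ℕ :=
  (I.filter fun v => ∃ h ∈ I, IsRightCompatible I h v ∧ level I h = level I v ∧ ¬ S h v).card

variable {S S' : Ivl α → Ivl α → Prop}

theorem loose_le_card (I : Finset (Ivl α)) (S : Ivl α → Ivl α → Prop) : loose I S ≤ I.card :=
  by classical exact Finset.card_filter_le _ _

theorem loose_anti (h : ∀ a ∈ I, ∀ b ∈ I, S a b → S' a b) : loose I S' ≤ loose I S := by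
  classical
  refine Finset.card_le_card fun v hv => ?_
  rw [Finset.mem_filter] at hv ⊢
  obtain ⟨hv, a, ha, h1, h2, h3⟩ := hv
  exact ⟨hv, a, ha, h1, h2, fun hs => h3 (h _ ha _ hv hs)⟩

theorem loose_le_add_one {c : Ivl α} (h : ∀ a b, S a b → b ≠ c → S' a b) :
    loose I S' ≤ loose I S + 1 := by
  classical
  refine le_trans (Finset.card_le_card (t := insert c (I.filter fun v => ∃ h ∈ I,
    IsRightCompatible I h v ∧ level I h = level I v ∧ ¬ S h v)) fun v hv => ?_)
    (Finset.card_insert_le _ _)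
  rw [Finset.mem_filter] at hv
  rw [Finset.mem_insert, Finset.mem_filter]
  obtain ⟨hv, a, ha, h1, h2, h3⟩ := hv
  by_cases hvc : v = c
  · exact .inl hvc
  · exact .inr ⟨hv, a, ha, h1, h2, fun hs => h3 (h _ _ hs hvc)⟩

/-- The edges that may be lost lead to `c`. Since the heavy edge to `c` is the one gained, any lost
edge is light and does not count. -/
theorem loose_add_one_le (hI : Monotonic I) {c : Ivl α} (hj : j ∈ I)
    (hjc : IsRightCompatible I j c) (hl : level I j = level I c) (hS : ¬ S j c) (hS' : S' j c)
    (h : ∀ a b, S a b → b ≠ c → S' a b) : loose I S' + 1 ≤ loose I S := by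
  classical
  refine Nat.succ_le_of_lt (Finset.card_lt_card ?_)
  rw [Finset.ssubset_iff_of_subset]
  · refine ⟨c, ?_, ?_⟩
    · rw [Finset.mem_filter]
      exact ⟨hjc.mem, j, hj, hjc, hl, hS⟩
    · rw [Finset.mem_filter]
      rintro ⟨-, a, ha, h1, h2, h3⟩
      exact h3 (heavy_unique hI ha hj h1 hjc h2 hl ▸ hS')
  · intro v hv
    rw [Finset.mem_filter] at hv ⊢
    obtain ⟨hv, a, ha, h1, h2, h3⟩ := hv
    refine ⟨hv, a, ha, h1, h2, fun hs => ?_⟩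
    by_cases hvc : v = c
    · subst hvc
      exact h3 (heavy_unique hI ha hj h1 hjc h2 hl ▸ hS')
    · exact h3 (h _ _ hs hvc)

/-! #### The effect of one additional interval -/

theorem IsRightCompatible.of_insert (h : IsRightCompatible (insert i I) j k) (hk : k ≠ i) :
    IsRightCompatible I j k := by
  rw [isRightCompatible_iff] at h ⊢
  exact ⟨⟨Finset.mem_of_mem_insert_of_ne h.1.1 hk, h.1.2⟩, fun l hl =>
    h.2 l (Finset.mem_insert_of_mem hl)⟩

theorem IsRightCompatible.insert_of_lt (h : IsRightCompatible I j k) (hji : j.f < i.s)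
    (hik : i.f ≤ k.f) : IsRightCompatible (insert i I) j i := by
  rw [isRightCompatible_iff] at h ⊢
  refine ⟨⟨Finset.mem_insert_self _ _, hji⟩, fun l hl hjl => ?_⟩
  rcases Finset.mem_insert.1 hl with rfl | hl
  · exact le_rfl
  · exact hik.trans (h.2 l hl hjl)

/-- A new interval can change the parent of `j` only by becoming that parent. -/
theorem IsRightCompatible.insert (h : IsRightCompatible I j k)
    (hi : ¬ IsRightCompatible (insert i I) j i) : IsRightCompatible (insert i I) j k := by
  have h' := isRightCompatible_iff.1 h
  refine isRightCompatible_iff.2 ⟨⟨Finset.mem_insert_of_mem h'.1.1, h'.1.2⟩, fun l hl hjl => ?_⟩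
  rcases Finset.mem_insert.1 hl with rfl | hl
  · by_contra hlt
    exact hi (h.insert_of_lt hjl (not_le.1 hlt).le)
  · exact h'.2 l hl hjl

theorem isRightCompatible_insert_iff (hj : i.f ≤ j.f) :
    IsRightCompatible (insert i I) j k ↔ IsRightCompatible I j k := by
  have hn : ¬ IsRightCompatible (insert i I) j i := fun h => hj.not_gt h.f_lt
  exact ⟨fun h => h.of_insert (by rintro rfl; exact hn h), fun h => h.insert hn⟩

/-- Nothing that finishes at or after `i` has `i` as its right compatible interval, so above `i` the
two forests agree. -/
theorem path_of_path_insert (hj : i.f ≤ j.f)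
    (h : ReflTransGen (IsRightCompatible (insert i I)) j k) :
    ReflTransGen (IsRightCompatible I) j k := by
  induction h with
  | refl => exact .refl
  | tail h1 h2 ih =>
    exact ih.tail ((isRightCompatible_insert_iff (hj.trans (f_le_of_path h1))).1 h2)

/-- If the parent of `j` changes, then the old parent is the successor of the new interval. -/
theorem IsRightCompatible.f_le_of_insert (h : IsRightCompatible I j k) {r : Ivl α} (hr : r ∈ I)
    (hr' : i.s < r.s) (hji : IsRightCompatible (Insert.insert i I) j i) : k.f ≤ r.f :=
  (isRightCompatible_iff.1 h).2 r hr ((hji.lt_s).trans hr')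

theorem IsRightCompatible.s_lt_of_insert (hI : Monotonic (Insert.insert i I)) (hi : i ∉ I)
    (h : IsRightCompatible I j k) (hji : IsRightCompatible (Insert.insert i I) j i) :
    i.s < k.s := by
  have h1 := (isRightCompatible_iff.1 hji).2 k (Finset.mem_insert_of_mem h.mem) h.lt_s
  refine hI.s_lt_of_f_lt (Finset.mem_insert_self _ _) (Finset.mem_insert_of_mem h.mem)
    (lt_of_le_of_ne h1 fun e => hi ?_)
  rw [hI.eq_of_f_eq (Finset.mem_insert_self _ _) (Finset.mem_insert_of_mem h.mem) e]
  exact h.mem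

open Classical in
/-- The ends of the light edges of the forest of `J` on the path from `x` in the forest of `I`. -/
noncomputable def lightEnds (I J : Finset (Ivl α)) (x : Ivl α) : Finset (Ivl α) :=
  J.filter fun v => ∃ p ∈ J, ReflTransGen (IsRightCompatible I) x p ∧ IsRightCompatible J p v ∧
    level J p < level J v

/-- Levels increase weakly along a path of the forest of `J` and strictly at a light edge. So the
ends of the light edges on one path have distinct levels among $0,\dots,\lfloor\log_2|J|\rfloor$. -/
theorem card_lightEnds_le {J : Finset (Ivl α)} {x : Ivl α} (hI : Monotonic I) (hJ : Monotonic J)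
    (h : ∀ p q, ReflTransGen (IsRightCompatible I) x p → ReflTransGen (IsRightCompatible I) p q →
      ReflTransGen (IsRightCompatible J) p q) :
    (lightEnds I J x).card ≤ Nat.log 2 J.card + 1 := by
  rw [← Finset.card_range (Nat.log 2 J.card + 1)]
  refine Finset.card_le_card_of_injOn (level J) (fun v _ => ?_) ?_
  · simpa using Nat.lt_succ_of_le (level_le J v)
  · have key : ∀ v w p q, ReflTransGen (IsRightCompatible J) p q → IsRightCompatible J p v →
        IsRightCompatible J q w → level J q < level J w → level J v = level J w → v = w := by
      intro v w p q hpq hpv hqw hl he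
      rcases hpq.cases_head with rfl | ⟨c, hpc, hcq⟩
      · exact hpv.unique hJ hqw
      · rw [hpc.unique hJ hpv] at hcq
        exact absurd (level_mono_path hcq) (by omega)
    intro v hv w hw he
    simp only [lightEnds, Finset.coe_filter, Set.mem_ofPred_eq] at hv hw
    obtain ⟨-, p, -, hxp, hpv, hlv⟩ := hv
    obtain ⟨-, q, -, hxq, hqw, hlw⟩ := hw
    rcases path_total hI hxp hxq with hpq | hpq
    · exact key v w p q (h p q hxp hpq) hpv hqw hlw he
    · exact (key w v q p (h q p hxq hpq) hqw hpv hlv he.symm).symm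

/-- A path to `v` is lost or gained only if it uses a redirected edge. In the new forest such a path
passes through `i`; in the old one it passes through `r`, the common old parent of all redirected
nodes. Neither leads to `v`. -/
theorem descendants_insert {r : Ivl α} (hv : v ≠ i)
    (hr : ∀ j k, IsRightCompatible (insert i I) j i → IsRightCompatible I j k → k = r)
    (h1 : ¬ ReflTransGen (IsRightCompatible (insert i I)) i v)
    (h2 : ¬ ReflTransGen (IsRightCompatible (insert i I)) r v) :
    descendants (insert i I) v = descendants I v := by
  ext j
  rw [mem_descendants, mem_descendants]
  constructor
  · rintro ⟨hj, h⟩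
    have hji : j ≠ i := by rintro rfl; exact h1 h
    refine ⟨Finset.mem_of_mem_insert_of_ne hj hji, ?_⟩
    induction h using ReflTransGen.head_induction_on with
    | refl => exact .refl
    | head h h' ih =>
      have hne := fun e => h1 (Eq.subst (motive := fun z => ReflTransGen _ z v) e h')
      exact (ih h.mem hne).head (h.of_insert hne)
  · rintro ⟨hj, h⟩
    refine ⟨Finset.mem_insert_of_mem hj, ?_⟩
    induction h using ReflTransGen.head_induction_on with
    | refl => exact .refl
    | head h h' ih =>
      refine (ih h.mem).head (h.insert fun hi => h2 ?_)
      rw [← hr _ _ hi h]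
      exact ih h.mem

/-- Outside a set `B` of at most $4(\lfloor\log_2(n+1)\rfloor+1)+3$ nodes, a node is the end of a
loose edge in one forest if and only if it is so in the other. This gives both inequalities, the
second of which serves removals. -/
theorem loose_insert (hI : Monotonic (insert i I)) (hi : i ∉ I) (S : Ivl α → Ivl α → Prop) :
    loose (insert i I) S ≤ loose I S + (4 * Nat.log 2 (I.card + 1) + 7) ∧
    loose I S ≤ loose (insert i I) S + (4 * Nat.log 2 (I.card + 1) + 7) := by
  classical
  have hI0 : Monotonic I := hI.subset (Finset.subset_insert _ _)
  obtain ⟨r, hrI, hir, hr⟩ : ∃ r ∈ insert i I, i.f ≤ r.f ∧ ∀ j k,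
      IsRightCompatible (insert i I) j i → IsRightCompatible I j k → k = r := by
    by_cases h : ∃ j k, IsRightCompatible (insert i I) j i ∧ IsRightCompatible I j k
    · obtain ⟨j, k, hji, hjk⟩ := h
      have hik := hjk.s_lt_of_insert hI hi hji
      refine ⟨k, Finset.mem_insert_of_mem hjk.mem, (hI.f_lt_of_s_lt (Finset.mem_insert_self _ _)
        (Finset.mem_insert_of_mem hjk.mem) hik).le, fun j' k' hji' hjk' => ?_⟩
      exact hI0.eq_of_f_eq hjk'.mem hjk.mem (le_antisymm (hjk'.f_le_of_insert hjk.mem hik hji')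
        (hjk.f_le_of_insert hjk'.mem (hjk'.s_lt_of_insert hI hi hji') hji))
    · push Not at h
      -- If no edge is redirected, any node that finishes no earlier than `i` will do for `r`.
      exact ⟨i, Finset.mem_insert_self _ _, le_rfl, fun j k h1 h2 => absurd h2 (h j k h1)⟩
  -- The exceptional nodes are `i`, `r`, the new parent of `i`, and the ends of light edges of
  -- either forest on the paths from `i` and from `r`.
  set B : Finset (Ivl α) := {i} ∪ ({r} ∪ ((insert i I).filter (IsRightCompatible (insert i I) i) ∪
    (lightEnds (insert i I) (insert i I) i ∪ (lightEnds (insert i I) I i ∪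
    (lightEnds (insert i I) (insert i I) r ∪ lightEnds (insert i I) I r))))) with hB
  have hBc : B.card ≤ 4 * Nat.log 2 (I.card + 1) + 7 := by
    have h1 : ((insert i I).filter (IsRightCompatible (insert i I) i)).card ≤ 1 :=
      Finset.card_le_one.2 fun a ha b hb =>
        (Finset.mem_filter.1 ha).2.unique hI (Finset.mem_filter.1 hb).2
    have h2 : ∀ x, (lightEnds (insert i I) (insert i I) x).card ≤ Nat.log 2 (I.card + 1) + 1 :=
      fun x => by
        have := card_lightEnds_le (x := x) hI hI fun p q _ h => h
        rwa [Finset.card_insert_of_notMem hi] at this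
    have h3 : ∀ x, i.f ≤ x.f → (lightEnds (insert i I) I x).card ≤ Nat.log 2 (I.card + 1) + 1 :=
      fun x hx => (card_lightEnds_le (x := x) hI hI0 fun p q h h' =>
        path_of_path_insert (hx.trans (f_le_of_path h)) h').trans
          (Nat.succ_le_succ (Nat.log_mono_right (Nat.le_succ _)))
    have h4 := h2 i
    have h5 := h2 r
    have h6 := h3 i le_rfl
    have h7 := h3 r hir
    have e1 : ({i} : Finset (Ivl α)).card = 1 := Finset.card_singleton _
    have e2 : ({r} : Finset (Ivl α)).card = 1 := Finset.card_singleton _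
    rw [hB]
    refine (Finset.card_union_le _ _).trans ?_
    refine (Nat.add_le_add_left (Finset.card_union_le _ _) _).trans ?_
    refine (Nat.add_le_add_left (Nat.add_le_add_left (Finset.card_union_le _ _) _) _).trans ?_
    refine (Nat.add_le_add_left (Nat.add_le_add_left (Nat.add_le_add_left
      (Finset.card_union_le _ _) _) _) _).trans ?_
    refine (Nat.add_le_add_left (Nat.add_le_add_left (Nat.add_le_add_left (Nat.add_le_add_left
      (Finset.card_union_le _ _) _) _) _) _).trans ?_
    refine (Nat.add_le_add_left (Nat.add_le_add_left (Nat.add_le_add_left (Nat.add_le_add_left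
      (Nat.add_le_add_left (Finset.card_union_le _ _) _) _) _) _) _).trans ?_
    omega
  have key : ∀ v ∈ insert i I, v ∉ B →
      ((v ∈ I ∧ ∃ h ∈ I, IsRightCompatible I h v ∧ level I h = level I v ∧ ¬ S h v) ↔
      ∃ h ∈ insert i I, IsRightCompatible (insert i I) h v ∧
        level (insert i I) h = level (insert i I) v ∧ ¬ S h v) := by
    intro v hv hvB
    simp only [hB, Finset.mem_union, not_or, Finset.mem_singleton] at hvB
    obtain ⟨b1, b2, b3, b4, b5, b6, b7⟩ := hvB
    have hvI : v ∈ I := Finset.mem_of_mem_insert_of_ne hv b1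
    -- If `v` lies on such a path, its predecessor `p` there is its child in both forests. Neither
    -- edge is light, so `p` is the unique heavy child both times, and looseness depends only on
    -- whether `S p v` holds.
    have on_path : ∀ x ∈ insert i I, i.f ≤ x.f → v ≠ x →
        v ∉ lightEnds (insert i I) (insert i I) x → v ∉ lightEnds (insert i I) I x →
        ReflTransGen (IsRightCompatible (insert i I)) x v →
        ((v ∈ I ∧ ∃ h ∈ I, IsRightCompatible I h v ∧ level I h = level I v ∧ ¬ S h v) ↔
        ∃ h ∈ insert i I, IsRightCompatible (insert i I) h v ∧
          level (insert i I) h = level (insert i I) v ∧ ¬ S h v) := by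
      intro x hxI hix hvx c1 c2 hxv
      rcases hxv.cases_tail with h | ⟨p, hxp, hpv⟩
      · exact absurd h hvx
      have hp' := mem_of_path hxp hxI
      have hpi : p ≠ i := by
        rintro rfl
        exact b3 (Finset.mem_filter.2 ⟨hv, hpv⟩)
      have hp := Finset.mem_of_mem_insert_of_ne hp' hpi
      have hpv' := hpv.of_insert b1
      have l1 : level (insert i I) p = level (insert i I) v :=
        le_antisymm (level_mono hpv) (not_lt.1 fun h =>
          c1 (Finset.mem_filter.2 ⟨hv, p, hp', hxp, hpv, h⟩))
      have l2 : level I p = level I v :=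
        le_antisymm (level_mono hpv') (not_lt.1 fun h =>
          c2 (Finset.mem_filter.2 ⟨hvI, p, hp, hxp, hpv', h⟩))
      constructor
      · rintro ⟨-, h, hh, h1, h2, h3⟩
        rw [heavy_unique hI0 hh hp h1 hpv' h2 l2] at h3
        exact ⟨p, hp', hpv, l1, h3⟩
      · rintro ⟨h, hh, h1, h2, h3⟩
        rw [heavy_unique hI hh hp' h1 hpv h2 l1] at h3
        exact ⟨hvI, p, hp, hpv', l2, h3⟩
    by_cases hiv : ReflTransGen (IsRightCompatible (insert i I)) i v
    · exact on_path i (Finset.mem_insert_self _ _) le_rfl b1 b4 b5 hiv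
    by_cases hrv : ReflTransGen (IsRightCompatible (insert i I)) r v
    · exact on_path r hrI hir b2 b6 b7 hrv
    -- Away from both paths, the descendants of `v` and of its children are the same in both
    -- forests, hence so are their levels.
    have hlv : level (insert i I) v = level I v := by
      rw [level, level, descendants_insert b1 hr hiv hrv]
    have hlev : ∀ h, IsRightCompatible (insert i I) h v → h ≠ i →
        level (insert i I) h = level I h := fun h hhv hhi => by
      rw [level, level, descendants_insert hhi hr (fun e => hiv (e.tail hhv))
        (fun e => hrv (e.tail hhv))]
    constructor
    · rintro ⟨-, h, hh, h1, h2, h3⟩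
      have h1' : IsRightCompatible (insert i I) h v := h1.insert fun e => b2 (hr _ _ e h1)
      exact ⟨h, Finset.mem_insert_of_mem hh, h1',
        by rw [hlev h h1' (by rintro rfl; exact hi hh), h2, hlv], h3⟩
    · rintro ⟨h, hh, h1, h2, h3⟩
      have hhi : h ≠ i := by
        rintro rfl
        exact hiv (.single h1)
      exact ⟨hvI, h, Finset.mem_of_mem_insert_of_ne hh hhi, h1.of_insert b1,
        by rw [← hlev h h1 hhi, h2, hlv], h3⟩
  have fin : ∀ X Y : Finset (Ivl α), X ⊆ Y ∪ B →
      X.card ≤ Y.card + (4 * Nat.log 2 (I.card + 1) + 7) := fun X Y h =>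
    (Finset.card_le_card h).trans ((Finset.card_union_le _ _).trans (Nat.add_le_add_left hBc _))
  constructor
  · refine fin _ _ fun v hv => ?_
    rw [Finset.mem_filter] at hv
    rw [Finset.mem_union, Finset.mem_filter]
    by_cases hvB : v ∈ B
    · exact .inr hvB
    · exact .inl ((key v hv.1 hvB).2 hv.2)
  · refine fin _ _ fun v hv => ?_
    rw [Finset.mem_filter] at hv
    rw [Finset.mem_union, Finset.mem_filter]
    by_cases hvB : v ∈ B
    · exact .inr hvB
    · exact .inl ⟨Finset.mem_insert_of_mem hv.1,
        (key v (Finset.mem_insert_of_mem hv.1) hvB).1 hv⟩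

end Ivl

/-! ### Solid edges as neighbours in the stored paths. -/

section Adjacent

variable {β : Type}

/-- `b` follows `a` immediately in the list. -/
def Adj (l : List β) (a b : β) : Prop := ∃ A B, l = A ++ a :: b :: B

theorem adj_append {A B : List β} {a b : β} :
    Adj (A ++ B) a b ↔ Adj A a b ∨ Adj B a b ∨ (A.getLast? = some a ∧ B.head? = some b) := by
  constructor
  · rintro ⟨C, D, h⟩
    rcases List.append_eq_append_iff.1 h with ⟨E, rfl, rfl⟩ | ⟨E, rfl, h'⟩
    · exact .inr (.inl ⟨E, D, rfl⟩)
    · rcases E with _ | ⟨x, _ | ⟨y, E⟩⟩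
      · exact .inr (.inl ⟨[], D, by simpa using Eq.symm h'⟩)
      · simp only [List.cons_append, List.nil_append, List.cons.injEq] at h'
        obtain ⟨rfl, rfl⟩ := h'
        exact .inr (.inr (by simp))
      · simp only [List.cons_append, List.cons.injEq] at h'
        obtain ⟨rfl, rfl, rfl⟩ := h'
        exact .inl ⟨C, E, rfl⟩
  · rintro (⟨C, D, rfl⟩ | ⟨C, D, rfl⟩ | ⟨h1, h2⟩)
    · exact ⟨C, D ++ B, by simp⟩
    · exact ⟨A ++ C, D, by simp⟩
    · obtain ⟨C, rfl⟩ := List.getLast?_eq_some_iff.1 h1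
      obtain ⟨D, rfl⟩ := List.head?_eq_some_iff.1 h2
      exact ⟨C, D, by simp⟩

theorem not_adj_singleton {x a b : β} : ¬ Adj [x] a b := by
  rintro ⟨A, B, h⟩
  have := congrArg List.length h
  simp at this
  omega

theorem Adj.left_mem {l : List β} {a b : β} (h : Adj l a b) : a ∈ l := by
  obtain ⟨A, B, rfl⟩ := h
  simp

theorem Adj.right_mem {l : List β} {a b : β} (h : Adj l a b) : b ∈ l := by
  obtain ⟨A, B, rfl⟩ := h
  simp

theorem isChain_iff_adj {R : β → β → Prop} {l : List β} :
    l.IsChain R ↔ ∀ a b, Adj l a b → R a b := by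
  rw [List.isChain_iff_forall_rel_of_append_cons_cons]
  exact ⟨fun h a b ⟨A, B, e⟩ => h e, fun h a b A B e => h a b ⟨A, B, e⟩⟩

theorem not_adj_head {B : List β} {a u : β} (hn : (u :: B).Nodup) : ¬ Adj (u :: B) a u := by
  rintro ⟨C, D, h⟩
  rw [List.nodup_cons] at hn
  rcases C with _ | ⟨c, C⟩
  · simp only [List.nil_append, List.cons.injEq] at h
    exact hn.1 (by simp [h.2])
  · simp only [List.cons_append, List.cons.injEq] at h
    exact hn.1 (by simp [h.2])

/-- In a list without repetitions, the element `u` has no other predecessor than the last element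
of the part before it. -/
theorem Adj.getLast?_eq {A B : List β} {a u : β} (hn : (A ++ u :: B).Nodup)
    (h : Adj (A ++ u :: B) a u) : A.getLast? = some a := by
  rw [List.nodup_append] at hn
  rcases adj_append.1 h with h | h | ⟨h, -⟩
  · exact absurd rfl (hn.2.2 u h.right_mem u (by simp))
  · exact absurd h (not_adj_head hn.2.1)
  · exact h

/-- Splitting a path before `u` destroys the edge that leads to `u` and no other. -/
theorem adj_split {A B : List β} {a b u : β} (hn : (A ++ u :: B).Nodup) :
    (Adj A a b ∨ Adj (u :: B) a b) ↔ Adj (A ++ u :: B) a b ∧ b ≠ u := by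
  rw [List.nodup_append] at hn
  rw [adj_append]
  constructor
  · rintro (h | h)
    · exact ⟨.inl h, hn.2.2 b h.right_mem u (by simp)⟩
    · exact ⟨.inr (.inl h), by rintro rfl; exact not_adj_head hn.2.1 h⟩
  · rintro ⟨h | h | ⟨-, h⟩, hb⟩
    · exact .inl h
    · exact .inr h
    · exact absurd (by simpa using h.symm) hb

theorem path_of_isChain {R : β → β → Prop} {l : List β} : ∀ {x y : β}, (x :: l).IsChain R →
    y ∈ x :: l → Relation.ReflTransGen R x y := by
  induction l with
  | nil =>
    intro x y _ h
    rw [List.mem_singleton.1 h]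
  | cons z l ih =>
    intro x y hc h
    rw [List.isChain_cons_cons] at hc
    rcases List.mem_cons.1 h with rfl | h
    · exact .refl
    · exact (ih hc.2 h).head hc.1

end Adjacent

section Solid

open STree

variable {α : Type} [LinearOrder α] {F G : List (STree α)} {t : STree α} {a b : Ivl α}

/-- The edges of the paths stored in the splay trees. -/
def Solid (F : List (STree α)) (a b : Ivl α) : Prop := ∃ l ∈ F.map inorder, Adj l a b

theorem solid_cons : Solid (t :: F) a b ↔ Adj t.inorder a b ∨ Solid F a b := by
  simp [Solid]

theorem solid_perm (h : F.Perm G) : Solid F a b ↔ Solid G a b := by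
  simp only [Solid, (h.map inorder).mem_iff]

theorem Solid.mem (h : Solid F a b) : a ∈ keys F ∧ b ∈ keys F := by
  obtain ⟨l, hl, h⟩ := h
  obtain ⟨t, ht, rfl⟩ := List.mem_map.1 hl
  exact ⟨mem_keys.2 ⟨t, ht, h.left_mem⟩, mem_keys.2 ⟨t, ht, h.right_mem⟩⟩

theorem exists_perm_of_mem_keys {x : Ivl α} (h : x ∈ keys F) :
    ∃ t G, F.Perm (t :: G) ∧ x ∈ t.inorder := by
  obtain ⟨t, ht, hx⟩ := mem_keys.1 h
  obtain ⟨A, B, rfl⟩ := List.append_of_mem ht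
  exact ⟨t, A ++ B, List.perm_middle, hx⟩

theorem not_mem_keys_of_mem {n : ℕ} {s : CF α} (h : Stores n (t :: F) s) {x : Ivl α}
    (hx : x ∈ t.inorder) : x ∉ keys F := by
  have hn := h.nodup
  rw [keys_cons, List.nodup_append] at hn
  exact fun hx' => hn.2.2 x hx x hx' rfl

end Solid

/-! ### Searches in the tree of all intervals -/

section Search

variable {α : Type} [LinearOrder α] {I : Finset (Ivl α)} {i j m : Ivl α} {s : CF α} {T : AVL α}

/-- `T` is a balanced search tree for the set `I`. -/
structure SearchTree (T : AVL α) (I : Finset (Ivl α)) : Prop where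
  balanced : T.Balanced
  sorted : T.Sorted
  mem : ∀ i, i ∈ T.toList ↔ i ∈ I

theorem SearchTree.length_eq (h : SearchTree T I) : T.toList.length = I.card := by
  have hn : T.toList.Nodup := List.Pairwise.imp (fun {a b} h e => by rw [e] at h; exact h.false) h.sorted
  rw [← List.toFinset_card_of_nodup hn]
  congr 1
  ext i
  rw [List.mem_toFinset, h.mem]

theorem SearchTree.height_le (h : SearchTree T I) :
    ((T.height + 1 : ℕ) : ℝ) ≤ 3 * lg I.card := by
  have := AVL.height_le_lg h.balanced h.length_eq.le
  have := one_le_lg I.card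
  push_cast
  linarith

theorem energy_of_waits {F : List (STree α)} {s s' : CF α} {k : ℕ} {c : ℝ}
    (h : AVL.Waits k s s') (hk : (k : ℝ) ≤ c) : energy F s' ≤ energy F s + c :=
  (energy_of_clock h.clock).trans (by linarith)

theorem find?_sorted_eq_some {l : List (Ivl α)} (hl : l.Pairwise fun a b => a.s < b.s)
    {p : Ivl α → Prop} [DecidablePred p] {r : Ivl α} :
    l.find? p = some r ↔ r ∈ l ∧ p r ∧ ∀ k ∈ l, p k → r.s ≤ k.s := by
  induction l with
  | nil => simp
  | cons x l ih =>
    rw [List.pairwise_cons] at hl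
    rw [List.find?_cons]
    by_cases hx : p x
    · simp only [hx, decide_true, Option.some.injEq, List.mem_cons]
      constructor
      · rintro rfl
        refine ⟨.inl rfl, hx, ?_⟩
        rintro k (rfl | hk) _
        exacts [le_rfl, (hl.1 k hk).le]
      · rintro ⟨rfl | h1, h2, h3⟩
        · rfl
        · exact absurd (hl.1 r h1) (h3 x (.inl rfl) hx).not_gt
    · simp only [hx, decide_false, ih hl.2, List.mem_cons]
      constructor
      · rintro ⟨h1, h2, h3⟩
        refine ⟨.inr h1, h2, ?_⟩
        rintro k (rfl | hk) hpk
        exacts [absurd hpk hx, h3 k hk hpk]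
      · rintro ⟨rfl | h1, h2, h3⟩
        · exact absurd h2 hx
        · exact ⟨h1, h2, fun k hk => h3 k (.inr hk)⟩

theorem runs_MonCF_minimum (hI : Ivl.Monotonic I) (h : SearchTree s.tree I) :
    Runs MonCF.minimum s fun o s' => (∀ m, o = some m ↔ Ivl.IsLeastIn I m) ∧
      AVL.Waits (s.tree.height + 1) s s' := by
  simp only [MonCF.minimum, runs_bind, runs_get]
  refine (AVL.runs_minimum s.tree none h.balanced).mono ?_
  rintro o s' ⟨rfl, hw⟩
  refine ⟨fun m => ?_, hw⟩
  have hd : s.tree.toList.head? = s.tree.toList.find? fun _ => (True : Prop) := by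
    cases s.tree.toList <;> simp
  rw [Option.or_none, hd, find?_sorted_eq_some h.sorted, h.mem]
  simp only [true_implies, h.mem, true_and, Ivl.IsLeastIn]
  refine and_congr_right fun hm => forall₂_congr fun k hk => ?_
  rw [← not_lt, ← not_lt]
  exact not_congr ⟨hI.f_lt_of_s_lt hk hm, hI.s_lt_of_f_lt hk hm⟩

theorem not_or_not_compatible_iff {k : Ivl α} :
    ¬ (k.f ≤ i.f ∨ ¬ Ivl.Compatible k i) ↔ i.f < k.s := by
  rw [← Ivl.lt_s_iff, not_or, not_le, not_not, and_comm]
  refine and_congr_left fun _ => ?_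
  simp only [Ivl.Compatible, or_comm]

/-- The test made during the descent amounts to $f(i)<s(k)$, which persists along increasing
starting times. The first interval that passes is also the least by finishing time, by monotonicity.
-/
theorem runs_MonCF_rightCompatible (hI : Ivl.Monotonic I) (h : SearchTree s.tree I) (i : Ivl α) :
    Runs (MonCF.rightCompatible i) s fun o s' =>
      (∀ k, o = some k ↔ Ivl.IsRightCompatible I i k) ∧ AVL.Waits (s.tree.height + 1) s s' := by
  simp only [MonCF.rightCompatible, runs_bind, runs_get]
  refine (AVL.runs_rightCompatible i s.tree none h.balanced ?_).mono ?_
  · simp only [not_or_not_compatible_iff]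
    exact h.sorted.imp fun hab ha => ha.trans hab
  rintro o s' ⟨rfl, hw⟩
  refine ⟨fun k => ?_, hw⟩
  rw [Option.or_none, find?_sorted_eq_some h.sorted, h.mem, Ivl.isRightCompatible_iff, and_assoc]
  simp only [not_or_not_compatible_iff, h.mem]
  refine and_congr_right fun hm => and_congr_right fun _ => forall₂_congr fun l hl =>
    imp_congr_right fun _ => ?_
  rw [← not_lt, ← not_lt]
  exact not_congr ⟨hI.f_lt_of_s_lt hl hm, hI.s_lt_of_f_lt hl hm⟩

theorem runs_next_of_searchTree (h : SearchTree s.tree I) (i : Ivl α) :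
    Runs (s.tree.next i none) s fun o s' =>
      (∀ r, o = some r ↔ r ∈ I ∧ i.s < r.s ∧ ∀ k ∈ I, i.s < k.s → r.s ≤ k.s) ∧
      (o = none → ∀ k ∈ I, ¬ i.s < k.s) ∧ AVL.Waits (s.tree.height + 1) s s' := by
  refine (AVL.runs_next i s.tree none h.balanced
    (h.sorted.imp fun hab ha => ha.trans hab)).mono ?_
  rintro o s' ⟨rfl, hw⟩
  refine ⟨fun k => ?_, fun ho k hk => ?_, hw⟩
  · rw [Option.or_none, find?_sorted_eq_some h.sorted, h.mem]
    simp only [h.mem]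
  · rw [Option.or_none, List.find?_eq_none] at ho
    simpa using ho k ((h.mem k).2 hk)

theorem runs_treeInsert (hi : i ∉ I) (hI : Ivl.Monotonic (insert i I))
    (h : SearchTree s.tree I) :
    Runs (MonCF.treeInsert i) s fun _ s' => SearchTree s'.tree (insert i I) ∧
      s'.cell = s.cell ∧ s'.clock ≤ s.clock + (s.tree.height + 1) := by
  simp only [MonCF.treeInsert, runs_bind, runs_get]
  refine (AVL.runs_insert i s.tree h.balanced h.sorted fun y hy e => hi ?_).mono ?_
  · rw [h.mem] at hy
    rwa [← hI.eq_of_s_eq (Finset.mem_insert_of_mem hy) (Finset.mem_insert_self _ _) e]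
  · rintro t' s' ⟨h1, h2, h3, -, -, h4⟩
    exact runs_modify.2 ⟨⟨h1, h2, fun k => by rw [h3, Finset.mem_insert, h.mem]⟩, h4.cell, h4.clock⟩

theorem runs_treeRemove (hi : i ∈ I) (h : SearchTree s.tree I) :
    Runs (MonCF.treeRemove i) s fun _ s' => SearchTree s'.tree (I.erase i) ∧
      s'.cell = s.cell ∧ s'.clock ≤ s.clock + (s.tree.height + 1) := by
  simp only [MonCF.treeRemove, runs_bind, runs_get]
  refine (AVL.runs_remove i s.tree h.balanced h.sorted ((h.mem i).2 hi)).mono ?_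
  rintro t' s' ⟨h1, h2, h3, -, -, h4⟩
  exact runs_modify.2 ⟨⟨h1, h2, fun k => by rw [h3, Finset.mem_erase, h.mem]⟩, h4.cell, h4.clock⟩

end Search

theorem log_le_lg (n : ℕ) : (Nat.log 2 n : ℝ) ≤ lg n := by
  rcases Nat.eq_zero_or_pos n with rfl | h
  · simpa using zero_le_one.trans (one_le_lg 0)
  · refine le_trans ?_ (logb_le_lg h le_rfl)
    rw [Real.le_logb_iff_rpow_le (by norm_num) (by exact_mod_cast h), Real.rpow_natCast]
    exact_mod_cast Nat.pow_log_le_self 2 h.ne'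

/-! ### The invariant and the algorithm `expose` -/

section Expose

open STree

variable {α : Type} [LinearOrder α] {I : Finset (Ivl α)} {F : List (STree α)} {s : CF α}

/-- The search tree stores `I`, and the splay trees store a partition of `I` into paths of the
compatibility forest. -/
structure Partitions (I : Finset (Ivl α)) (F : List (STree α)) (s : CF α) : Prop where
  search : SearchTree s.tree I
  stores : Stores I.card F s
  keys : ∀ x, x ∈ keys F ↔ x ∈ I
  solid : ∀ a b, Solid F a b → Ivl.IsRightCompatible I a b

/-- The clock together with the potential of the data structure. -/
noncomputable def total (I : Finset (Ivl α)) (F : List (STree α)) (s : CF α) : ℝ :=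
  energy F s + 320 * lg I.card * Ivl.loose I (Solid F)

theorem Partitions.perm {G : List (STree α)} (h : Partitions I F s) (hp : F.Perm G) :
    Partitions I G s where
  search := h.search
  stores := h.stores.perm hp
  keys x := by rw [← h.keys, (keys_perm hp).mem_iff]
  solid a b hab := h.solid a b ((solid_perm hp).2 hab)

theorem Partitions.isChain {t : STree α} (h : Partitions I (t :: F) s) :
    t.inorder.IsChain (Ivl.IsRightCompatible I) :=
  isChain_iff_adj.2 fun a b hab => h.solid a b (solid_cons.2 (.inl hab))

theorem pairwise_f_of_isChain {l : List (Ivl α)} (h : l.IsChain (Ivl.IsRightCompatible I)) :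
    l.Pairwise fun a b => a.f < b.f := by
  have : Trans (fun a b : Ivl α => a.f < b.f) (fun a b : Ivl α => a.f < b.f)
      (fun a b : Ivl α => a.f < b.f) := ⟨fun h h' => lt_trans h h'⟩
  exact List.isChain_iff_pairwise.1 (h.imp fun a b h => h.f_lt)

/-- The list is a path of the compatibility forest that ends at a root. -/
def Complete (I : Finset (Ivl α)) (l : List (Ivl α)) : Prop :=
  ∀ j, l.getLast? = some j → ∀ k, ¬ Ivl.IsRightCompatible I j k

theorem f_le_getLast {t : STree α} {j x : Ivl α} (h : Partitions I (t :: F) s)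
    (hj : t.inorder.getLast? = some j) (hx : x ∈ t.inorder) : x.f ≤ j.f := by
  obtain ⟨A, hA⟩ := List.getLast?_eq_some_iff.1 hj
  have hp := pairwise_f_of_isChain h.isChain
  rw [hA, List.pairwise_append] at hp
  rw [hA, List.mem_append, List.mem_singleton] at hx
  rcases hx with hx | rfl
  · exact (hp.2.2 x hx j (by simp)).le
  · exact le_rfl

/-- One solid edge is added to the path, at a cost that is paid for by the number of loose heavy
edges and by the level of the end of the path. -/
theorem runs_extend (hI : Ivl.Monotonic I) {i j u : Ivl α} {t : STree α}
    (h : Partitions I (t :: F) s) (hi : i ∈ t.inorder) (hj : t.inorder.getLast? = some j)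
    (hju : Ivl.IsRightCompatible I j u) :
    Runs (Splay.split u) s fun _ s1 => Runs (Splay.join i u) s1 fun _ s2 =>
      Runs (Splay.maximum u) s2 fun j' s' => ∃ t' F', Partitions I (t' :: F') s' ∧
        t.inorder <+: t'.inorder ∧ t'.inorder.getLast? = some j' ∧
        Relation.ReflTransGen (Ivl.IsRightCompatible I) u j' ∧
        total I (t' :: F') s' + 640 * lg I.card * (Ivl.level I j - Ivl.level I j') ≤
          total I (t :: F) s - 9 * lg I.card := by
  have hlg := one_le_lg I.card
  have hj' : j ∈ t.inorder := List.mem_of_getLast? hj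
  have hjI : j ∈ I := (h.keys j).1 (by simp [hj'])
  have hut : u ∉ t.inorder := fun hu => (f_le_getLast h hj hu).not_gt hju.f_lt
  have huF : u ∈ keys F := by
    have := (h.keys u).2 hju.mem
    rw [keys_cons, List.mem_append] at this
    -- `j` finishes last in its path and `u` finishes later, so `u` is in another splay tree.
    exact this.resolve_left hut
  obtain ⟨t2, F2, hp, hu2⟩ := exists_perm_of_mem_keys huF
  have hp' : (t :: F).Perm (t2 :: t :: F2) := (hp.cons t).trans (List.Perm.swap _ _ _)
  refine ((h.stores.perm hp').split hu2).mono ?_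
  rintro _ s2 ⟨l2, r2, a1, a2, a3, a4⟩
  have hp2 : (l2 :: node nil u r2 :: t :: F2).Perm (t :: node nil u r2 :: l2 :: F2) :=
    (List.Perm.swap _ _ _).trans (((List.Perm.swap _ _ _).cons _).trans (List.Perm.swap _ _ _))
  refine ((a1.perm hp2).join hi (b := u) (by simp [inorder])).mono ?_
  rintro _ s3 ⟨t3, b1, b2, b3, b4⟩
  refine (b1.maximum (x := u) (by rw [b2]; simp [inorder])).mono ?_
  rintro j' s4 ⟨l4, c1, c2, c3, c4⟩
  have hj4 : (node l4 j' nil).inorder.getLast? = some j' := by simp [inorder]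
  generalize node l4 j' nil = t4 at c1 c2 c4 hj4
  have e4 : t4.inorder = t.inorder ++ u :: r2.inorder := by rw [c2, b2]; rfl
  have hold : ∀ a b, Solid (t :: F) a b ↔ Adj t.inorder a b ∨
      Adj (l2.inorder ++ u :: r2.inorder) a b ∨ Solid F2 a b := by
    intro a b
    rw [solid_perm hp', solid_cons, solid_cons, a2]
    exact or_left_comm
  have hnew : ∀ a b, Solid (t4 :: l2 :: F2) a b ↔ (Adj t.inorder a b ∨
      Adj (u :: r2.inorder) a b ∨ (j = a ∧ u = b)) ∨ Adj l2.inorder a b ∨ Solid F2 a b := by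
    intro a b
    rw [solid_cons, solid_cons, e4, adj_append, hj, List.head?_cons, Option.some.injEq,
      Option.some.injEq]
  have hpart : Partitions I (t4 :: l2 :: F2) s4 := by
    refine ⟨?_, c1, fun x => ?_, fun a b hab => ?_⟩
    · rw [c3, b3, a3]
      exact h.search
    · rw [← h.keys, (keys_perm hp').mem_iff]
      simp only [keys_cons, e4, a2, List.mem_append, List.mem_cons]
      tauto
    · rcases (hnew a b).1 hab with (hab | hab | ⟨rfl, rfl⟩) | hab | hab
      · exact h.solid a b ((hold a b).2 (.inl hab))
      · exact h.solid a b ((hold a b).2 (.inr (.inl (adj_append.2 (.inr (.inl hab))))))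
      · exact hju
      · exact h.solid a b ((hold a b).2 (.inr (.inl (adj_append.2 (.inl hab)))))
      · exact h.solid a b ((hold a b).2 (.inr (.inr hab)))
  have hkeep : ∀ a b, Solid (t :: F) a b → b ≠ u → Solid (t4 :: l2 :: F2) a b := by
    intro a b hab hbu
    rw [hnew]
    rcases (hold a b).1 hab with hab | hab | hab
    · exact .inl (.inl hab)
    · rcases adj_append.1 hab with hab | hab | ⟨-, hab⟩
      · exact .inr (.inl hab)
      · exact .inl (.inr (.inl hab))
      · exact absurd (by simpa using hab.symm) hbu
    · exact .inr (.inr hab)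
  have hnot : ¬ Solid (t :: F) j u := by
    intro hs
    rcases solid_cons.1 hs with hs | hs
    · exact hut hs.right_mem
    · exact not_mem_keys_of_mem h.stores hj' hs.mem.1
  have hyes : Solid (t4 :: l2 :: F2) j u := (hnew j u).2 (.inl (.inr (.inr ⟨rfl, rfl⟩)))
  have hpath : Relation.ReflTransGen (Ivl.IsRightCompatible I) u j' := by
    have hchain := hpart.isChain
    rw [e4] at hchain hj4
    refine path_of_isChain (List.isChain_append.1 hchain).2.1 (List.mem_of_getLast? ?_)
    rwa [List.getLast?_append, List.getLast?_cons, Option.some_or, ← List.getLast?_cons] at hj4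
  have hlu := Ivl.level_mono_path hpath
  refine ⟨t4, l2 :: F2, hpart, e4 ▸ List.prefix_append _ _, hj4, hpath, ?_⟩
  -- The three operations cost $53+161+97=311$. A unit of `hpot` is worth 320, which leaves 9 for
  -- the next search in the search tree.
  have he : energy (t4 :: l2 :: F2) s4 ≤ energy (t :: F) s + 311 * lg I.card := by
    rw [energy_perm hp2] at a4
    rw [energy_perm hp']
    linarith
  -- For a heavy edge the loose number drops by one and the level does not fall. For a light edge
  -- the loose number may rise by one, but the level gains one and counts twice.
  have hpot : (Ivl.loose I (Solid (t4 :: l2 :: F2)) : ℝ) - 2 * Ivl.level I j' + 1 ≤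
      Ivl.loose I (Solid (t :: F)) - 2 * Ivl.level I j := by
    rcases (Ivl.level_mono hju).eq_or_lt with hl | hl
    · have h2 : (Ivl.loose I (Solid (t4 :: l2 :: F2)) : ℝ) + 1 ≤ Ivl.loose I (Solid (t :: F)) := by
        exact_mod_cast Ivl.loose_add_one_le hI hjI hju hl hnot hyes hkeep
      have h3 : (Ivl.level I j : ℝ) ≤ Ivl.level I j' := by exact_mod_cast hl ▸ hlu
      linarith
    · have h2 : (Ivl.loose I (Solid (t4 :: l2 :: F2)) : ℝ) ≤ Ivl.loose I (Solid (t :: F)) + 1 := by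
        exact_mod_cast Ivl.loose_le_add_one hkeep
      have h3 : (Ivl.level I j : ℝ) + 1 ≤ Ivl.level I j' := by
        exact_mod_cast (Nat.succ_le_of_lt hl).trans hlu
      linarith
  have hmul := mul_le_mul_of_nonneg_left hpot (show 0 ≤ 320 * lg I.card by linarith)
  simp only [total]
  linarith

/-- `N` bounds the number of intervals that finish after `j`; it decreases because `j` moves to a
later finishing time. The level of `j` cannot exceed $\log_2 n$, so the price of the light edges is
bounded in advance. -/
theorem runs_exposeLoop (hI : Ivl.Monotonic I) : ∀ (N : ℕ) (i j : Ivl α) (t : STree α)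
    (F : List (STree α)) (s : CF α), Partitions I (t :: F) s → i ∈ t.inorder →
    t.inorder.getLast? = some j → (I.filter fun k => j.f < k.f).card < N →
    Runs (MonCF.exposeLoop i j) s fun _ s' => ∃ t' F', Partitions I (t' :: F') s' ∧
      t.inorder <+: t'.inorder ∧ Complete I t'.inorder ∧
      total I (t' :: F') s' ≤ total I (t :: F) s +
        640 * lg I.card * (Nat.log 2 I.card - Ivl.level I j) + 3 * lg I.card := by
  intro N
  induction N with
  | zero => intro i j t F s _ _ _ h; omega
  | succ N ih =>
    intro i j t F s h hi hj hN
    have hlg := one_le_lg I.card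
    rw [MonCF.exposeLoop]
    refine (runs_MonCF_rightCompatible hI h.search j).bind ?_
    rintro o s1 ⟨ho, hw⟩
    have hen := energy_of_waits (F := t :: F) hw h.search.height_le
    have h1 : Partitions I (t :: F) s1 :=
      ⟨hw.tree ▸ h.search, h.stores.of_cell_eq hw.cell, h.keys, h.solid⟩
    have htot : total I (t :: F) s1 ≤ total I (t :: F) s + 3 * lg I.card := by
      simp only [total]
      linarith
    rcases o with _ | u
    · refine runs_pure.2 ⟨t, F, h1, List.prefix_rfl, ?_, ?_⟩
      · intro k hk l hkl
        rw [hj, Option.some.injEq] at hk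
        subst hk
        exact absurd ((ho l).2 hkl) (by simp)
      · have hlev : (Ivl.level I j : ℝ) ≤ Nat.log 2 I.card := by
          exact_mod_cast Ivl.level_le I j
        have : 0 ≤ 640 * lg I.card * (Nat.log 2 I.card - Ivl.level I j) :=
          mul_nonneg (by linarith) (by linarith)
        linarith
    have hju := (ho u).1 rfl
    simp only [runs_bind]
    refine (runs_extend hI h1 hi hj hju).mono fun _ s2 h2 => h2.mono fun _ s3 h3 => h3.mono ?_
    rintro j' s4 ⟨t4, F4, c1, c2, c3, c4, c5⟩
    have hfu := hju.f_lt.trans_le (Ivl.f_le_of_path c4)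
    refine (ih i j' t4 F4 s4 c1 (c2.subset hi) c3 ?_).mono ?_
    -- The interval `u` finishes after `j` but not after the new end `j'`.
    · refine lt_of_lt_of_le (Finset.card_lt_card ?_) (Nat.le_of_lt_succ hN)
      rw [Finset.ssubset_iff_of_subset]
      · refine ⟨u, by simp [hju.mem, hju.f_lt], ?_⟩
        simpa using fun _ => Ivl.f_le_of_path c4
      · intro k hk
        rw [Finset.mem_filter] at hk ⊢
        exact ⟨hk.1, hfu.trans hk.2⟩
    · rintro _ s' ⟨t', F', d1, d2, d3, d4⟩
      refine ⟨t', F', d1, c2.trans d2, d3, d4.trans ?_⟩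
      linarith

theorem Ivl.IsLeastIn.unique (hI : Ivl.Monotonic I) {m m' : Ivl α} (h : Ivl.IsLeastIn I m)
    (h' : Ivl.IsLeastIn I m') : m = m' :=
  hI.eq_of_f_eq h.1 h'.1 (le_antisymm (h.2 _ h'.1) (h'.2 _ h.1))

/-- The data structure between two operations. -/
structure Invariant (I : Finset (Ivl α)) (F : List (STree α)) (s : CF α) : Prop
    extends Partitions I F s where
  top : ∀ m, Ivl.IsLeastIn I m → ∃ t ∈ F, t.inorder.head? = some m ∧ Complete I t.inorder

/-- The constant is $743=3+97+640+3$: finding the minimum, the first `maximum`, the light edges, and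
the last search of the loop. -/
theorem runs_exposeMinimum (hI : Ivl.Monotonic I) (h : Partitions I F s) :
    Runs MonCF.exposeMinimum s fun _ s' => ∃ F', Invariant I F' s' ∧
      total I F' s' ≤ total I F s + 743 * lg I.card ^ 2 := by
  have hlg := one_le_lg I.card
  have hsq : lg I.card ≤ lg I.card ^ 2 := by nlinarith
  rw [MonCF.exposeMinimum]
  refine (runs_MonCF_minimum hI h.search).bind ?_
  rintro o s1 ⟨ho, hw⟩
  have hen := energy_of_waits (F := F) hw h.search.height_le
  have h1 : Partitions I F s1 :=
    ⟨hw.tree ▸ h.search, h.stores.of_cell_eq hw.cell, h.keys, h.solid⟩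
  rcases o with _ | m
  · refine runs_pure.2 ⟨F, ⟨h1, fun m hm => absurd ((ho m).2 hm) (by simp)⟩, ?_⟩
    simp only [total]
    linarith
  have hm := (ho m).1 rfl
  obtain ⟨t, G, hp, hmt⟩ := exists_perm_of_mem_keys ((h.keys m).2 hm.1)
  have h2 := h1.perm hp
  simp only [MonCF.expose, runs_bind]
  refine (h2.stores.maximum hmt).mono ?_
  rintro j s2 ⟨l, a1, a2, a3, a4⟩
  have hs : ∀ a b, Solid (node l j nil :: G) a b ↔ Solid F a b := fun a b => by
    rw [solid_perm hp, solid_cons, solid_cons, a2]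
  have h3 : Partitions I (node l j nil :: G) s2 :=
    ⟨a3 ▸ h2.search, a1, fun x => by rw [← h2.keys, keys_cons, keys_cons, a2],
      fun a b hab => h.solid a b ((hs a b).1 hab)⟩
  refine (runs_exposeLoop hI _ m j _ G s2 h3 (a2 ▸ hmt) (by simp [inorder])
    (Nat.lt_succ_self _)).mono ?_
  rintro _ s' ⟨t', F', b1, b2, b3, b4⟩
  refine ⟨t' :: F', ⟨b1, fun m' hm' => ⟨t', by simp, ?_, b3⟩⟩, b4.trans ?_⟩
  · obtain rfl := hm.unique hI hm'
    have hmt' : m ∈ t'.inorder := b2.subset (a2 ▸ hmt)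
    -- The path is ordered by finishing times and contains the least interval, which must therefore
    -- be its head.
    have hpw := pairwise_f_of_isChain b1.isChain
    rcases hl : t'.inorder with _ | ⟨x, L⟩
    · simp [hl] at hmt'
    · rw [hl, List.pairwise_cons] at hpw
      rw [hl] at hmt'
      rcases List.mem_cons.1 hmt' with rfl | hmL
      · rfl
      · refine absurd (hpw.1 m hmL) (hm.2 x ?_).not_gt
        rw [← b1.keys]
        simp [hl]
  · have e : Ivl.loose I (Solid (node l j nil :: G)) = Ivl.loose I (Solid F) := by
      congr 1
      funext a b
      exact propext (hs a b)
    have h4 := log_le_lg I.card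
    have h5 : (0 : ℝ) ≤ Ivl.level I j := Nat.cast_nonneg _
    have h6 : 640 * lg I.card * (Nat.log 2 I.card - Ivl.level I j) ≤ 640 * lg I.card * lg I.card :=
      mul_le_mul_of_nonneg_left (by linarith) (by linarith)
    rw [energy_perm hp] at hen
    rw [energy_perm hp] at hen
    simp only [total, e]
    rw [energy_perm hp s]
    nlinarith

end Expose

/-! ### From the invariant to the greedy optimal set. -/

section Correctness

open STree

variable {α : Type} [LinearOrder α] {I : Finset (Ivl α)} {F : List (STree α)} {s : CF α}

theorem greedy_of_path {i j : Ivl α} (hi : Ivl.Greedy I i)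
    (h : Relation.ReflTransGen (Ivl.IsRightCompatible I) i j) : Ivl.Greedy I j := by
  induction h with
  | refl => exact hi
  | tail _ h ih => exact .next _ _ ih h

theorem mem_iff_greedy (hI : Ivl.Monotonic I) {l : List (Ivl α)} {m : Ivl α}
    (hl : l.IsChain (Ivl.IsRightCompatible I)) (hm : Ivl.IsLeastIn I m) (hh : l.head? = some m)
    (hc : Complete I l) (i : Ivl α) : i ∈ l ↔ Ivl.Greedy I i := by
  constructor
  · intro hi
    obtain ⟨l', rfl⟩ := List.head?_eq_some_iff.1 hh
    exact greedy_of_path (.first m hm) (path_of_isChain hl hi)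
  · intro h
    induction h with
    | first m' hm' =>
      obtain rfl := hm.unique hI hm'
      exact List.mem_of_head? hh
    | next i j _ hij ih =>
      obtain ⟨A, B, rfl⟩ := List.append_of_mem ih
      rcases B with _ | ⟨b, B⟩
      · exact absurd hij (hc i (by simp) j)
      · rw [hij.unique hI (isChain_iff_adj.1 hl i b ⟨A, B, rfl⟩)]
        simp

theorem STree.Holds.parent_mem {c : Ivl α → Cell α} {t : STree α} : ∀ {p : Option (Ivl α)}
    {x b : Ivl α}, Holds c p t → x ∈ t.inorder → (c x).parent = some b →
    b ∈ t.inorder ∨ p = some b := by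
  induction t with
  | nil => intro p x b _ hx; simp [inorder] at hx
  | node l y r ihl ihr =>
    rintro p x b ⟨h1, h2, h3⟩ hx hb
    simp only [inorder, List.mem_append, List.mem_cons] at hx ⊢
    rcases hx with hx | rfl | hx
    · rcases ihl h2 hx hb with h | h
      · exact .inl (.inl h)
      · exact .inl (.inr (.inl (Option.some.inj h).symm))
    · rw [h1] at hb
      exact .inr hb
    · rcases ihr h3 hx hb with h | h
      · exact .inl (.inr (.inr h))
      · exact .inl (.inr (.inl (Option.some.inj h).symm))

theorem STree.Holds.path_to_root {c : Ivl α → Cell α} {t : STree α} : ∀ {p : Option (Ivl α)}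
    {x z : Ivl α}, Holds c p t → x ∈ t.inorder → t.root = some z →
    Relation.ReflTransGen (fun a b => (c a).parent = some b) x z := by
  induction t with
  | nil => intro p x z _ hx; simp [inorder] at hx
  | node l y r ihl ihr =>
    rintro p x z ⟨h1, h2, h3⟩ hx hz
    rw [root_node, Option.some.injEq] at hz
    subst hz
    simp only [inorder, List.mem_append, List.mem_cons] at hx
    rcases hx with hx | rfl | hx
    · cases l with
      | nil => simp [inorder] at hx
      | node l' w r' => exact (ihl h2 hx rfl).tail (by rw [h2.1])
    · exact .refl
    · cases r with
      | nil => simp [inorder] at hx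
      | node l' w r' => exact (ihr h3 hx rfl).tail (by rw [h3.1])

/-- Parent links neither leave nor enter a splay tree from outside. For intervals that are not
stored this uses that their records are blank. -/
theorem sameSplayTree_iff {n : ℕ} (h : Stores n F s) {t : STree α} (ht : t ∈ F) {m i : Ivl α}
    (hm : m ∈ t.inorder) : MonCF.SameSplayTree s m i ↔ i ∈ t.inorder := by
  constructor
  · rintro ⟨z, hmz, hiz⟩
    have hz : z ∈ t.inorder := by
      clear hiz
      induction hmz with
      | refl => exact hm
      | tail _ hbc ih =>
        exact ((h.holds t ht).parent_mem ih hbc).resolve_right (by simp)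
    clear hmz
    induction hiz using Relation.ReflTransGen.head_induction_on with
    | refl => exact hz
    | @head a c hac _ ih =>
      obtain ⟨t', ht', ha⟩ : ∃ t' ∈ F, a ∈ t'.inorder := by
        by_contra hne
        rw [← mem_keys] at hne
        rw [h.blank a hne] at hac
        simp [Cell.blank] at hac
      have hc := ((h.holds t' ht').parent_mem ha hac).resolve_right (by simp)
      obtain ⟨A, B, rfl⟩ := List.append_of_mem ht
      rcases List.mem_cons.1 (List.perm_middle.mem_iff.1 ht') with rfl | ht'
      · exact ha
      · exact absurd (mem_keys.2 ⟨t', ht', hc⟩)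
          (not_mem_keys_of_mem (h.perm List.perm_middle) ih)
  · intro hi
    cases t with
    | nil => simp [inorder] at hi
    | node l y r =>
      exact ⟨y, (h.holds _ ht).path_to_root hm rfl, (h.holds _ ht).path_to_root hi rfl⟩

theorem Invariant.represents (hI : Ivl.Monotonic I) (h : Invariant I F s) :
    MonCF.Represents s I := by
  refine ⟨fun i => by rw [AVL.mem_iff, h.search.mem], fun m hm i => ?_⟩
  obtain ⟨t, ht, h1, h2⟩ := h.top m hm
  rw [sameSplayTree_iff h.stores ht (List.mem_of_head? h1)]
  obtain ⟨A, B, rfl⟩ := List.append_of_mem ht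
  exact mem_iff_greedy hI (h.toPartitions.perm List.perm_middle).isChain hm h1 h2 i

end Correctness

/-! ### The three operations -/

section Operations

open STree

variable {α : Type} [LinearOrder α] {I : Finset (Ivl α)} {F : List (STree α)} {s : CF α}

theorem runs_queryMonCF (hI : Ivl.Monotonic I) (h : Invariant I F s) (i : Ivl α) :
    Runs (MonCF.queryMonCF i) s fun b s' => ∃ F', Invariant I F' s' ∧
      (b = true ↔ Ivl.Greedy I i) ∧ total I F' s' ≤ total I F s + 100 * lg I.card := by
  have hlg := one_le_lg I.card
  rw [MonCF.queryMonCF]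
  refine (runs_MonCF_minimum hI h.search).bind ?_
  rintro o s1 ⟨ho, hw⟩
  have hen := energy_of_waits (F := F) hw h.search.height_le
  have h1 : Partitions I F s1 :=
    ⟨hw.tree ▸ h.search, h.stores.of_cell_eq hw.cell, h.keys, h.solid⟩
  rcases o with _ | m
  · refine runs_pure.2 ⟨F, ⟨h1, h.top⟩, ?_, ?_⟩
    · simp only [Bool.false_eq_true, false_iff]
      intro hg
      -- Without a least interval the inductive definition of `Greedy` has no starting point.
      have hne : ∀ j, Ivl.Greedy I j → False := by
        intro j hj
        induction hj with
        | first m hm => exact absurd ((ho m).2 hm) (by simp)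
        | next _ _ _ _ ih => exact ih
      exact hne i hg
    · simp only [total]
      linarith
  have hm := (ho m).1 rfl
  obtain ⟨t, ht, hh, hc⟩ := h.top m hm
  obtain ⟨A, B, rfl⟩ := List.append_of_mem ht
  have hp : (A ++ t :: B).Perm (t :: (A ++ B)) := List.perm_middle
  have h2 := h1.perm hp
  simp only [runs_bind]
  refine (h2.stores.find (i := i) (List.mem_of_head? hh) (pairwise_f_of_isChain h2.isChain)).mono ?_
  rintro y s' ⟨t', a1, a2, a3, a4, a5⟩
  have hs : Solid (t' :: (A ++ B)) = Solid (A ++ t :: B) := by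
    funext a b
    rw [solid_perm hp, solid_cons, solid_cons, a2]
  refine runs_pure.2 ⟨t' :: (A ++ B), ⟨⟨a4 ▸ h2.search, a1, fun x => ?_, ?_⟩, ?_⟩, ?_, ?_⟩
  · rw [← h2.keys, keys_cons, keys_cons, a2]
  · rw [hs]
    exact h.solid
  · intro m' hm'
    obtain rfl := hm.unique hI hm'
    exact ⟨t', by simp, by rw [a2]; exact hh, by rw [a2]; exact hc⟩
  · rw [decide_eq_true_iff, a3]
    exact mem_iff_greedy hI h2.isChain hm hh hc i
  · rw [energy_perm hp, energy_perm hp] at hen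
    simp only [total, hs]
    rw [energy_perm hp s]
    linarith

theorem lg_succ_le (n : ℕ) : lg (n + 1) ≤ 2 * lg n := by
  have hn : (0 : ℝ) ≤ n := n.cast_nonneg
  have : lg (n + 1) ≤ Real.logb 2 (((n : ℝ) + 2) ^ 2) := by
    refine Real.logb_le_logb_of_le (by norm_num) (by positivity) ?_
    push_cast
    nlinarith
  rwa [Real.logb_pow] at this

/-- As there are at most $n$ loose edges, this bounds the rise of the potential that is due only to
the larger factor $\mathrm{lg}(n+1)$. The reason is $\ln(1+\frac1{n+2})\le\frac1{n+2}$ and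
$\ln2\ge\frac12$. -/
theorem lg_succ_mul_le (n : ℕ) : lg (n + 1) * n ≤ lg n * n + 2 := by
  have hn : (0 : ℝ) ≤ n := n.cast_nonneg
  have h1 : lg (n + 1) - lg n = Real.log ((n + 1 + 2) / (n + 2)) / Real.log 2 := by
    rw [Real.log_div (by positivity) (by positivity), sub_div]
    simp only [lg, Real.logb]
    push_cast
    rfl
  have h2 : Real.log (((n : ℝ) + 1 + 2) / (n + 2)) ≤ 1 / (n + 2) := by
    refine (Real.log_le_sub_one_of_pos (by positivity)).trans (le_of_eq ?_)
    field_simp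
    ring
  have h3 : (1 / 2 : ℝ) ≤ Real.log 2 := by linarith [Real.log_two_gt_d9]
  have h4 : lg (n + 1) - lg n ≤ 2 * (1 / (n + 2)) := by
    rw [h1, div_le_iff₀ (by linarith)]
    have : (0 : ℝ) ≤ 1 / (n + 2) := by positivity
    nlinarith
  have h5 : 1 / ((n : ℝ) + 2) * n ≤ 1 := by
    rw [one_div_mul_eq_div, div_le_one (by positivity)]
    linarith
  nlinarith

theorem Stores.add {n : ℕ} {i : Ivl α} {s' : CF α} (h : Stores n F s) (hi : i ∉ keys F)
    (hs : s'.cell = Function.update s.cell i Cell.blank) :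
    Stores (n + 1) (node nil i nil :: F) s' := by
  refine ⟨?_, ?_, ?_, ?_⟩
  · simp only [List.mem_cons, forall_eq_or_imp]
    refine ⟨⟨by simp [hs, Cell.blank], trivial, trivial⟩, fun t ht => ?_⟩
    rw [hs, holds_update fun hi' => hi (mem_keys.2 ⟨t, ht, hi'⟩)]
    exact h.holds t ht
  · simpa [inorder] using ⟨hi, h.nodup⟩
  · intro x hx
    simp only [keys_cons, inorder, List.nil_append, List.cons_append, List.mem_cons, not_or] at hx
    rw [hs, Function.update_of_ne hx.1, h.blank x hx.2]
  · simpa [inorder] using h.length_le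

/-- A one-node tree without a parent has a blank record, so forgetting it keeps unused memory blank.
-/
theorem Stores.drop {n : ℕ} {i : Ivl α} (h : Stores (n + 1) (node nil i nil :: F) s) :
    Stores n F s := by
  refine ⟨fun t ht => h.holds t (by simp [ht]), ?_, fun x hx => ?_, ?_⟩
  · have := h.nodup
    simp only [keys_cons, List.nodup_append] at this
    exact this.2.1
  · by_cases hxi : x = i
    · rw [hxi]
      exact h.holds_head.1
    · exact h.blank x (by simp [inorder, hxi, hx])
  · simpa [inorder] using h.length_le

theorem solid_singleton_cons {i a b : Ivl α} : Solid (node nil i nil :: F) a b ↔ Solid F a b := by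
  rw [solid_cons]
  exact or_iff_right not_adj_singleton

/-- The only solid edge whose head changes by the insertion of `i` is the one that leads to the
next interval `r`. -/
theorem eq_next {i r a b : Ivl α} (hI : Ivl.Monotonic (insert i I)) (hi : i ∉ I) (hr : r ∈ I)
    (hir : i.s < r.s) (hmin : ∀ k ∈ I, i.s < k.s → r.s ≤ k.s)
    (hab : Ivl.IsRightCompatible I a b) (hai : Ivl.IsRightCompatible (insert i I) a i) :
    b = r := by
  have h0 : Ivl.Monotonic I := hI.subset (Finset.subset_insert _ _)
  have h1 := hab.f_le_of_insert hr hir hai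
  have h2 := hmin b hab.mem (hab.s_lt_of_insert hI hi hai)
  refine h0.eq_of_f_eq hab.mem hr (le_antisymm h1 (not_lt.1 fun h => ?_))
  exact h2.not_gt (h0.s_lt_of_f_lt hab.mem hr h)

/-- Exposing the minimum after the other steps of an insertion. -/
theorem runs_exposeMinimum_of_insert {i r : Ivl α} {G : List (STree α)} {s' : CF α}
    (hI : Ivl.Monotonic (insert i I)) (hi : i ∉ I) (h : Partitions (insert i I) G s')
    (hG : ∀ a b, Solid F a b → b ≠ r → Solid G a b)
    (he : energy G s' ≤ energy F s + 650 * lg I.card) :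
    Runs MonCF.exposeMinimum s' fun _ s'' => ∃ F', Invariant (insert i I) F' s'' ∧
      total (insert i I) F' s'' ≤ total I F s + 15000 * lg I.card ^ 2 := by
  refine (runs_exposeMinimum hI h).mono ?_
  rintro _ s'' ⟨F', h1, h2⟩
  refine ⟨F', h1, h2.trans ?_⟩
  have hc : (insert i I).card = I.card + 1 := Finset.card_insert_of_notMem hi
  have hl : (Ivl.loose (insert i I) (Solid G) : ℝ) ≤
      Ivl.loose I (Solid F) + 4 * Nat.log 2 (I.card + 1) + 8 := by
    have := (Ivl.loose_le_add_one (I := insert i I) hG).trans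
      (Nat.add_le_add_right (Ivl.loose_insert hI hi (Solid F)).1 1)
    have : (Ivl.loose (insert i I) (Solid G) : ℝ) ≤
      Ivl.loose I (Solid F) + (4 * Nat.log 2 (I.card + 1) + 7) + 1 := by exact_mod_cast this
    linarith
  have h3 := log_le_lg (I.card + 1)
  have h4 := lg_succ_le I.card
  have h5 := lg_succ_mul_le I.card
  have h6 := one_le_lg I.card
  have h7 : (Ivl.loose I (Solid F) : ℝ) ≤ I.card := by exact_mod_cast Ivl.loose_le_card I _
  have h8 := lg_mono (Nat.le_succ I.card)
  simp only [Nat.succ_eq_add_one] at h8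
  simp only [total, hc]
  set L := lg I.card
  set L' := lg (I.card + 1)
  set d : ℝ := (Ivl.loose I (Solid F) : ℝ)
  -- Here $\lfloor\log_2(n+1)\rfloor\le L'\le2L$ turns the 4 logarithms into $8L$.
  have h9 : L' * Ivl.loose (insert i I) (Solid G) ≤ L' * (d + 8 * L + 8) :=
    mul_le_mul_of_nonneg_left (by linarith) (by linarith)
  have h10 : L' * d ≤ L * d + 2 := by
    have : (L' - L) * d ≤ (L' - L) * I.card := mul_le_mul_of_nonneg_left h7 (by linarith)
    linarith
  have h11 : L' ^ 2 ≤ 4 * L ^ 2 := by nlinarith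
  have h12 : L' * L ≤ 2 * L ^ 2 := by nlinarith
  have h13 : L ≤ L ^ 2 := by nlinarith
  nlinarith

set_option maxHeartbeats 400000 in
-- The stored paths must be paths of the new forest before `exposeMinimum` may run. Only the solid
-- edge that leads to `r` can become wrong, and it does so exactly if its tail `j` is compatible
-- with `i`; then it is cut. The optional link is an edge of the new forest, and a further solid
-- edge cannot increase the number of loose ones, so both variants obey the same bound.
theorem runs_insertMonCF (link : Bool) {i : Ivl α} (hi : i ∉ I)
    (hI : Ivl.Monotonic (insert i I)) (h : Invariant I F s) :
    Runs (MonCF.insertMonCF link i) s fun _ s' => ∃ F', Invariant (insert i I) F' s' ∧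
      total (insert i I) F' s' ≤ total I F s + 15000 * lg I.card ^ 2 := by
  have hlg := one_le_lg I.card
  have hlg' := lg_succ_le I.card
  have hc : (insert i I).card = I.card + 1 := Finset.card_insert_of_notMem hi
  rw [MonCF.insertMonCF]
  refine (runs_treeInsert hi hI h.search).bind ?_
  rintro _ s1 ⟨a1, a2, a3⟩
  simp only [runs_bind, runs_writeCell, runs_get]
  set s2 : CF α := { s1 with cell := Function.update s1.cell i Cell.blank, clock := s1.clock + 1 }
    with hs2
  have hst2 : Stores (insert i I).card (node nil i nil :: F) s2 := by
    rw [hc]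
    exact h.stores.add (by rwa [h.keys]) (by rw [hs2, a2])
  have hen2 : energy (node nil i nil :: F) s2 ≤ energy F s + 4 * lg I.card := by
    have h1 : energy F s2 ≤ energy F s + ((s.tree.height + 1 + 1 : ℕ) : ℝ) :=
      energy_of_clock (by rw [hs2]; simp only; omega)
    have h2 := h.search.height_le
    rw [energy_cons, pot_node]
    simp only [pot_nil, size_nil]
    norm_num at *
    linarith
  refine (runs_next_of_searchTree (s := s2) a1 i).mono ?_
  rintro o s3 ⟨ho, ho', hw⟩
  have hst3 : Stores (insert i I).card (node nil i nil :: F) s3 := hst2.of_cell_eq hw.cell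
  have htr3 : SearchTree s3.tree (insert i I) := hw.tree ▸ a1
  have hen3 := energy_of_waits (F := node nil i nil :: F) hw
    (SearchTree.height_le (T := s2.tree) a1)
  rw [hc] at hen3
  have hkeys : ∀ x, x ∈ keys (node nil i nil :: F) ↔ x ∈ insert i I := fun x => by
    simp [inorder, h.keys]
  rcases o with _ | r
  -- No interval starts after `i`, so no edge is redirected and no solid edge is lost; the choice of
  -- `r` is immaterial.
  · refine runs_exposeMinimum_of_insert (r := i) hI hi (G := node nil i nil :: F) ?_ ?_ ?_
    · refine ⟨htr3, hst3, hkeys, fun a b hab => ?_⟩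
      have hab' := h.solid a b (solid_singleton_cons.1 hab)
      refine hab'.insert fun hai => ?_
      have hib := hab'.s_lt_of_insert hI hi hai
      exact ho' rfl b (Finset.mem_insert_of_mem hab'.mem) hib
    · exact fun a b hab _ => solid_singleton_cons.2 hab
    · linarith
  obtain ⟨hr, hir, hmin⟩ := (ho r).1 rfl
  have hrI : r ∈ I := Finset.mem_of_mem_insert_of_ne hr (by rintro rfl; exact hir.false)
  have hnext : ∀ a b, Ivl.IsRightCompatible I a b →
      (b = r → ¬ Ivl.IsRightCompatible (insert i I) a i) →
      Ivl.IsRightCompatible (insert i I) a b := fun a b hab hb =>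
    hab.insert fun hai => hb (eq_next hI hi hrI hir
      (fun k hk => hmin k (Finset.mem_insert_of_mem hk)) hab hai) hai
  obtain ⟨t, G, hp, hrt⟩ := exists_perm_of_mem_keys ((h.keys r).2 hrI)
  have hp2 : (node nil i nil :: F).Perm (t :: node nil i nil :: G) :=
    (hp.cons _).trans (List.Perm.swap _ _ _)
  simp only [runs_bind]
  refine ((hst3.perm hp2).predecessor hrt).mono ?_
  rintro o s4 ⟨t', A, B, b1, b2, b3, rfl, b5, b6⟩
  rw [hc] at b6
  have hsol : ∀ a b, Solid (t' :: node nil i nil :: G) a b ↔ Solid F a b := fun a b => by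
    rw [solid_perm hp, solid_cons (t := t'), solid_cons (t := t), solid_singleton_cons, b2]
  have hnd : (A ++ r :: B).Nodup := b3 ▸ (hst3.perm hp2).nodup_head
  have hrG : ∀ a, ¬ Solid G a r := fun a hs =>
    not_mem_keys_of_mem (h.stores.perm hp) hrt hs.mem.2
  have hpred : ∀ a, Solid F a r → A.getLast? = some a := fun a hs => by
    rcases solid_cons.1 ((solid_perm hp).1 hs) with hs | hs
    · exact Adj.getLast?_eq hnd (b3 ▸ hs)
    · exact absurd hs (hrG a)
  have htr4 : SearchTree s4.tree (insert i I) := b5 ▸ htr3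
  have hkeys4 : ∀ x, x ∈ keys (t' :: node nil i nil :: G) ↔ x ∈ insert i I := fun x => by
    rw [← hkeys, (keys_perm hp2).mem_iff, keys_cons, keys_cons (t := t), b2]
  have hen4 : energy (t' :: node nil i nil :: G) s4 ≤ energy F s + 206 * lg I.card := by
    rw [energy_perm hp2] at hen3
    rw [energy_perm hp2] at hen3
    rw [energy_perm hp2] at hen2
    linarith
  -- The cases in which the algorithm cuts nothing: `r` has no predecessor in its path, or the
  -- predecessor overlaps `i`.
  have unchanged : (∀ a, Solid F a r → ¬ Ivl.IsRightCompatible (insert i I) a i) →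
      Runs MonCF.exposeMinimum s4 fun _ s' => ∃ F', Invariant (insert i I) F' s' ∧
        total (insert i I) F' s' ≤ total I F s + 15000 * lg I.card ^ 2 := fun hnr =>
    runs_exposeMinimum_of_insert (r := r) hI hi ⟨htr4, b1, hkeys4, fun a b hab =>
      hnext a b (h.solid a b ((hsol a b).1 hab)) (by rintro rfl; exact hnr a ((hsol _ _).1 hab))⟩
      (fun a b hab _ => (hsol a b).2 hab) (by linarith)
  rcases hA : A.getLast? with _ | j
  · exact unchanged fun a hs => by simp [hpred a hs] at hA
  have hjr : Ivl.IsRightCompatible I j r := by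
    obtain ⟨A', rfl⟩ := List.getLast?_eq_some_iff.1 hA
    exact h.solid j r ((solid_perm hp).2 (solid_cons.2 (.inl ⟨A', B, by simp [b3]⟩)))
  by_cases hji : Ivl.Compatible j i
  swap
  · simp only [hji, if_false]
    exact unchanged fun a hs hai => by
      have := hpred a hs
      rw [hA, Option.some.injEq] at this
      exact hji (this ▸ hai.1.2.1)
  -- If `j` started after `i` finishes, it would be a later interval than `i`, yet precede the next
  -- interval `r`. So compatibility means that `j` finishes before `i` starts.
  have hji' : Ivl.IsRightCompatible (insert i I) j i := by
    refine hjr.insert_of_lt (hji.resolve_right fun hij => ?_)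
      (hI.f_lt_of_s_lt (Finset.mem_insert_self _ _) hr hir).le
    have hjI : j ∈ I := by
      rw [← h.keys, (keys_perm hp).mem_iff, keys_cons, b3]
      simp [List.mem_of_getLast? hA]
    have h1 := hmin j (Finset.mem_insert_of_mem hjI) (i.lt.trans hij)
    exact h1.not_gt (j.lt.trans hjr.lt_s)
  simp only [hji, if_true, runs_bind]
  refine (b1.split (u := r) (by rw [b2]; exact hrt)).mono ?_
  rintro _ s5 ⟨l5, r5, c1, c2, c3, c4⟩
  rw [hc] at c4
  have htr5 : SearchTree s5.tree (insert i I) := c3 ▸ htr4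
  have hkeys5 : ∀ x, x ∈ keys (l5 :: node nil r r5 :: node nil i nil :: G) ↔ x ∈ insert i I :=
    fun x => by
      rw [← hkeys4]
      simp [inorder, c2]
  have hl5 : l5.inorder = A := by
    have e : l5.inorder ++ r :: r5.inorder = A ++ r :: B := by rw [← c2, b2, b3]
    have hnd' : (l5.inorder ++ r :: r5.inorder).Nodup := by rw [e, ← b3, ← b2]; exact b1.nodup_head
    rw [List.nodup_append] at hnd'
    exact (List.append_cons_inj_of_notMem (fun hm => hnd'.2.2 r hm r (by simp) rfl)
      (List.nodup_cons.1 hnd'.2.1).1).1 e |>.1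
  have hsol5 : ∀ a b, Solid (l5 :: node nil r r5 :: node nil i nil :: G) a b ↔
      Solid F a b ∧ b ≠ r := by
    intro a b
    have hs := adj_split (a := a) (b := b) (c2 ▸ b1.nodup_head)
    rw [← c2] at hs
    rw [← hsol, solid_cons, solid_cons, solid_cons (t := t'), ← or_assoc]
    change (Adj l5.inorder a b ∨ Adj (r :: r5.inorder) a b) ∨ _ ↔ _
    rw [hs, solid_singleton_cons, or_and_right]
    refine or_congr_right ⟨fun h => ⟨h, ?_⟩, And.left⟩
    rintro rfl
    exact hrG a h
  cases link
  · simp only [Bool.false_eq_true, if_false]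
    refine runs_exposeMinimum_of_insert (r := r) hI hi ⟨htr5, c1, hkeys5, fun a b hab => ?_⟩
      (fun a b hab hb => (hsol5 a b).2 ⟨hab, hb⟩) (by linarith)
    rw [hsol5] at hab
    exact hnext a b (h.solid a b hab.1) fun e => absurd e hab.2
  · simp only [if_true, runs_bind]
    have hp6 : (l5 :: node nil r r5 :: node nil i nil :: G).Perm
        (l5 :: node nil i nil :: node nil r r5 :: G) := (List.Perm.swap _ _ _).cons _
    refine ((c1.perm hp6).join (a := j) (b := i) (by rw [hl5]; exact List.mem_of_getLast? hA)
      (by simp [inorder])).mono ?_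
    rintro _ s6 ⟨t6, d1, d2, d3, d4⟩
    rw [hc] at d4
    have hsol6 : ∀ a b, Solid (t6 :: node nil r r5 :: G) a b ↔
        Solid (l5 :: node nil r r5 :: node nil i nil :: G) a b ∨ (j = a ∧ i = b) := by
      intro a b
      rw [solid_perm hp6, solid_cons, solid_cons (t := l5), solid_singleton_cons, d2, adj_append,
        hl5, hA]
      simp only [inorder, List.nil_append, List.head?_cons, Option.some.injEq, not_adj_singleton,
        false_or]
      tauto
    refine runs_exposeMinimum_of_insert (r := r) hI hi ⟨d3 ▸ htr5, d1, fun x => ?_,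
      fun a b hab => ?_⟩ (fun a b hab hb => (hsol6 a b).2 (.inl ((hsol5 a b).2 ⟨hab, hb⟩))) ?_
    · rw [← hkeys5, (keys_perm hp6).mem_iff]
      simp [inorder, d2]
    · rcases (hsol6 a b).1 hab with hab | ⟨rfl, rfl⟩
      · rw [hsol5] at hab
        exact hnext a b (h.solid a b hab.1) fun e => absurd e hab.2
      · exact hji'
    · rw [energy_perm hp6] at c4
      linarith

/-- A removal is an insertion into `J` read backwards. No surviving solid edge becomes wrong: the
parent of a node changes only if it was `i`, and the edges at `i` have been cut. -/
theorem runs_removeMonCF {i : Ivl α} (hi : i ∈ I) (hI : Ivl.Monotonic I) (h : Invariant I F s) :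
    Runs (MonCF.removeMonCF i) s fun _ s' => ∃ F', Invariant (I.erase i) F' s' ∧
      total (I.erase i) F' s' ≤ total I F s + 15000 * lg I.card ^ 2 := by
  have hlg := one_le_lg I.card
  obtain ⟨J, rfl, hiJ⟩ : ∃ J, insert i J = I ∧ i ∉ J :=
    ⟨I.erase i, Finset.insert_erase hi, Finset.notMem_erase i I⟩
  have hc : (insert i J).card = J.card + 1 := Finset.card_insert_of_notMem hiJ
  rw [Finset.erase_insert hiJ]
  rw [MonCF.removeMonCF]
  simp only [runs_bind, runs_get]
  refine (AVL.runs_find i s.tree h.search.balanced h.search.sorted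
    ((h.search.mem i).2 hi)).mono ?_
  rintro o s1 ⟨rfl, hw⟩
  have hen := energy_of_waits (F := F) hw h.search.height_le
  have hst : Stores (insert i J).card F s1 := h.stores.of_cell_eq hw.cell
  obtain ⟨t, G, hp, hit⟩ := exists_perm_of_mem_keys ((h.keys i).2 hi)
  simp only [runs_bind]
  refine ((hst.perm hp).remove hit).mono ?_
  rintro _ s2 ⟨l, r, a1, a2, a3, a4⟩
  have htr : SearchTree s2.tree (insert i J) := by rw [a3, hw.tree]; exact h.search
  refine (runs_treeRemove hi htr).mono ?_
  rintro _ s3 ⟨b1, b2, b3⟩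
  rw [Finset.erase_insert hiJ] at b1
  have hp2 : (l :: node nil i nil :: r :: G).Perm (node nil i nil :: l :: r :: G) :=
    List.Perm.swap _ _ _
  have hst3 : Stores J.card (l :: r :: G) s3 :=
    Stores.drop (i := i) (by rw [← hc]; exact (a1.perm hp2).of_cell_eq b2)
  have hen3 : energy (l :: r :: G) s3 ≤ energy F s + 64 * lg (insert i J).card := by
    have h1 := energy_of_clock (F := l :: node nil i nil :: r :: G) b3
    have h2 := htr.height_le
    rw [energy_perm hp2] at h1 a4
    rw [energy_perm hp, energy_perm hp] at hen
    -- A single node has potential $\log_2 1=0$, so dropping it costs nothing.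
    have h3 : energy (node nil i nil :: l :: r :: G) s3 = energy (l :: r :: G) s3 := by
      rw [energy_cons, pot_node]
      simp
    rw [energy_perm hp2 s2, h3] at h1
    rw [energy_perm hp s]
    linarith
  have hnd := (h.stores.perm hp).nodup_head
  have hiG := not_mem_keys_of_mem (h.stores.perm hp) hit
  have hsol : ∀ a b, Solid (l :: r :: G) a b ↔ Solid F a b ∧ a ≠ i ∧ b ≠ i := by
    intro a b
    rw [solid_perm hp, solid_cons, solid_cons, solid_cons, a2]
    rw [a2] at hnd
    have hl : i ∉ l.inorder := fun h =>
      (List.disjoint_of_nodup_append hnd) h (by simp)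
    have hr : i ∉ r.inorder := (List.nodup_cons.1 (List.nodup_append.1 hnd).2.1).1
    have e : i :: r.inorder = [i] ++ r.inorder := rfl
    rw [adj_append, e, adj_append]
    constructor
    · rintro (h | h | h)
      · exact ⟨Or.inl (Or.inl h), fun e => hl (e ▸ h.left_mem), fun e => hl (e ▸ h.right_mem)⟩
      · exact ⟨Or.inl (Or.inr (Or.inl (Or.inr (Or.inl h)))), fun e => hr (e ▸ h.left_mem),
          fun e => hr (e ▸ h.right_mem)⟩
      · exact ⟨Or.inr h, fun e => hiG (e ▸ h.mem.1), fun e => hiG (e ▸ h.mem.2)⟩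
    · rintro ⟨(h | (h | h | ⟨h, -⟩) | ⟨-, h⟩) | h, ha, hb⟩
      · exact Or.inl h
      · exact absurd h not_adj_singleton
      · exact Or.inr (Or.inl h)
      · exact absurd (by simpa using h.symm) ha
      · exact absurd (by simpa using h.symm) hb
      · exact Or.inr (Or.inr h)
  have hkeys : ∀ x, x ∈ keys (l :: r :: G) ↔ x ∈ J := by
    intro x
    have h1 : x ∈ keys F ↔ _ := h.keys x
    have h2 := (hst3.nodup)
    rw [(keys_perm hp).mem_iff, Finset.mem_insert, keys_cons, a2] at h1
    have h3 : i ∉ keys (l :: r :: G) := by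
      have := (a1.perm hp2).nodup
      simp only [keys_cons, inorder, List.nil_append, List.cons_append, List.nodup_cons] at this
      exact this.1
    constructor
    · intro hx
      have hxi : x ≠ i := by rintro rfl; exact h3 hx
      refine (h1.1 ?_).resolve_left hxi
      simp only [keys_cons, List.mem_append, List.mem_cons] at hx ⊢
      tauto
    · intro hx
      have hxi : x ≠ i := by rintro rfl; exact hiJ hx
      have := h1.2 (.inr hx)
      simp only [keys_cons, List.mem_append, List.mem_cons, hxi, false_or] at this ⊢
      tauto
  refine (runs_exposeMinimum (hI.subset (Finset.subset_insert _ _)) ⟨b1, hst3, hkeys,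
    fun a b hab => ?_⟩).mono ?_
  · rw [hsol] at hab
    exact (h.solid a b hab.1).of_insert hab.2.2
  rintro _ s' ⟨F', c1, c2⟩
  refine ⟨F', c1, c2.trans ?_⟩
  have hl : (Ivl.loose J (Solid (l :: r :: G)) : ℝ) ≤
      Ivl.loose (insert i J) (Solid F) + (4 * Nat.log 2 (insert i J).card + 7) := by
    -- The cut solid edges are incident to `i`, hence are not edges between intervals of `J`.
    have h1 : Ivl.loose J (Solid (l :: r :: G)) ≤ Ivl.loose J (Solid F) :=
      Ivl.loose_anti fun a ha b hb hab => (hsol a b).2 ⟨hab, by rintro rfl; exact hiJ ha,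
        by rintro rfl; exact hiJ hb⟩
    have h2 := h1.trans (Ivl.loose_insert hI hiJ (Solid F)).2
    rw [← hc] at h2
    exact_mod_cast h2
  have h3 := log_le_lg (insert i J).card
  have h4 : lg J.card ≤ lg (insert i J).card := lg_mono (by omega)
  have h5 := one_le_lg J.card
  simp only [total]
  set L := lg (insert i J).card
  set L' := lg J.card
  set d : ℝ := (Ivl.loose (insert i J) (Solid F) : ℝ)
  have h6 : L' * Ivl.loose J (Solid (l :: r :: G)) ≤ L * (d + (4 * L + 7)) := by
    refine mul_le_mul h4 (by linarith) (Nat.cast_nonneg _) (by linarith)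
  have h7 : L' ^ 2 ≤ L ^ 2 := by nlinarith
  have h8 : L ≤ L ^ 2 := by nlinarith
  nlinarith

theorem Op.Admissible.monotonic {o : Op α} (hI : Ivl.Monotonic I) (h : Op.Admissible I o) :
    Ivl.Monotonic (Op.apply I o) := by
  cases o with
  | insert i => exact h.2
  | remove i => exact hI.subset (Finset.erase_subset _ _)
  | query i => exact hI

theorem runs_exec (link : Bool) (hI : Ivl.Monotonic I) (h : Invariant I F s) (o : Op α)
    (ho : Op.Admissible I o) :
    Runs (MonCF.exec link o) s fun a s' => a = Op.answer I o ∧ ∃ F',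
      Invariant (Op.apply I o) F' s' ∧
      total (Op.apply I o) F' s' ≤ total I F s + 15000 * Op.rate I.card o := by
  cases o with
  | insert i =>
    simp only [MonCF.exec, runs_bind]
    exact (runs_insertMonCF link ho.1 ho.2 h).mono fun _ s' H => runs_pure.2 ⟨rfl, H⟩
  | remove i =>
    simp only [MonCF.exec, runs_bind]
    exact (runs_removeMonCF ho hI h).mono fun _ s' H => runs_pure.2 ⟨rfl, H⟩
  | query i =>
    simp only [MonCF.exec, runs_bind]
    refine (runs_queryMonCF hI h i).mono ?_
    rintro b s' ⟨F', h1, h2, h3⟩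
    refine runs_pure.2 ⟨?_, F', h1, h3.trans ?_⟩
    · simp only [Op.answer, ← h2, Bool.decide_eq_true]
    · have := one_le_lg I.card
      change _ ≤ _ + 15000 * lg I.card
      linarith

theorem runs_execSeq (link : Bool) (ops : List (Op α)) : ∀ {I : Finset (Ivl α)}
    {F : List (STree α)} {s : CF α}, Ivl.Monotonic I → Invariant I F s →
    Op.AdmissibleSeq I ops →
    Runs (MonCF.execSeq link ops) s fun as s' => as = Op.answers I ops ∧
      Ivl.Monotonic (Op.applySeq I ops) ∧ ∃ F', Invariant (Op.applySeq I ops) F' s' ∧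
      total (Op.applySeq I ops) F' s' ≤ total I F s + 15000 * Op.totalRate I ops := by
  induction ops with
  | nil =>
    intro I F s hI h _
    exact runs_pure.2 ⟨rfl, hI, F, h, by simp [Op.applySeq, Op.totalRate]⟩
  | cons o ops ih =>
    rintro I F s hI h ⟨ho, hops⟩
    simp only [MonCF.execSeq, runs_bind]
    refine (runs_exec link hI h o ho).mono ?_
    rintro a s1 ⟨rfl, F1, h1, h2⟩
    refine (ih (ho.monotonic hI) h1 hops).mono ?_
    rintro as s2 ⟨rfl, h3, F2, h4, h5⟩
    refine runs_pure.2 ⟨rfl, h3, F2, h4, ?_⟩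
    rw [Op.totalRate, mul_add]
    exact h5.trans (by linarith)

theorem invariant_empty : Invariant (∅ : Finset (Ivl α)) [] (CF.empty α) where
  search := ⟨trivial, List.Pairwise.nil, fun i => by simp [CF.empty, AVL.toList]⟩
  stores := ⟨by simp, by simp, fun _ _ => rfl, by simp⟩
  keys := by simp
  solid a b h := by simp [Solid] at h
  top m hm := by simpa using hm.1

theorem total_empty : total (∅ : Finset (Ivl α)) [] (CF.empty α) = 0 := by
  have : Ivl.loose (∅ : Finset (Ivl α)) (Solid []) = 0 :=
    Nat.le_zero.1 (Ivl.loose_le_card _ _)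
  simp [total, energy, CF.empty, this]

theorem clock_le_total : (s.clock : ℝ) ≤ total I F s := by
  have := one_le_lg I.card
  refine (clock_le_energy F s).trans ?_
  have : 0 ≤ 320 * lg I.card * (Ivl.loose I (Solid F) : ℝ) := by positivity
  simp only [total]
  linarith

end Operations

theorem theorem1 :
    ∃ C : ℝ, ∀ (link : Bool) (ops : List (Op ℝ)), Op.AdmissibleSeq ∅ ops →
      ∃ c : CF ℝ,
        (MonCF.execSeq link ops).run (CF.empty ℝ) = some (Op.answers ∅ ops, c) ∧
        MonCF.Represents c (Op.applySeq ∅ ops) ∧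
        (c.clock : ℝ) ≤ C * Op.totalRate ∅ ops := by
  refine ⟨15000, fun link ops h => ?_⟩
  obtain ⟨as, c, h1, rfl, h2, F, h3, h4⟩ :=
    runs_execSeq link ops (fun i hi => by simp at hi) invariant_empty h
  rw [total_empty, zero_add] at h4
  -- The potential vanishes at the start and is never negative, so the clock is bounded by the sum
  -- of the amortised costs.
  exact ⟨c, h1, h3.represents h2, clock_le_total.trans h4⟩
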